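/- **Definitions.** For a positive integer $\Delta$ let $\overline{P_\Delta}$ be the set of integer vectors $(x,y)$ with $\gcd(x,y)=1$ and $1\le x,y\le\Delta$, ordered by slope $y/x$; the *boundary vectors* are $(1,0)$ (slope $0$) and $(0,1)$ (slope $\infty$). Positive integers $(f,d)$ form a *valid pair* if $f\ge d$ and, for every $\Delta\ge 1$ and any two vectors that are consecutive by slope in $\overline{P_\Delta}\cup\{(1,0),(0,1)\}$, at least $f$ vectors of $\overline{P_{d\Delta}}\setminus\overline{P_\Delta}$ have slope strictly between theirs. Let $T$ be a tree with $n\ge 1$ vertices, a root $r$, and a left-to-right (ccw) order of the children of each vertex. Leaves are the non-root vertices without children. A *length decreasing path decomposition* of $T$ is a sequence of paths $b_1,\dots,b_t$ obtained as follows: with $T_0=\{r\}$ and $T_k=T_0\cup b_1\cup\dots\cup b_k$, the path $b_{k+1}$ goes from a leaf $l_{k+1}$ not used before up to the first vertex of $T_k$ on the way to $r$ (its attachment), where $l_{k+1}$ maximizes the length of this path among all unused leaves (ties broken arbitrarily), until all leaves are used. Put $c=f+1$ and $K=\lceil\log_c n\rceil$. The path $b_i$, with $|b_i|$ edges, has *level*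 $1$ if $\frac{n-1}{c}\le |b_i|\le n-1$, and level $j$ ($1<j\le K$) if $\frac{n-1}{c^{j}}\le |b_i|<\frac{n-1}{c^{j-1}}$. Vector sets $R_1,\dots,R_K$ are chosen as follows: $R_1$ consists of $(1,1)$ together with $f$ vectors of $\overline{P_d}\setminus\overline{P_1}$ with slope between those of $(1,0)$ and $(1,1)$, and $f$ such vectors with slope between those of $(1,1)$ and $(0,1)$; $R_{j+1}$ consists of exactly $f$ vectors of $\overline{P_{d^{j+1}}}\setminus\overline{P_{d^{j}}}$ with slope strictly between each two consecutive vectors of $R_1\cup\dots\cup R_j\cup\{(1,0),(0,1)\}$ (the choices are arbitrary). *Optimal Draw*, on input $T$ and $(f,d)$: compute a length decreasing path decomposition and vector sets $R_1,\dots,R_K$. Go through the paths in the left-to-right order of their leaves, and assign to a path of level $j$ the vector of smallest slope in $R_1\cup\dots\cup R_j$ whose slope exceeds that of all vectors assigned so far. Draw $r$ at $(0,0)$, and every other vertex at the position of its parent plus the vector of the path containing the edge to its parent. A *monotone drawing* of $T$ is a drawing with distinct vertices at distinct points, edges drawn as straight segments without crossings (two different edges meet only at a common end vertex), in which any two vertices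 are joined by a path whose vertices have, in some direction, orthogonal projections in the same strict order as along the path. **Theorem.** Let $(f,d)$ be a valid pair. For every rooted ordered tree $T$ with $n$ vertices, Optimal Draw can always be carried out to the end, whatever arbitrary choices are made (in particular all required vectors exist), and every drawing it can produce is a monotone drawing of $T$ on an $I\times I$ integer grid ($I$ columns and $I$ rows) with $$I\le\frac{(f+1)\,d}{(f+1)-d}\,n .$$ Moreover, Optimal Draw can be implemented to run in $O(n)$ time: there is a single word RAM program that, given adjacency lists of $T$, the root, and a valid pair $(f,d)$, outputs the coordinates of a drawing produced by Optimal Draw after at most $C\,n$ steps, using only words of value at most $C\,n^{C}$, where $C$ depends only on $(f,d)$. -/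

import Mathlib

/-! ### Straight-line grid drawings and monotone drawings -/

/-- The point of the real plane with the given integer coordinates. -/
def toPlane (p : ℤ × ℤ) : ℝ × ℝ := ((p.1 : ℝ), (p.2 : ℝ))

/-- Straight-line drawing without crossings: distinct vertices are drawn at distinct points, and
the segments of two different edges meet only at the image of a common end vertex. -/
def IsStraightLineDrawing {V : Type*} (G : SimpleGraph V) (pos : V → ℤ × ℤ) : Prop :=
  Function.Injective pos ∧
  ∀ u v x y : V, G.Adj u v → G.Adj x y → s(u, v) ≠ s(x, y) →
    ∀ z : ℝ × ℝ, z ∈ segment ℝ (toPlane (pos u)) (toPlane (pos v)) →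
      z ∈ segment ℝ (toPlane (pos x)) (toPlane (pos y)) →
      ∃ w : V, w ∈ s(u, v) ∧ w ∈ s(x, y) ∧ z = toPlane (pos w)

/-- A walk is monotone in the drawing `pos` if, for some direction `l`, the orthogonal projections
of its vertices on `l` appear in the order in which the vertices appear along the walk. -/
def IsMonotoneWalk {V : Type*} {G : SimpleGraph V} (pos : V → ℤ × ℤ) {u w : V}
    (p : G.Walk u w) : Prop :=
  ∃ l : ℝ × ℝ, l ≠ 0 ∧
    p.support.Pairwise fun a b =>
      l.1 * (toPlane (pos a)).1 + l.2 * (toPlane (pos a)).2 <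
        l.1 * (toPlane (pos b)).1 + l.2 * (toPlane (pos b)).2

/-- A monotone drawing: a straight-line drawing in which every two vertices are joined by a
monotone path. -/
def IsMonotoneDrawing {V : Type*} (G : SimpleGraph V) (pos : V → ℤ × ℤ) : Prop :=
  IsStraightLineDrawing G pos ∧
  ∀ u w : V, ∃ p : G.Walk u w, p.IsPath ∧ IsMonotoneWalk pos p

/-- All vertices lie on a grid of `I` columns and `I` rows with lower left corner `(0, 0)`. -/
def IsOnGrid {V : Type*} (pos : V → ℤ × ℤ) (I : ℕ) : Prop :=
  ∀ v, 0 ≤ (pos v).1 ∧ (pos v).1 < I ∧ 0 ≤ (pos v).2 ∧ (pos v).2 < I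

/-! ### Rooted ordered trees -/

/-- A tree on the vertices `0, …, n - 1` with a root and with adjacency lists. The order in which
the children of a vertex occur in its adjacency list is their counterclockwise (left to right)
order. -/
structure OrderedTree (n : ℕ) where
  graph : SimpleGraph (Fin n)
  isTree : graph.IsTree
  root : Fin n
  adj : Fin n → List (Fin n)
  adj_nodup : ∀ v, (adj v).Nodup
  mem_adj : ∀ v w, w ∈ adj v ↔ graph.Adj v w

namespace OrderedTree

variable {n : ℕ}

/-- `u` is an ancestor of `v` (or `v` itself): it lies on the path from the root to `v`. -/
def Anc (T : OrderedTree n) (u v : Fin n) : Prop :=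
  T.graph.dist T.root u + T.graph.dist u v = T.graph.dist T.root v

/-- `v` is a child of `u`. -/
def IsChild (T : OrderedTree n) (u v : Fin n) : Prop :=
  T.graph.Adj u v ∧ T.Anc u v

/-- A leaf: a vertex other than the root without children. -/
def IsLeaf (T : OrderedTree n) (v : Fin n) : Prop :=
  v ≠ T.root ∧ ∀ w, ¬ T.IsChild v w

/-- `a` precedes `b` in the left to right order: they lie below two children `c₁`, `c₂` of a common
vertex, and `c₁` comes before `c₂`. On the leaves this is a strict linear order. -/
def LeftOf (T : OrderedTree n) (a b : Fin n) : Prop :=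
  ∃ u c₁ c₂, T.IsChild u c₁ ∧ T.IsChild u c₂ ∧ [c₁, c₂].Sublist (T.adj u) ∧
    T.Anc c₁ a ∧ T.Anc c₂ b

/-- The vertices of the path from `l` up to its ancestor `u`. -/
def pathUp (T : OrderedTree n) (l u : Fin n) : Set (Fin n) :=
  {v | T.Anc u v ∧ T.Anc v l}

/-- `u` is the attachment of `l` in `S`: the first vertex in `S` on the path from `l` to the
root. -/
def IsAttachment (T : OrderedTree n) (S : Set (Fin n)) (l u : Fin n) : Prop :=
  u ∈ S ∧ T.Anc u l ∧ ∀ w ∈ S, T.Anc w l → T.Anc w u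

/-- The vertices of the union of the paths from `leaf i` up to `attach i` with `i < k`; the root
is always included, so that the first path of a decomposition ends at the root. -/
def unionBefore (T : OrderedTree n) {t : ℕ} (leaf attach : Fin t → Fin n) (k : Fin t) :
    Set (Fin n) :=
  {T.root} ∪ {v | ∃ i, i < k ∧ v ∈ T.pathUp (leaf i) (attach i)}

end OrderedTree

/-! ### Path decompositions -/

/-- The path decomposition of `T` with respect to an enumeration `leaf` of its leaves: the `k`-th
path goes from `leaf k` up to the attachment of `leaf k` in the union of the earlier paths. -/
structure PathDecomposition {n : ℕ} (T : OrderedTree n) where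
  t : ℕ
  leaf : Fin t → Fin n
  leaf_injective : Function.Injective leaf
  range_leaf : Set.range leaf = {v | T.IsLeaf v}
  attach : Fin t → Fin n
  isAttachment : ∀ k, T.IsAttachment (T.unionBefore leaf attach k) (leaf k) (attach k)

namespace PathDecomposition

variable {n : ℕ} {T : OrderedTree n}

/-- The number of edges of the `k`-th path. -/
noncomputable def length (B : PathDecomposition T) (k : Fin B.t) : ℕ :=
  T.graph.dist (B.leaf k) (B.attach k)

/-- The edges of the `k`-th path are those joining a vertex `v` of this set to its parent. -/
def lowerEnds (B : PathDecomposition T) (k : Fin B.t) : Set (Fin n) :=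
  T.pathUp (B.leaf k) (B.attach k) \ {B.attach k}

/-- Length decreasing path decomposition: each new leaf is one whose path to its attachment is
the longest among all leaves not used before. -/
def IsLengthDecreasing (B : PathDecomposition T) : Prop :=
  ∀ k, ∀ l, T.IsLeaf l → (∀ i, i < k → B.leaf i ≠ l) →
    ∀ u, T.IsAttachment (T.unionBefore B.leaf B.attach k) l u → T.graph.dist l u ≤ B.length k

/-- The `k`-th path belongs to the class `D_j` (`1 ≤ j ≤ K = ⌈log_c n⌉`) of the `c`-partition:
its length is in `[(n-1)/c, n-1]` if `j = 1`, and in `[(n-1)/c^j, (n-1)/c^(j-1))` if `j > 1`. -/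
def IsLevel (B : PathDecomposition T) (c : ℕ) (k : Fin B.t) (j : ℕ) : Prop :=
  1 ≤ j ∧ j ≤ Nat.clog c n ∧
  ((n : ℝ) - 1) / (c : ℝ) ^ j ≤ (B.length k : ℝ) ∧
  (j = 1 → (B.length k : ℝ) ≤ (n : ℝ) - 1) ∧
  (1 < j → (B.length k : ℝ) < ((n : ℝ) - 1) / (c : ℝ) ^ (j - 1))

end PathDecomposition

/-! ### Primitive vectors and valid pairs -/

/-- The primitive vectors of size `m`: coprime pairs `(x, y)` with `1 ≤ x, y ≤ m`. -/
def primVec (m : ℕ) : Finset (ℕ × ℕ) :=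
  (Finset.Icc 1 m ×ˢ Finset.Icc 1 m).filter fun v => Nat.Coprime v.1 v.2

/-- The boundary vectors. -/
def boundaryVec : Finset (ℕ × ℕ) := {(1, 0), (0, 1)}

/-- `(x₁, y₁)` has smaller slope than `(x₂, y₂)`: `y₁ / x₁ < y₂ / x₂`, where `1 / 0 = ∞`. -/
def SlopeLT (u v : ℕ × ℕ) : Prop := u.2 * v.1 < v.2 * u.1

instance (u v : ℕ × ℕ) : Decidable (SlopeLT u v) :=
  inferInstanceAs (Decidable (u.2 * v.1 < v.2 * u.1))

/-- `u` and `v` are consecutive in `S` in the order of slopes, `u` first. -/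
def Consecutive (S : Finset (ℕ × ℕ)) (u v : ℕ × ℕ) : Prop :=
  u ∈ S ∧ v ∈ S ∧ SlopeLT u v ∧ ∀ w ∈ S, ¬ (SlopeLT u w ∧ SlopeLT w v)

/-- The vectors of `S` with slope strictly between those of `u` and `v`. -/
def vecBetween (S : Finset (ℕ × ℕ)) (u v : ℕ × ℕ) : Finset (ℕ × ℕ) :=
  S.filter fun w => SlopeLT u w ∧ SlopeLT w v

/-- `(f, d)` is a valid pair. -/
def ValidPair (f d : ℕ) : Prop :=
  0 < f ∧ 0 < d ∧ d ≤ f ∧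
  ∀ m : ℕ, 0 < m → ∀ u v : ℕ × ℕ, Consecutive (primVec m ∪ boundaryVec) u v →
    f ≤ (vecBetween (primVec (d * m) \ primVec m) u v).card

/-- The union `R₁ ∪ … ∪ R_j`. -/
def unionUpTo (R : ℕ → Finset (ℕ × ℕ)) (j : ℕ) : Finset (ℕ × ℕ) :=
  (Finset.Icc 1 j).biUnion R

/-- `R₁, …, R_K` is a possible outcome of the construction of the vector set: `R₁` consists of
`(1, 1)`, of `f` vectors of `primVec d \ primVec 1` between `(1, 0)` and `(1, 1)`, and of `f` such
vectors between `(1, 1)` and `(0, 1)`; and `R_{j+1}` consists of exactly `f` vectors of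
`primVec (d ^ (j + 1)) \ primVec (d ^ j)` between any two consecutive vectors of
`R₁ ∪ … ∪ R_j ∪ {(1, 0), (0, 1)}`. -/
def IsVectorFamily (f d K : ℕ) (R : ℕ → Finset (ℕ × ℕ)) : Prop :=
  (1 ≤ K → ∃ S₁ S₂ : Finset (ℕ × ℕ),
    S₁ ⊆ vecBetween (primVec d \ primVec 1) (1, 0) (1, 1) ∧ S₁.card = f ∧
    S₂ ⊆ vecBetween (primVec d \ primVec 1) (1, 1) (0, 1) ∧ S₂.card = f ∧
    R 1 = S₁ ∪ S₂ ∪ {(1, 1)}) ∧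
  ∀ j, 1 ≤ j → j < K →
    R (j + 1) ⊆ primVec (d ^ (j + 1)) \ primVec (d ^ j) ∧
    ∀ u v, Consecutive (unionUpTo R j ∪ boundaryVec) u v → (vecBetween (R (j + 1)) u v).card = f

/-! ### The algorithm Optimal Draw -/

/-- The vector assignment: the paths are treated from left to right, and a path of level `j`
receives the next vector (the one of smallest slope beyond all vectors assigned to paths further
left) that belongs to `R₁ ∪ … ∪ R_j`. -/
def IsAssignment {n : ℕ} {T : OrderedTree n} (B : PathDecomposition T) (c : ℕ)
    (R : ℕ → Finset (ℕ × ℕ)) (a : Fin B.t → ℕ × ℕ) : Prop :=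
  ∀ k, ∃ j, B.IsLevel c k j ∧
    a k ∈ unionUpTo R j ∧
    (∀ i, T.LeftOf (B.leaf i) (B.leaf k) → SlopeLT (a i) (a k)) ∧
    ∀ w ∈ unionUpTo R j, (∀ i, T.LeftOf (B.leaf i) (B.leaf k) → SlopeLT (a i) w) →
      ¬ SlopeLT w (a k)

/-- The drawing step: the root is drawn at the origin, and every other vertex `v` is drawn at the
position of its parent plus the vector of the path that contains the edge from `v` to its
parent. -/
def IsDrawnBy {n : ℕ} {T : OrderedTree n} (B : PathDecomposition T) (a : Fin B.t → ℕ × ℕ)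
    (pos : Fin n → ℤ × ℤ) : Prop :=
  pos T.root = (0, 0) ∧
  ∀ k, ∀ v ∈ B.lowerEnds k, ∀ u, T.IsChild u v →
    pos v = ((pos u).1 + ((a k).1 : ℤ), (pos u).2 + ((a k).2 : ℤ))

/-- `pos` is a possible output of Optimal Draw on the tree `T` and the pair `(f, d)`. (The algorithm
breaks ties in the decomposition and selects the vectors of the family arbitrarily.) -/
def OptimalDraw {n : ℕ} (T : OrderedTree n) (f d : ℕ) (pos : Fin n → ℤ × ℤ) : Prop :=
  ∃ B : PathDecomposition T, B.IsLengthDecreasing ∧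
  ∃ R : ℕ → Finset (ℕ × ℕ), IsVectorFamily f d (Nat.clog (f + 1) n) R ∧
  ∃ a : Fin B.t → ℕ × ℕ, IsAssignment B (f + 1) R a ∧ IsDrawnBy B a pos

/-! ### Word RAM programs

A program works on registers and on arrays of words, a word being a natural number of bounded
size. Every operation on words and every array access counts one step. -/

namespace RAM

/-- The contents of the registers and of the arrays. -/
structure State where
  reg : ℕ → ℕ
  arr : ℕ → ℕ → ℕ

/-- Operations on words: sum, truncated difference, product, integer quotient, and the comparisons
`<` and `=` (with result `1` or `0`). -/
inductive Op
  | add | sub | mul | div | lt | eq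

def Op.eval : Op → ℕ → ℕ → ℕ
  | .add, a, b => a + b
  | .sub, a, b => a - b
  | .mul, a, b => a * b
  | .div, a, b => a / b
  | .lt, a, b => if a < b then 1 else 0
  | .eq, a, b => if a = b then 1 else 0

/-- Expressions: constants, registers, array entries (array `a` at a computed index), and
operations. -/
inductive Expr
  | lit (k : ℕ)
  | reg (x : ℕ)
  | get (a : ℕ) (i : Expr)
  | op (o : Op) (e₁ e₂ : Expr)

namespace Expr

def eval (s : State) : Expr → ℕ
  | lit k => k
  | reg x => s.reg x
  | get a i => s.arr a (i.eval s)
  | op o e₁ e₂ => o.eval (e₁.eval s) (e₂.eval s)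

/-- The number of steps needed to evaluate an expression. -/
def cost : Expr → ℕ
  | lit _ => 1
  | reg _ => 1
  | get _ i => i.cost + 1
  | op _ e₁ e₂ => e₁.cost + e₂.cost + 1

/-- All values that occur in the evaluation are at most `W`. -/
def Fits (W : ℕ) (s : State) : Expr → Prop
  | lit k => k ≤ W
  | reg x => s.reg x ≤ W
  | get a i => i.Fits W s ∧ s.arr a (i.eval s) ≤ W
  | op o e₁ e₂ => e₁.Fits W s ∧ e₂.Fits W s ∧ o.eval (e₁.eval s) (e₂.eval s) ≤ W

end Expr

/-- Programs. -/
inductive Prog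
  | skip
  | assign (x : ℕ) (e : Expr)
  | store (a : ℕ) (i e : Expr)
  | seq (p q : Prog)
  | ite (e : Expr) (p q : Prog)
  | loop (e : Expr) (p : Prog)

def State.setReg (s : State) (x v : ℕ) : State :=
  { s with reg := Function.update s.reg x v }

def State.setArr (s : State) (a i v : ℕ) : State :=
  { s with arr := Function.update s.arr a (Function.update (s.arr a) i v) }

/-- `Exec W p s τ s'`: the program `p`, started in the state `s`, halts in the state `s'` after
exactly `τ` steps, and all words that it handles are at most `W`. A condition is true if its value
is nonzero; `loop e p` is the loop "while `e` do `p`". -/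
inductive Exec (W : ℕ) : Prog → State → ℕ → State → Prop
  | skip (s : State) : Exec W .skip s 1 s
  | assign (s : State) (x : ℕ) (e : Expr) (he : e.Fits W s) :
      Exec W (.assign x e) s (e.cost + 1) (s.setReg x (e.eval s))
  | store (s : State) (a : ℕ) (i e : Expr) (hi : i.Fits W s) (he : e.Fits W s) :
      Exec W (.store a i e) s (i.cost + e.cost + 1) (s.setArr a (i.eval s) (e.eval s))
  | seq {p q : Prog} {s s₁ s₂ : State} {τ₁ τ₂ : ℕ} (hp : Exec W p s τ₁ s₁)
      (hq : Exec W q s₁ τ₂ s₂) : Exec W (.seq p q) s (τ₁ + τ₂) s₂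
  | ite_true {e : Expr} {p q : Prog} {s s₁ : State} {τ : ℕ} (hf : e.Fits W s)
      (he : e.eval s ≠ 0) (hp : Exec W p s τ s₁) : Exec W (.ite e p q) s (e.cost + 1 + τ) s₁
  | ite_false {e : Expr} {p q : Prog} {s s₁ : State} {τ : ℕ} (hf : e.Fits W s)
      (he : e.eval s = 0) (hq : Exec W q s τ s₁) : Exec W (.ite e p q) s (e.cost + 1 + τ) s₁
  | loop_true {e : Expr} {p : Prog} {s s₁ s₂ : State} {τ₁ τ₂ : ℕ} (hf : e.Fits W s)
      (he : e.eval s ≠ 0) (hp : Exec W p s τ₁ s₁) (hl : Exec W (.loop e p) s₁ τ₂ s₂) :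
      Exec W (.loop e p) s (e.cost + 1 + τ₁ + τ₂) s₂
  | loop_false {e : Expr} {p : Prog} {s : State} (hf : e.Fits W s) (he : e.eval s = 0) :
      Exec W (.loop e p) s (e.cost + 1) s

/-- The initial state for the tree `T` and the pair `(f, d)`. Registers `0, 1, 2, 3` contain `n`,
the root, `f` and `d`; array `1` contains the concatenation of the adjacency lists of the vertices
`0, …, n - 1`, and array `0` contains at index `v ≤ n` the position in array `1` at which the
adjacency list of `v` starts (the total length for `v = n`). Everything else is zero. -/
def input {n : ℕ} (T : OrderedTree n) (f d : ℕ) : State where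
  reg x := [n, (T.root : ℕ), f, d].getD x 0
  arr a i :=
    if a = 0 then (if i ≤ n then (((List.ofFn T.adj).take i).flatten).length else 0)
    else if a = 1 then (((List.ofFn T.adj).flatten).map fun w : Fin n => (w : ℕ)).getD i 0
    else 0

/-- The drawing in the final state: arrays `2` and `3` contain the coordinates of the vertices. -/
def output (n : ℕ) (s : State) (v : Fin n) : ℤ × ℤ :=
  ((s.arr 2 (v : ℕ) : ℤ), (s.arr 3 (v : ℕ) : ℤ))

end RAM

/-! Monotonicity. The assigned vectors are primitive with positive entries, and their slopes
increase from left to right. So a line separates the edge directions below two siblings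
(`exists_separating`). A path between a vertex and a descendant is monotone in direction `±(1, 1)`,
a path through a branching vertex in the direction normal to the separating line. The same
projections show that two edges meet only in a common end vertex (`isMonotoneDrawing`).

Sufficiency of the vectors. Put `c = f + 1`. Each new level splits every gap into `c` gaps, so
exactly `c ^ K` vectors have slope at most `1`, and passing a gap of level `j` passes `c ^ (K - j)`
vectors (`card_gaps_consecutive`). Thus a path of level `j` consumes at most `c ^ (K - j)` vectors.
It has at least `(n - 1) / c ^ j` edges, and all paths together have at most `n - 1` edges, so at
most `c ^ K` vectors are consumed (`sum_pow_level_le`) and `(1, 1)` is never passed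
(`exists_isAssignment`).

Size. In a length decreasing decomposition nothing below a path is farther from its attachment than
its leaf (`IsLengthDecreasing.depth_le`). Hence at most `(n - 1) / c ^ (j - 1)` edges of level `j`
lie above a given vertex, each adding at most `d ^ j` to a coordinate. The geometric series of ratio
`d / c` gives `c d / (c - d) * (n - 1)` (`sum_pow_level_path_le`).

Linear time. The decomposition is obtained by continuing every path into a highest child. Sorting
the paths by length is needed only in the proof (`exists_pathDecomposition`), because the paths and
their lengths do not depend on the order. The vectors of slope at most `1` are chosen as Farey
fractions: by validity the `f` terms that follow a member of order `d ^ j` in the sequence of order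
`d ^ (j + 1)` stay in its gap, and the recurrence for Farey neighbours produces them one by one
(`exists_gap_family`). The `i`-th vector of level `j` is then the vector with index `i * c ^ (K -
j)` of level `K`, so an assignment step moves to the next multiple of `c ^ (K - j)`
(`IsLongPathData.optimalDraw`). The program consists of a breadth first search, sweeps along its
order for heights, path ends, leaf counts and leaf ranks, tables of strides and vectors, and a final
sweep for the coordinates. -/

theorem List.pair_sublist_iff_exists_getElem {α : Type*} {l : List α} {a b : α} :
    [a, b].Sublist l ↔ ∃ i j, ∃ (hi : i < l.length) (hj : j < l.length),
      i < j ∧ l[i] = a ∧ l[j] = b := by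
  constructor
  · intro h
    obtain ⟨f, hf⟩ := List.sublist_iff_exists_fin_orderEmbedding_get_eq.1 h
    have h0 := hf ⟨0, by simp⟩
    have h1 := hf ⟨1, by simp⟩
    refine ⟨f ⟨0, by simp⟩, f ⟨1, by simp⟩, (f _).2, (f _).2, ?_, ?_, ?_⟩
    · exact f.strictMono (by simp)
    · simpa using h0.symm
    · simpa using h1.symm
  · rintro ⟨i, j, hi, hj, hij, rfl, rfl⟩
    have h1 : [l[i]].Sublist (l.take j) := by
      rw [List.singleton_sublist]
      exact List.mem_take_iff_getElem.2 ⟨i, by simp [hij, hi], rfl⟩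
    have h2 : [l[j]].Sublist (l.drop j) := by
      rw [List.singleton_sublist]
      exact List.mem_drop_iff_getElem.2 ⟨0, by simp [hj], by simp⟩
    have := h1.append h2
    rwa [List.take_append_drop] at this

/-! ### Ancestors, parents and the left-to-right order in a rooted tree. -/

namespace OrderedTree

variable {n : ℕ} (T : OrderedTree n)

/-- The distance from the root. -/
noncomputable def depth (v : Fin n) : ℕ := T.graph.dist T.root v

variable {T}

theorem anc_iff_depth {u v : Fin n} : T.Anc u v ↔ T.depth u + T.graph.dist u v = T.depth v :=
  Iff.rfl

@[simp] theorem depth_root : T.depth T.root = 0 := by simp [depth]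

theorem depth_eq_zero {v : Fin n} : T.depth v = 0 ↔ v = T.root := by
  rw [depth, T.isTree.connected.dist_eq_zero_iff]
  exact eq_comm

theorem isChild_iff {u v : Fin n} : T.IsChild u v ↔ T.graph.Adj u v ∧ T.depth v = T.depth u + 1 := by
  unfold IsChild
  rw [anc_iff_depth]
  refine and_congr_right fun h => ?_
  rw [SimpleGraph.dist_eq_one_iff_adj.2 h]
  exact eq_comm

theorem IsChild.depth {u v : Fin n} (h : T.IsChild u v) : T.depth v = T.depth u + 1 :=
  (isChild_iff.1 h).2

theorem IsChild.ne_root {u v : Fin n} (h : T.IsChild u v) : v ≠ T.root := by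
  rintro rfl
  have := h.depth
  simp at this

theorem IsChild.ne {u v : Fin n} (h : T.IsChild u v) : u ≠ v := h.1.ne

theorem isChild_or_isChild_of_adj {u v : Fin n} (h : T.graph.Adj u v) :
    T.IsChild u v ∨ T.IsChild v u := by
  rcases T.isTree.dist_eq_dist_add_one_of_adj T.root h with h1 | h1
  · exact Or.inr (isChild_iff.2 ⟨h.symm, h1⟩)
  · exact Or.inl (isChild_iff.2 ⟨h, h1⟩)

/-- A shortest walk from the root to a parent of `v`, extended by the edge to `v`, is a path; a tree
has only one path from the root to `v`, and its penultimate vertex is the parent. -/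
theorem IsChild.unique {u u' v : Fin n} (h : T.IsChild u v) (h' : T.IsChild u' v) : u = u' := by
  have key : ∀ w, T.IsChild w v → ∃ p : T.graph.Walk T.root v, p.IsPath ∧ p.penultimate = w := by
    intro w hw
    obtain ⟨p, hp⟩ := T.isTree.connected.exists_walk_length_eq_dist T.root w
    refine ⟨p.concat hw.1, ?_, by simp⟩
    apply SimpleGraph.Walk.isPath_of_length_eq_dist
    rw [SimpleGraph.Walk.length_concat, hp]
    exact hw.depth.symm
  obtain ⟨p, hp, rfl⟩ := key u h
  obtain ⟨q, hq, rfl⟩ := key u' h'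
  rw [(T.isTree.existsUnique_path _ _).unique hp hq]

theorem exists_adj_dist {u v : Fin n} (h : u ≠ v) :
    ∃ w, T.graph.Adj w v ∧ T.graph.dist u w + 1 = T.graph.dist u v := by
  obtain ⟨p, hp⟩ := T.isTree.connected.exists_walk_length_eq_dist u v
  have hn : ¬ p.Nil := fun hn => h hn.eq
  refine ⟨p.penultimate, p.adj_penultimate hn, ?_⟩
  have h1 := SimpleGraph.Walk.length_dropLast_add_one hn
  have h2 := SimpleGraph.dist_le p.dropLast
  have h3 := T.isTree.connected.dist_triangle (u := u) (v := p.penultimate) (w := v)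
  rw [SimpleGraph.dist_eq_one_iff_adj.2 (p.adj_penultimate hn)] at h3
  omega

theorem exists_isChild {v : Fin n} (h : v ≠ T.root) : ∃ u, T.IsChild u v := by
  obtain ⟨w, hw, hd⟩ := exists_adj_dist (T := T) h.symm
  exact ⟨w, isChild_iff.2 ⟨hw, hd.symm⟩⟩

open Classical in
/-- The parent of a vertex; the parent of the root is the root. -/
noncomputable def par (T : OrderedTree n) (v : Fin n) : Fin n :=
  if h : v = T.root then T.root else (exists_isChild h).choose

theorem isChild_par {v : Fin n} (h : v ≠ T.root) : T.IsChild (T.par v) v := by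
  rw [par, dif_neg h]
  exact (exists_isChild h).choose_spec

@[simp] theorem par_root : T.par T.root = T.root := by simp [par]

theorem IsChild.par_eq {u v : Fin n} (h : T.IsChild u v) : T.par v = u :=
  (isChild_par h.ne_root).unique h

theorem depth_par {v : Fin n} (h : v ≠ T.root) : T.depth v = T.depth (T.par v) + 1 :=
  (isChild_par h).depth

@[refl] theorem anc_refl (v : Fin n) : T.Anc v v := by simp [Anc]

theorem Anc.depth_le {u v : Fin n} (h : T.Anc u v) : T.depth u ≤ T.depth v := by
  rw [anc_iff_depth] at h; omega

/-- This turns the metric definition of `Anc` into a recursion towards the root, on which the later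
inductions rest. By the triangle inequality the last vertex before `v` on a shortest walk from an
ancestor is the parent of `v`. -/
theorem anc_iff {u v : Fin n} : T.Anc u v ↔ u = v ∨ (v ≠ T.root ∧ T.Anc u (T.par v)) := by
  constructor
  · intro h
    by_cases huv : u = v
    · exact Or.inl huv
    right
    obtain ⟨w, hw, hd⟩ := exists_adj_dist (T := T) huv
    have h1 := T.isTree.connected.dist_triangle (u := T.root) (v := u) (w := w)
    have h2 := T.isTree.connected.dist_triangle (u := T.root) (v := w) (w := v)
    rw [SimpleGraph.dist_eq_one_iff_adj.2 hw] at h2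
    have h3 : T.graph.dist T.root u + T.graph.dist u v = T.graph.dist T.root v := h
    have hc : T.IsChild w v := isChild_iff.2 ⟨hw, by unfold OrderedTree.depth; omega⟩
    refine ⟨hc.ne_root, ?_⟩
    rw [hc.par_eq]
    unfold Anc
    omega
  · rintro (rfl | ⟨hv, h⟩)
    · rfl
    · have hd := depth_par hv
      have hadj := (isChild_par hv).1
      have h1 := T.isTree.connected.dist_triangle (u := u) (v := T.par v) (w := v)
      have h2 := T.isTree.connected.dist_triangle (u := T.root) (v := u) (w := v)
      rw [SimpleGraph.dist_eq_one_iff_adj.2 hadj] at h1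
      have h3 : T.graph.dist T.root u + T.graph.dist u (T.par v) = T.graph.dist T.root (T.par v) := h
      unfold OrderedTree.depth at hd
      unfold Anc
      omega

theorem IsChild.anc {u v : Fin n} (h : T.IsChild u v) : T.Anc u v := h.2

theorem par_anc (v : Fin n) : T.Anc (T.par v) v := by
  by_cases h : v = T.root
  · subst h; rw [par_root]
  · exact (isChild_par h).anc

/-- Induction along the path from the root. -/
theorem rootInduction {P : Fin n → Prop} (root : P T.root)
    (step : ∀ v, v ≠ T.root → P (T.par v) → P v) (v : Fin n) : P v := by
  induction h : T.depth v using Nat.strong_induction_on generalizing v with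
  | _ m ih =>
    by_cases hv : v = T.root
    · exact hv ▸ root
    · exact step v hv (ih _ (by have := depth_par hv; omega) _ rfl)

theorem anc_root (v : Fin n) : T.Anc T.root v := by simp [Anc]

theorem Anc.trans {u v w : Fin n} (h : T.Anc u v) (h' : T.Anc v w) : T.Anc u w := by
  induction w using rootInduction (T := T) with
  | root =>
    rcases anc_iff.1 h' with rfl | ⟨h1, -⟩
    · exact h
    · exact absurd rfl h1
  | step w hw ih =>
    rcases anc_iff.1 h' with rfl | ⟨-, h1⟩
    · exact h
    · exact anc_iff.2 (Or.inr ⟨hw, ih h1⟩)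

theorem Anc.eq_of_depth_le {u v : Fin n} (h : T.Anc u v) (hd : T.depth v ≤ T.depth u) : u = v := by
  rw [anc_iff_depth] at h
  exact T.isTree.connected.dist_eq_zero_iff.1 (by omega)

theorem Anc.antisymm {u v : Fin n} (h : T.Anc u v) (h' : T.Anc v u) : u = v :=
  h.eq_of_depth_le h'.depth_le

theorem anc_root_iff {v : Fin n} : T.Anc v T.root ↔ v = T.root :=
  ⟨fun h => h.antisymm (anc_root v), fun h => h ▸ anc_refl _⟩

theorem Anc.total {u v w : Fin n} (h : T.Anc u w) (h' : T.Anc v w) : T.Anc u v ∨ T.Anc v u := by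
  induction w using rootInduction (T := T) with
  | root => rw [anc_root_iff.1 h, anc_root_iff.1 h']; exact Or.inl (anc_refl _)
  | step w hw ih =>
    rcases anc_iff.1 h with rfl | ⟨-, h1⟩
    · exact Or.inr h'
    · rcases anc_iff.1 h' with rfl | ⟨-, h2⟩
      · exact Or.inl h
      · exact ih h1 h2

theorem Anc.par_of_ne {u v : Fin n} (h : T.Anc u v) (hne : u ≠ v) : T.Anc u (T.par v) := by
  rcases anc_iff.1 h with h | h
  · exact absurd h hne
  · exact h.2

theorem Anc.exists_child {u v : Fin n} (h : T.Anc u v) (hne : u ≠ v) :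
    ∃ c, T.IsChild u c ∧ T.Anc c v := by
  induction v using rootInduction (T := T) with
  | root => exact absurd (anc_root_iff.1 h) hne
  | step v hv ih =>
    have h1 := h.par_of_ne hne
    by_cases h2 : u = T.par v
    · exact ⟨v, h2 ▸ isChild_par hv, anc_refl _⟩
    · obtain ⟨c, hc, hcv⟩ := ih h1 h2
      exact ⟨c, hc, hcv.trans (par_anc v)⟩

theorem dist_of_anc {u v : Fin n} (h : T.Anc u v) : T.graph.dist u v = T.depth v - T.depth u := by
  rw [anc_iff_depth] at h; omega

theorem dist_of_anc' {u v : Fin n} (h : T.Anc u v) : T.graph.dist v u = T.depth v - T.depth u := by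
  rw [SimpleGraph.dist_comm, dist_of_anc h]

theorem IsChild.not_anc {u c : Fin n} (h : T.IsChild u c) : ¬ T.Anc c u := fun h' => by
  have := h'.depth_le; have := h.depth; omega

/-- Two children of a vertex with a common descendant coincide. -/
theorem IsChild.eq_of_anc {u c c' v : Fin n} (h : T.IsChild u c) (h' : T.IsChild u c')
    (hc : T.Anc c v) (hc' : T.Anc c' v) : c = c' := by
  have hd := h.depth
  have hd' := h'.depth
  rcases hc.total hc' with h1 | h1
  · exact h1.eq_of_depth_le (by omega)
  · exact (h1.eq_of_depth_le (by omega)).symm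

theorem exists_leaf_below {v : Fin n} (h : v ≠ T.root) : ∃ l, T.IsLeaf l ∧ T.Anc v l := by
  classical
  obtain ⟨l, hl, hmax⟩ := Finset.exists_max_image (Finset.univ.filter fun l => T.Anc v l) T.depth
    ⟨v, by simp [anc_refl]⟩
  have hvl : T.Anc v l := by simpa using hl
  refine ⟨l, ⟨?_, ?_⟩, hvl⟩
  · rintro rfl
    exact h (anc_root_iff.1 hvl)
  · intro w hw
    have := hmax w (by simpa using hvl.trans hw.anc)
    have := hw.depth
    omega

theorem IsLeaf.eq_of_anc {l v : Fin n} (h : T.IsLeaf l) (hv : T.Anc l v) : l = v := by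
  by_contra hne
  obtain ⟨c, hc, -⟩ := hv.exists_child hne
  exact h.2 c hc

theorem LeftOf.mono {a b a' b' : Fin n} (h : T.LeftOf a b) (ha : T.Anc a a') (hb : T.Anc b b') :
    T.LeftOf a' b' := by
  obtain ⟨u, c₁, c₂, h1, h2, h3, h4, h5⟩ := h
  exact ⟨u, c₁, c₂, h1, h2, h3, h4.trans ha, h5.trans hb⟩

theorem ne_of_pair_sublist {u a b : Fin n} (h : [a, b].Sublist (T.adj u)) : a ≠ b := by
  have := (T.adj_nodup u).sublist h
  simpa using this

theorem pair_sublist_trans {u a b c : Fin n} (h : [a, b].Sublist (T.adj u))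
    (h' : [b, c].Sublist (T.adj u)) : [a, c].Sublist (T.adj u) := by
  rw [List.pair_sublist_iff_exists_getElem] at *
  obtain ⟨i, j, hi, hj, hij, rfl, rfl⟩ := h
  obtain ⟨k, l, hk, hl, hkl, hb, rfl⟩ := h'
  have := ((T.adj_nodup u).getElem_inj_iff).1 hb
  exact ⟨i, l, hi, hl, by omega, rfl, rfl⟩

theorem pair_sublist_total {u a b : Fin n} (ha : a ∈ T.adj u) (hb : b ∈ T.adj u) (h : a ≠ b) :
    [a, b].Sublist (T.adj u) ∨ [b, a].Sublist (T.adj u) := by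
  obtain ⟨i, hi, rfl⟩ := List.getElem_of_mem ha
  obtain ⟨j, hj, rfl⟩ := List.getElem_of_mem hb
  rcases lt_trichotomy i j with hij | rfl | hij
  · exact Or.inl (List.pair_sublist_iff_exists_getElem.2 ⟨i, j, hi, hj, hij, rfl, rfl⟩)
  · exact absurd rfl h
  · exact Or.inr (List.pair_sublist_iff_exists_getElem.2 ⟨j, i, hj, hi, hij, rfl, rfl⟩)

theorem LeftOf.not_anc {a b : Fin n} (h : T.LeftOf a b) : ¬ T.Anc a b := by
  obtain ⟨u, c₁, c₂, h1, h2, h3, h4, h5⟩ := h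
  exact fun h => ne_of_pair_sublist h3 (h1.eq_of_anc h2 (h4.trans h) h5)

theorem LeftOf.not_anc' {a b : Fin n} (h : T.LeftOf a b) : ¬ T.Anc b a := by
  obtain ⟨u, c₁, c₂, h1, h2, h3, h4, h5⟩ := h
  exact fun h => ne_of_pair_sublist h3 (h1.eq_of_anc h2 h4 (h5.trans h))

theorem LeftOf.irrefl (a : Fin n) : ¬ T.LeftOf a a := fun h => h.not_anc (anc_refl a)

/-- The branching vertices of `a`, `b` and of `b`, `c` are both ancestors of `b`, hence comparable.
If they coincide, the order of siblings is transitive; otherwise the higher one also separates `a`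
from `c`. -/
theorem LeftOf.trans {a b c : Fin n} (h : T.LeftOf a b) (h' : T.LeftOf b c) : T.LeftOf a c := by
  obtain ⟨u, c₁, c₂, h1, h2, h3, h4, h5⟩ := h
  obtain ⟨v, e₁, e₂, k1, k2, k3, k4, k5⟩ := h'
  by_cases huv : u = v
  · subst huv
    have := h2.eq_of_anc k1 h5 k4
    subst this
    exact ⟨u, c₁, e₂, h1, k2, pair_sublist_trans h3 k3, h4, k5⟩
  · rcases (h2.anc.trans h5).total (k1.anc.trans k4) with h | h
    · obtain ⟨e, he, hev⟩ := h.exists_child huv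
      have := h2.eq_of_anc he h5 (hev.trans (k1.anc.trans k4))
      subst this
      exact ⟨u, c₁, c₂, h1, h2, h3, h4, hev.trans (k2.anc.trans k5)⟩
    · obtain ⟨e, he, hev⟩ := h.exists_child (Ne.symm huv)
      have := k1.eq_of_anc he k4 (hev.trans (h2.anc.trans h5))
      subst this
      exact ⟨v, e₁, e₂, k1, k2, k3, hev.trans (h1.anc.trans h4), k5⟩

/-- The two vertices branch at their deepest common ancestor: there the children leading to `a` and
to `b` differ. -/
theorem leftOf_or_leftOf_of_not_anc {a b : Fin n} (hab : ¬ T.Anc a b) (hba : ¬ T.Anc b a) :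
    T.LeftOf a b ∨ T.LeftOf b a := by
  classical
  obtain ⟨u, hu, hmax⟩ := Finset.exists_max_image
    (Finset.univ.filter fun l => T.Anc l a ∧ T.Anc l b) T.depth ⟨T.root, by simp [anc_root]⟩
  have hu : T.Anc u a ∧ T.Anc u b := by simpa using hu
  obtain ⟨c₁, h1, h1a⟩ := hu.1.exists_child (by rintro rfl; exact hab hu.2)
  obtain ⟨c₂, h2, h2b⟩ := hu.2.exists_child (by rintro rfl; exact hba hu.1)
  have hne : c₁ ≠ c₂ := by
    rintro rfl
    have := hmax c₁ (by simp [h1a, h2b])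
    have := h1.depth
    omega
  rcases pair_sublist_total ((T.mem_adj _ _).2 h1.1) ((T.mem_adj _ _).2 h2.1) hne with h | h
  · exact Or.inl ⟨u, c₁, c₂, h1, h2, h, h1a, h2b⟩
  · exact Or.inr ⟨u, c₂, c₁, h2, h1, h, h2b, h1a⟩

theorem IsLeaf.leftOf_or_leftOf {a b : Fin n} (ha : T.IsLeaf a) (hb : T.IsLeaf b) (h : a ≠ b) :
    T.LeftOf a b ∨ T.LeftOf b a :=
  leftOf_or_leftOf_of_not_anc (fun h' => h (ha.eq_of_anc h')) (fun h' => h (hb.eq_of_anc h').symm)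

/-- What lies to the left of a child: what lies to the left of its parent, and the subtrees of the
earlier siblings. -/
theorem IsChild.leftOf_iff {u w a : Fin n} (h : T.IsChild u w) :
    T.LeftOf a w ↔ T.LeftOf a u ∨ ∃ c, T.IsChild u c ∧ [c, w].Sublist (T.adj u) ∧ T.Anc c a := by
  constructor
  · rintro ⟨v, c₁, c₂, h1, h2, h3, h4, h5⟩
    by_cases hc : c₂ = w
    · subst hc
      have := h2.unique h
      subst this
      exact Or.inr ⟨c₁, h1, h3, h4⟩
    · have := h5.par_of_ne hc
      rw [h.par_eq] at this
      exact Or.inl ⟨v, c₁, c₂, h1, h2, h3, h4, this⟩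
  · rintro (h1 | ⟨c, h1, h2, h3⟩)
    · exact h1.mono (anc_refl _) h.anc
    · exact ⟨u, c, w, h1, h, h2, h3, anc_refl _⟩

end OrderedTree

/-! ### Path decompositions: disjointness, total length, levels. -/

namespace OrderedTree

variable {n : ℕ} {T : OrderedTree n}

theorem Anc.exists_between {u v : Fin n} (h : T.Anc u v) {m : ℕ} (hu : T.depth u ≤ m)
    (hv : m ≤ T.depth v) : ∃ w, T.Anc u w ∧ T.Anc w v ∧ T.depth w = m := by
  induction v using rootInduction (T := T) with
  | root => exact ⟨T.root, h, anc_refl _, by simp at hv ⊢; omega⟩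
  | step v hne ih =>
    by_cases hm : m = T.depth v
    · exact ⟨v, h, anc_refl _, hm.symm⟩
    · have hd := depth_par hne
      have huv : u ≠ v := by rintro rfl; omega
      obtain ⟨w, h1, h2, h3⟩ := ih (h.par_of_ne huv) (by omega)
      exact ⟨w, h1, h2.trans (par_anc v), h3⟩

end OrderedTree

namespace PathDecomposition

open OrderedTree

variable {n : ℕ} {T : OrderedTree n} (B : PathDecomposition T)

theorem isLeaf_leaf (k : Fin B.t) : T.IsLeaf (B.leaf k) := by
  have : B.leaf k ∈ Set.range B.leaf := ⟨k, rfl⟩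
  rwa [B.range_leaf] at this

theorem exists_leaf_eq {l : Fin n} (h : T.IsLeaf l) : ∃ k, B.leaf k = l := by
  have : l ∈ {v | T.IsLeaf v} := h
  rwa [← B.range_leaf] at this

theorem attach_anc (k : Fin B.t) : T.Anc (B.attach k) (B.leaf k) := (B.isAttachment k).2.1

theorem attach_mem (k : Fin B.t) : B.attach k ∈ T.unionBefore B.leaf B.attach k :=
  (B.isAttachment k).1

/-- Each path ends in the union of its predecessors, so by induction on the index the union contains
the whole way up to the root: it is a subtree. -/
theorem mem_unionBefore_of_anc {k : Fin B.t} {u v : Fin n}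
    (hv : v ∈ T.unionBefore B.leaf B.attach k) (h : T.Anc u v) :
    u ∈ T.unionBefore B.leaf B.attach k := by
  induction hk : (k : ℕ) using Nat.strong_induction_on generalizing k u v with
  | _ m ih =>
    rcases hv with hv | ⟨i, hik, hv⟩
    · rw [Set.mem_singleton_iff] at hv
      subst hv
      exact Or.inl (anc_root_iff.1 h)
    · rcases (h.trans hv.2).total (B.attach_anc i) with h1 | h1
      · rcases ih i (hk ▸ hik) (B.attach_mem i) h1 rfl with h2 | ⟨i', h2, h3⟩
        · exact Or.inl h2
        · exact Or.inr ⟨i', h2.trans hik, h3⟩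
      · exact Or.inr ⟨i, hik, h1, h.trans hv.2⟩

theorem mem_lowerEnds {k : Fin B.t} {v : Fin n} :
    v ∈ B.lowerEnds k ↔ T.Anc (B.attach k) v ∧ T.Anc v (B.leaf k) ∧ v ≠ B.attach k := by
  simp [lowerEnds, pathUp, and_assoc]

theorem lowerEnds_ne_root {k : Fin B.t} {v : Fin n} (h : v ∈ B.lowerEnds k) : v ≠ T.root := by
  rintro rfl
  obtain ⟨h1, -, h2⟩ := B.mem_lowerEnds.1 h
  exact h2 (anc_root_iff.1 h1).symm

/-- A vertex of path `k` on an earlier path lies above the attachment, by the choice of the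
attachment, and so equals it. As a consequence the sets `lowerEnds` partition the vertices other
than the root, and every edge has a well-defined vector. -/
theorem not_mem_unionBefore {k : Fin B.t} {v : Fin n} (h : v ∈ B.lowerEnds k) :
    v ∉ T.unionBefore B.leaf B.attach k := by
  intro hv
  obtain ⟨h1, h2, h3⟩ := B.mem_lowerEnds.1 h
  exact h3 (((B.isAttachment k).2.2 v hv h2).antisymm h1)

theorem lowerEnds_unique {i k : Fin B.t} {v : Fin n} (hi : v ∈ B.lowerEnds i)
    (hk : v ∈ B.lowerEnds k) : i = k := by
  rcases lt_trichotomy i k with h | h | h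
  · exact absurd (Or.inr ⟨i, h, hi.1⟩) (B.not_mem_unionBefore hk)
  · exact h
  · exact absurd (Or.inr ⟨k, h, hk.1⟩) (B.not_mem_unionBefore hi)

theorem exists_mem_lowerEnds {v : Fin n} (hv : v ≠ T.root) : ∃ k, v ∈ B.lowerEnds k := by
  classical
  obtain ⟨l, hl, hvl⟩ := exists_leaf_below hv
  obtain ⟨m, rfl⟩ := B.exists_leaf_eq hl
  have hex : ∃ i, v ∈ T.pathUp (B.leaf i) (B.attach i) := by
    rcases hvl.total (B.attach_anc m) with h | h
    · rcases B.mem_unionBefore_of_anc (B.attach_mem m) h with h1 | ⟨i, -, h1⟩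
      · exact absurd h1 hv
      · exact ⟨i, h1⟩
    · exact ⟨m, h, hvl⟩
  -- On the first path that contains `v`, the vertex `v` is not the attachment, because an
  -- attachment other than the root lies on a still earlier path.
  obtain ⟨k, hk, hmin⟩ := WellFounded.has_min (r := fun a b : Fin B.t => a < b) wellFounded_lt
    {i | v ∈ T.pathUp (B.leaf i) (B.attach i)} hex
  refine ⟨k, hk, ?_⟩
  rintro (rfl : v = _)
  rcases B.attach_mem k with h1 | ⟨i, h1, h2⟩
  · exact hv h1
  · exact hmin i h2 h1

theorem length_eq (k : Fin B.t) : B.length k = T.depth (B.leaf k) - T.depth (B.attach k) :=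
  dist_of_anc' (B.attach_anc k)

theorem attach_ne_leaf (k : Fin B.t) : B.attach k ≠ B.leaf k := by
  intro h
  rcases B.attach_mem k with h1 | ⟨i, h1, h2⟩
  · exact (B.isLeaf_leaf k).1 (h ▸ h1)
  · have h3 := h2.2
    rw [h] at h3
    exact h1.ne' (B.leaf_injective ((B.isLeaf_leaf k).eq_of_anc h3))

theorem length_pos (k : Fin B.t) : 0 < B.length k :=
  (SimpleGraph.Connected.pos_dist_of_ne T.isTree.connected (B.attach_ne_leaf k).symm)

/-- A path has at least one lower end at each depth it passes, so at least as many lower ends as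
edges; the sets of lower ends are disjoint and avoid the root. -/
theorem sum_length_le : ∑ k, B.length k ≤ n - 1 := by
  classical
  let E : Fin B.t → Finset (Fin n) := fun k => Finset.univ.filter fun v => v ∈ B.lowerEnds k
  have hE : ∀ k, B.length k ≤ (E k).card := by
    intro k
    have h : Finset.Ioc (T.depth (B.attach k)) (T.depth (B.leaf k)) ⊆ (E k).image T.depth := by
      intro m hm
      rw [Finset.mem_Ioc] at hm
      obtain ⟨w, h1, h2, h3⟩ := (B.attach_anc k).exists_between hm.1.le hm.2
      refine Finset.mem_image.2 ⟨w, ?_, h3⟩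
      simp only [E, Finset.mem_filter, Finset.mem_univ, true_and]
      exact B.mem_lowerEnds.2 ⟨h1, h2, by rintro rfl; omega⟩
    have := (Finset.card_le_card h).trans Finset.card_image_le
    rw [Nat.card_Ioc] at this
    rwa [length_eq]
  calc ∑ k, B.length k ≤ ∑ k, (E k).card := Finset.sum_le_sum fun k _ => hE k
    _ = (Finset.univ.biUnion E).card := by
        rw [Finset.card_biUnion]
        intro i _ k _ hik
        rw [Function.onFun, Finset.disjoint_left]
        intro v hi hk
        simp only [E, Finset.mem_filter, Finset.mem_univ, true_and] at hi hk
        exact hik (B.lowerEnds_unique hi hk)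
    _ ≤ (Finset.univ.erase T.root).card := by
        apply Finset.card_le_card
        intro v hv
        simp only [E, Finset.mem_biUnion, Finset.mem_filter, Finset.mem_univ, true_and] at hv
        obtain ⟨k, hk⟩ := hv
        simpa using B.lowerEnds_ne_root hk
    _ = n - 1 := by simp

theorem length_le (k : Fin B.t) : B.length k ≤ n - 1 :=
  (Finset.single_le_sum (fun _ _ => Nat.zero_le _) (Finset.mem_univ k)).trans B.sum_length_le

/-- In a length decreasing decomposition no descendant of a vertex of a path is farther from the
attachment of the path than its leaf. -/
theorem IsLengthDecreasing.depth_le {B : PathDecomposition T} (hB : B.IsLengthDecreasing)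
    {k : Fin B.t} {w v : Fin n} (hw : w ∈ B.lowerEnds k) (h : T.Anc w v) :
    T.depth v ≤ T.depth (B.attach k) + B.length k := by
  have hv : v ≠ T.root := by
    rintro rfl
    exact B.lowerEnds_ne_root hw (anc_root_iff.1 h)
  obtain ⟨l, hl, hvl⟩ := exists_leaf_below hv
  obtain ⟨h1, h2, h3⟩ := B.mem_lowerEnds.1 hw
  -- The top vertex `y` of the path is uncovered before step `k`. So the leaf `l` below `v` is still
  -- unused and has the same attachment as `leaf k`, and the greedy choice compares the two.
  obtain ⟨y, hy, hyw⟩ := h1.exists_child h3.symm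
  have hyk : y ∈ B.lowerEnds k := B.mem_lowerEnds.2 ⟨hy.anc, hyw.trans h2, hy.ne.symm⟩
  have hyS := B.not_mem_unionBefore hyk
  have hyl : T.Anc y l := hyw.trans (h.trans hvl)
  have hatt : T.IsAttachment (T.unionBefore B.leaf B.attach k) l (B.attach k) := by
    refine ⟨B.attach_mem k, hy.anc.trans hyl, fun x hx hxl => ?_⟩
    rcases hxl.total hyl with h4 | h4
    · have hne : x ≠ y := by rintro rfl; exact hyS hx
      have := h4.par_of_ne hne
      rwa [hy.par_eq] at this
    · exact absurd (B.mem_unionBefore_of_anc hx h4) hyS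
  have hun : ∀ i, i < k → B.leaf i ≠ l := by
    rintro i hi rfl
    exact hyS (B.mem_unionBefore_of_anc (Or.inr ⟨i, hi, B.attach_anc i, anc_refl _⟩) hyl)
  have := hB k l hl hun _ hatt
  rw [dist_of_anc' hatt.2.1] at this
  have := hvl.depth_le
  omega

variable {B}

/-- Clearing denominators leaves inequalities between natural numbers; the bound for `j = 1` drops
out because no path has more than `n - 1` edges. -/
theorem isLevel_iff {c : ℕ} (hc : 0 < c) {k : Fin B.t} {j : ℕ} :
    B.IsLevel c k j ↔ 1 ≤ j ∧ j ≤ Nat.clog c n ∧ n - 1 ≤ B.length k * c ^ j ∧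
      (1 < j → B.length k * c ^ (j - 1) < n - 1) := by
  have hn : 1 ≤ n := Fin.pos T.root
  have hcast : (n : ℝ) - 1 = ((n - 1 : ℕ) : ℝ) := by push_cast [hn]; ring
  have hc' : (0 : ℝ) < c := by exact_mod_cast hc
  unfold IsLevel
  rw [hcast]
  have e1 : ((n - 1 : ℕ) : ℝ) / (c : ℝ) ^ j ≤ (B.length k : ℝ) ↔ n - 1 ≤ B.length k * c ^ j := by
    rw [div_le_iff₀ (by positivity)]; exact_mod_cast Iff.rfl
  have e2 : (B.length k : ℝ) < ((n - 1 : ℕ) : ℝ) / (c : ℝ) ^ (j - 1) ↔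
      B.length k * c ^ (j - 1) < n - 1 := by
    rw [lt_div_iff₀ (by positivity)]; exact_mod_cast Iff.rfl
  have e3 : (B.length k : ℝ) ≤ ((n - 1 : ℕ) : ℝ) := by exact_mod_cast B.length_le k
  rw [e1, e2]
  simp only [e3, implies_true, true_and]

theorem IsLevel.length_mul_le {c : ℕ} (hc : 0 < c) {k : Fin B.t} {j : ℕ} (h : B.IsLevel c k j) :
    B.length k * c ^ (j - 1) ≤ n - 1 := by
  obtain ⟨h1, -, -, h4⟩ := (isLevel_iff hc).1 h
  rcases h1.eq_or_lt with rfl | h1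
  · simpa using B.length_le k
  · exact (h4 h1).le

theorem one_lt_of_index (k : Fin B.t) : 1 < n := by
  have := B.length_pos k
  have := B.length_le k
  omega

/-- The least `j ≥ 1` with `n - 1 ≤ B.length k * c ^ j` works. It is at most `Nat.clog c n` because
a path has at least one edge, and its minimality gives the strict upper bound. -/
theorem exists_isLevel {c : ℕ} (hc : 1 < c) (k : Fin B.t) : ∃ j, B.IsLevel c k j := by
  classical
  have hn := one_lt_of_index k
  have hK : n ≤ c ^ Nat.clog c n := Nat.le_pow_clog hc n
  have hpos := B.length_pos k
  have hex : ∃ j, 1 ≤ j ∧ n - 1 ≤ B.length k * c ^ j := by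
    refine ⟨Nat.clog c n, Nat.clog_pos hc hn, ?_⟩
    nlinarith [Nat.sub_le n 1]
  refine ⟨Nat.find hex, (isLevel_iff (by omega)).2 ⟨(Nat.find_spec hex).1, ?_,
    (Nat.find_spec hex).2, ?_⟩⟩
  · apply Nat.find_min' hex
    exact ⟨Nat.clog_pos hc hn, by nlinarith [Nat.sub_le n 1]⟩
  · intro h
    have := Nat.find_min hex (m := Nat.find hex - 1) (by omega)
    push Not at this
    exact this (by omega)

/-- This is the budget of the vector assignment. With `K = Nat.clog c n`, a path of level `j` has at
least `(n - 1) / c ^ j` edges, so its weight `c ^ (K - j)` is at most `c ^ K / (n - 1)` per edge,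
and there are at most `n - 1` edges. -/
theorem sum_pow_level_le {c : ℕ} (hc : 1 < c) {j : Fin B.t → ℕ} (hj : ∀ k, B.IsLevel c k (j k)) :
    ∑ k, c ^ (Nat.clog c n - j k) ≤ c ^ Nat.clog c n := by
  rcases isEmpty_or_nonempty (Fin B.t) with he | ⟨⟨k⟩⟩
  · simp
  have hn := one_lt_of_index k
  refine Nat.le_of_mul_le_mul_left ?_ (show 0 < n - 1 by omega)
  calc (n - 1) * ∑ k, c ^ (Nat.clog c n - j k)
      = ∑ k, (n - 1) * c ^ (Nat.clog c n - j k) := Finset.mul_sum _ _ _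
    _ ≤ ∑ k, B.length k * c ^ Nat.clog c n := by
        refine Finset.sum_le_sum fun k _ => ?_
        obtain ⟨-, h2, h3, -⟩ := (isLevel_iff (by omega)).1 (hj k)
        calc (n - 1) * c ^ (Nat.clog c n - j k)
            ≤ B.length k * c ^ j k * c ^ (Nat.clog c n - j k) := Nat.mul_le_mul_right _ h3
          _ = B.length k * c ^ Nat.clog c n := by
              rw [mul_assoc, ← pow_add, Nat.add_sub_cancel' h2]
    _ = (∑ k, B.length k) * c ^ Nat.clog c n := (Finset.sum_mul _ _ _).symm
    _ ≤ (n - 1) * c ^ Nat.clog c n := Nat.mul_le_mul_right _ B.sum_length_le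

end PathDecomposition

/-! ### The order of slopes -/

/-- A strictly increasing function of the slope of a nonnegative vector. -/
def slopeKey (v : ℕ × ℕ) : ℚ := (v.2 : ℚ) / ((v.1 : ℚ) + (v.2 : ℚ))

/-- Coprimality excludes `(0, 0)`. The key `y / (x + y)`, unlike `y / x`, also covers infinite
slope, so that extremal slopes can be taken in `ℚ`. -/
theorem slopeLT_iff {u v : ℕ × ℕ} (hu : Nat.Coprime u.1 u.2) (hv : Nat.Coprime v.1 v.2) :
    SlopeLT u v ↔ slopeKey u < slopeKey v := by
  have pos : ∀ w : ℕ × ℕ, Nat.Coprime w.1 w.2 → (0 : ℚ) < (w.1 : ℚ) + (w.2 : ℚ) := by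
    intro w hw
    have : 0 < w.1 + w.2 := by
      by_contra h
      have h1 : w.1 = 0 := by omega
      have h2 : w.2 = 0 := by omega
      rw [h1, h2] at hw
      simp at hw
    exact_mod_cast this
  unfold SlopeLT slopeKey
  rw [div_lt_div_iff₀ (pos u hu) (pos v hv)]
  rw [mul_add, mul_add, mul_comm (v.2 : ℚ) (u.2 : ℚ), add_lt_add_iff_right]
  exact_mod_cast Iff.rfl

theorem eq_of_slopeKey_eq {u v : ℕ × ℕ} (hu : Nat.Coprime u.1 u.2) (hv : Nat.Coprime v.1 v.2)
    (h : slopeKey u = slopeKey v) : u = v := by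
  have h1 : ¬ SlopeLT u v := by rw [slopeLT_iff hu hv, h]; exact lt_irrefl _
  have h2 : ¬ SlopeLT v u := by rw [slopeLT_iff hv hu, h]; exact lt_irrefl _
  unfold SlopeLT at h1 h2
  have h3 : u.2 * v.1 = v.2 * u.1 := le_antisymm (not_lt.1 h2) (not_lt.1 h1)
  have d1 : u.1 ∣ v.1 := hu.dvd_of_dvd_mul_left (by rw [h3]; exact Dvd.intro_left _ rfl)
  have d2 : v.1 ∣ u.1 := hv.dvd_of_dvd_mul_left (by rw [← h3]; exact Dvd.intro_left _ rfl)
  have d3 : u.2 ∣ v.2 := hu.symm.dvd_of_dvd_mul_right (by rw [← h3]; exact Dvd.intro _ rfl)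
  have d4 : v.2 ∣ u.2 := hv.symm.dvd_of_dvd_mul_right (by rw [h3]; exact Dvd.intro _ rfl)
  exact Prod.ext (Nat.dvd_antisymm d1 d2) (Nat.dvd_antisymm d3 d4)

theorem SlopeLT.trans {u v w : ℕ × ℕ} (h : SlopeLT u v) (h' : SlopeLT v w) : SlopeLT u w := by
  unfold SlopeLT at *
  have hv : 0 < v.1 := Nat.pos_of_ne_zero fun h0 => by simp [h0] at h'
  have hu : 0 < u.1 := Nat.pos_of_ne_zero fun h0 => by simp [h0] at h
  have hw : 0 < w.2 := Nat.pos_of_ne_zero fun h0 => by simp [h0] at h'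
  rcases Nat.eq_zero_or_pos w.1 with h0 | h0
  · rw [h0]; simp [hu, hw]
  · refine Nat.lt_of_mul_lt_mul_left (a := v.1) ?_
    calc v.1 * (u.2 * w.1) = u.2 * v.1 * w.1 := by ring
      _ < v.2 * u.1 * w.1 := Nat.mul_lt_mul_of_pos_right h h0
      _ = v.2 * w.1 * u.1 := by ring
      _ ≤ w.2 * v.1 * u.1 := Nat.mul_le_mul_right _ h'.le
      _ = v.1 * (w.2 * u.1) := by ring

theorem SlopeLT.irrefl (u : ℕ × ℕ) : ¬ SlopeLT u u := by simp [SlopeLT]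

theorem SlopeLT.asymm {u v : ℕ × ℕ} (h : SlopeLT u v) : ¬ SlopeLT v u :=
  fun h' => SlopeLT.irrefl _ (h.trans h')

theorem mem_primVec {m : ℕ} {v : ℕ × ℕ} :
    v ∈ primVec m ↔ (1 ≤ v.1 ∧ v.1 ≤ m) ∧ (1 ≤ v.2 ∧ v.2 ≤ m) ∧ Nat.Coprime v.1 v.2 := by
  simp [primVec, and_assoc]

theorem primVec_mono {m m' : ℕ} (h : m ≤ m') : primVec m ⊆ primVec m' := by
  intro v
  simp only [mem_primVec]
  omega

theorem mem_boundaryVec {v : ℕ × ℕ} : v ∈ boundaryVec ↔ v = (1, 0) ∨ v = (0, 1) := by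
  simp [boundaryVec]

theorem coprime_of_mem {m : ℕ} {S : Finset (ℕ × ℕ)} (hS : S ⊆ primVec m) {v : ℕ × ℕ}
    (h : v ∈ S ∪ boundaryVec) : Nat.Coprime v.1 v.2 := by
  rcases Finset.mem_union.1 h with h | h
  · exact (mem_primVec.1 (hS h)).2.2
  · rcases mem_boundaryVec.1 h with rfl | rfl <;> simp

theorem slopeLT_zero_left {v : ℕ × ℕ} (h : 1 ≤ v.2) : SlopeLT (1, 0) v := by
  simp [SlopeLT]; omega

theorem mem_vecBetween {S : Finset (ℕ × ℕ)} {u v w : ℕ × ℕ} :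
    w ∈ vecBetween S u v ↔ w ∈ S ∧ SlopeLT u w ∧ SlopeLT w v := by simp [vecBetween]

theorem slopeLT_trichotomy {u v : ℕ × ℕ} (hu : Nat.Coprime u.1 u.2) (hv : Nat.Coprime v.1 v.2) :
    SlopeLT u v ∨ u = v ∨ SlopeLT v u := by
  rw [slopeLT_iff hu hv, slopeLT_iff hv hu]
  rcases lt_trichotomy (slopeKey u) (slopeKey v) with h | h | h
  · exact Or.inl h
  · exact Or.inr (Or.inl (eq_of_slopeKey_eq hu hv h))
  · exact Or.inr (Or.inr h)

/-- A set of vectors every member of which is coprime. -/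
def CoprimeSet (S : Finset (ℕ × ℕ)) : Prop := ∀ v ∈ S, Nat.Coprime v.1 v.2

theorem coprimeSet_union_boundary {m : ℕ} {S : Finset (ℕ × ℕ)} (hS : S ⊆ primVec m) :
    CoprimeSet (S ∪ boundaryVec) := fun _ hv => coprime_of_mem hS hv

theorem exists_next {S : Finset (ℕ × ℕ)} (hS : CoprimeSet S) {p q : ℕ × ℕ} (hq : q ∈ S) (hpq : SlopeLT p q) :
    ∃ v ∈ S, SlopeLT p v ∧ ∀ w ∈ S, SlopeLT p w → ¬ SlopeLT w v := by
  obtain ⟨v, hv, hmin⟩ := Finset.exists_min_image (S.filter fun w => SlopeLT p w) slopeKey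
    ⟨q, by simp [hq, hpq]⟩
  rw [Finset.mem_filter] at hv
  refine ⟨v, hv.1, hv.2, fun w hw hpw => ?_⟩
  rw [slopeLT_iff (hS w hw) (hS v hv.1), not_lt]
  exact hmin w (by simp [hw, hpw])

theorem exists_prev {S : Finset (ℕ × ℕ)} (hS : CoprimeSet S) {p q : ℕ × ℕ} (hq : q ∈ S) (hpq : ¬ SlopeLT p q) :
    ∃ v ∈ S, ¬ SlopeLT p v ∧ ∀ w ∈ S, ¬ SlopeLT p w → ¬ SlopeLT v w := by
  obtain ⟨v, hv, hmax⟩ := Finset.exists_max_image (S.filter fun w => ¬ SlopeLT p w) slopeKey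
    ⟨q, by simp [hq, hpq]⟩
  rw [Finset.mem_filter] at hv
  refine ⟨v, hv.1, hv.2, fun w hw hpw => ?_⟩
  rw [slopeLT_iff (hS v hv.1) (hS w hw), not_lt]
  exact hmax w (by simp [hw, hpw])

/-- Every vector is enclosed by two consecutive vectors of `S`. -/
theorem exists_consecutive {S : Finset (ℕ × ℕ)} (hS : CoprimeSet S) {p a b : ℕ × ℕ}
    (hp : Nat.Coprime p.1 p.2) (ha : a ∈ S) (hb : b ∈ S) (hap : ¬ SlopeLT p a)
    (hpb : SlopeLT p b) :
    ∃ u v, Consecutive S u v ∧ ¬ SlopeLT p u ∧ SlopeLT p v ∧ ¬ SlopeLT u a ∧ ¬ SlopeLT b v := by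
  obtain ⟨u, hu, hpu, humax⟩ := exists_prev hS ha hap
  obtain ⟨v, hv, hpv, hvmin⟩ := exists_next hS hb hpb
  refine ⟨u, v, ⟨hu, hv, ?_, ?_⟩, hpu, hpv, humax a ha hap, hvmin b hb hpb⟩
  · rw [slopeLT_iff (hS u hu) (hS v hv)]
    rw [slopeLT_iff hp (hS u hu), not_lt] at hpu
    rw [slopeLT_iff hp (hS v hv)] at hpv
    exact hpu.trans_lt hpv
  · rintro w hw ⟨h1, h2⟩
    by_cases h : SlopeLT p w
    · exact hvmin w hw h h2
    · exact humax w hw h h1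

/-- If two gaps share an interior slope but differ, an end of one lies strictly inside the other. -/
theorem Consecutive.unique {S : Finset (ℕ × ℕ)} (hS : CoprimeSet S) {u v u' v' w : ℕ × ℕ}
    (hw : Nat.Coprime w.1 w.2) (h : Consecutive S u v) (h' : Consecutive S u' v')
    (h1 : SlopeLT u w) (h2 : SlopeLT w v) (h1' : SlopeLT u' w) (h2' : SlopeLT w v') :
    u = u' ∧ v = v' := by
  have hu := hS u h.1
  have hv := hS v h.2.1
  have hu' := hS u' h'.1
  have hv' := hS v' h'.2.1
  have a1 := h.2.2.2 u' h'.1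
  have a2 := h.2.2.2 v' h'.2.1
  have b1 := h'.2.2.2 u h.1
  have b2 := h'.2.2.2 v h.2.1
  rw [slopeLT_iff hu hu', slopeLT_iff hu' hv] at a1
  rw [slopeLT_iff hu hv', slopeLT_iff hv' hv] at a2
  rw [slopeLT_iff hu' hu, slopeLT_iff hu hv'] at b1
  rw [slopeLT_iff hu' hv, slopeLT_iff hv hv'] at b2
  rw [slopeLT_iff hu hw] at h1
  rw [slopeLT_iff hw hv] at h2
  rw [slopeLT_iff hu' hw] at h1'
  rw [slopeLT_iff hw hv'] at h2'
  push Not at a1 a2 b1 b2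
  constructor
  · refine eq_of_slopeKey_eq hu hu' (le_antisymm ?_ ?_)
    · by_contra h; push Not at h; have := b1 h; linarith
    · by_contra h; push Not at h; have := a1 h; linarith
  · refine eq_of_slopeKey_eq hv hv' (le_antisymm ?_ ?_)
    · by_contra h
      push Not at h
      have := a2 (by linarith); linarith
    · by_contra h
      push Not at h
      have := b2 (by linarith); linarith

theorem Consecutive.unique_right {S : Finset (ℕ × ℕ)} (hS : CoprimeSet S) {u v v' : ℕ × ℕ}
    (h : Consecutive S u v) (h' : Consecutive S u v') : v = v' := by
  rcases slopeLT_trichotomy (hS v h.2.1) (hS v' h'.2.1) with h1 | h1 | h1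
  · exact absurd ⟨h.2.2.1, h1⟩ (h'.2.2.2 v h.2.1)
  · exact h1
  · exact absurd ⟨h'.2.2.1, h1⟩ (h.2.2.2 v' h'.2.1)

theorem slopeLT_of_slopeLT_of_not {u v w : ℕ × ℕ} (hu : Nat.Coprime u.1 u.2)
    (hv : Nat.Coprime v.1 v.2) (hw : Nat.Coprime w.1 w.2) (h : SlopeLT u v) (h' : ¬ SlopeLT w v) :
    SlopeLT u w := by
  rw [slopeLT_iff hu hv] at h
  rw [slopeLT_iff hw hv, not_lt] at h'
  rw [slopeLT_iff hu hw]
  exact h.trans_le h'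

theorem slopeLT_of_not_of_slopeLT {u v w : ℕ × ℕ} (hu : Nat.Coprime u.1 u.2)
    (hv : Nat.Coprime v.1 v.2) (hw : Nat.Coprime w.1 w.2) (h : ¬ SlopeLT v u) (h' : SlopeLT v w) :
    SlopeLT u w := by
  rw [slopeLT_iff hv hu, not_lt] at h
  rw [slopeLT_iff hv hw] at h'
  rw [slopeLT_iff hu hw]
  exact h.trans_lt h'

/-! ### Vector families -/

/-- Validity speaks of the gaps of the full set `primVec m`. A gap of a subset that starts at `u`
contains the full gap from `u` to its successor `s`, and the `f` vectors are taken there. -/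
theorem ValidPair.exists_subset {f d : ℕ} (h : ValidPair f d) {m : ℕ} (hm : 0 < m)
    {S : Finset (ℕ × ℕ)} (hS : S ⊆ primVec m) {u v : ℕ × ℕ}
    (huv : Consecutive (S ∪ boundaryVec) u v) :
    ∃ A ⊆ vecBetween (primVec (d * m) \ primVec m) u v, A.card = f := by
  have hC := coprimeSet_union_boundary (subset_refl (primVec m))
  have hsub : S ∪ boundaryVec ⊆ primVec m ∪ boundaryVec := Finset.union_subset_union_left hS
  have hu := hC u (hsub huv.1)
  obtain ⟨s, hs, hus, hmin⟩ := exists_next hC (hsub huv.2.1) huv.2.2.1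
  have hcons : Consecutive (primVec m ∪ boundaryVec) u s :=
    ⟨hsub huv.1, hs, hus, fun w hw h => hmin w hw h.1 h.2⟩
  obtain ⟨A, hA, hcard⟩ := Finset.exists_subset_card_eq (h.2.2.2 m hm u s hcons)
  refine ⟨A, hA.trans fun w hw => ?_, hcard⟩
  rw [mem_vecBetween] at hw ⊢
  refine ⟨hw.1, hw.2.1, ?_⟩
  have hwc : Nat.Coprime w.1 w.2 := (mem_primVec.1 (Finset.mem_sdiff.1 hw.1).1).2.2
  exact slopeLT_of_slopeLT_of_not hwc (hC s hs) (hC v (hsub huv.2.1)) hw.2.2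
    (hmin v (hsub huv.2.1) huv.2.2.1)

theorem mem_unionUpTo {R : ℕ → Finset (ℕ × ℕ)} {j : ℕ} {w : ℕ × ℕ} :
    w ∈ unionUpTo R j ↔ ∃ i, (1 ≤ i ∧ i ≤ j) ∧ w ∈ R i := by simp [unionUpTo]

theorem unionUpTo_succ (R : ℕ → Finset (ℕ × ℕ)) (j : ℕ) :
    unionUpTo R (j + 1) = unionUpTo R j ∪ R (j + 1) := by
  ext w
  simp only [mem_unionUpTo, Finset.mem_union]
  constructor
  · rintro ⟨i, ⟨h1, h2⟩, h3⟩
    rcases h2.lt_or_eq with h | rfl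
    · exact Or.inl ⟨i, ⟨h1, by omega⟩, h3⟩
    · exact Or.inr h3
  · rintro (⟨i, h1, h2⟩ | h)
    · exact ⟨i, ⟨h1.1, by omega⟩, h2⟩
    · exact ⟨j + 1, ⟨by omega, le_rfl⟩, h⟩

theorem unionUpTo_mono (R : ℕ → Finset (ℕ × ℕ)) {i j : ℕ} (h : i ≤ j) :
    unionUpTo R i ⊆ unionUpTo R j := by
  intro w
  simp only [mem_unionUpTo]
  rintro ⟨i, h1, h2⟩
  exact ⟨i, by omega, h2⟩

theorem unionUpTo_congr {R R' : ℕ → Finset (ℕ × ℕ)} {j : ℕ} (h : ∀ i, 1 ≤ i → i ≤ j → R' i = R i) :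
    unionUpTo R' j = unionUpTo R j := by
  ext w
  simp only [mem_unionUpTo]
  constructor <;> rintro ⟨i, h1, h2⟩
  · exact ⟨i, h1, h i h1.1 h1.2 ▸ h2⟩
  · exact ⟨i, h1, (h i h1.1 h1.2).symm ▸ h2⟩

namespace IsVectorFamily

variable {f d K : ℕ} {R : ℕ → Finset (ℕ × ℕ)}

theorem congr (h : IsVectorFamily f d K R) {R' : ℕ → Finset (ℕ × ℕ)}
    (hR : ∀ i, 1 ≤ i → i ≤ K → R' i = R i) : IsVectorFamily f d K R' := by
  refine ⟨fun h1 => ?_, fun j h1 h2 => ?_⟩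
  · rw [hR 1 le_rfl h1]; exact h.1 h1
  · rw [hR (j + 1) (by omega) (by omega), unionUpTo_congr fun i hi hij => hR i hi (by omega)]
    exact h.2 j h1 h2

theorem one_one_mem (h : IsVectorFamily f d K R) {j : ℕ} (h1 : 1 ≤ j) (hj : j ≤ K) :
    (1, 1) ∈ unionUpTo R j := by
  obtain ⟨S₁, S₂, -, -, -, -, hR⟩ := h.1 (h1.trans hj)
  exact mem_unionUpTo.2 ⟨1, ⟨le_rfl, h1⟩, by simp [hR]⟩

theorem subset_primVec (h : IsVectorFamily f d K R) (hd : 0 < d) {j : ℕ} (hj : j ≤ K) :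
    unionUpTo R j ⊆ primVec (d ^ j) := by
  intro w hw
  obtain ⟨i, ⟨h1, h2⟩, h3⟩ := mem_unionUpTo.1 hw
  refine primVec_mono (Nat.pow_le_pow_right hd h2) ?_
  rcases h1.eq_or_lt with rfl | h1
  · obtain ⟨S₁, S₂, hS₁, -, hS₂, -, hR⟩ := h.1 (h2.trans hj)
    rw [hR] at h3
    rw [pow_one]
    simp only [Finset.mem_union, Finset.mem_singleton] at h3
    rcases h3 with (h3 | h3) | rfl
    · exact (Finset.mem_sdiff.1 (mem_vecBetween.1 (hS₁ h3)).1).1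
    · exact (Finset.mem_sdiff.1 (mem_vecBetween.1 (hS₂ h3)).1).1
    · simp [mem_primVec]; omega
  · have := (h.2 (i - 1) (by omega) (by omega)).1
    rw [Nat.sub_add_cancel (by omega)] at this
    exact (Finset.mem_sdiff.1 (this h3)).1

theorem coprimeSet (h : IsVectorFamily f d K R) (hd : 0 < d) {j : ℕ} (hj : j ≤ K) :
    CoprimeSet (unionUpTo R j ∪ boundaryVec) :=
  coprimeSet_union_boundary (h.subset_primVec hd hj)

open Classical in
/-- The union of the sets `A u v` over all pairs of consecutive vectors. -/
noncomputable def fill (S : Finset (ℕ × ℕ)) (A : ℕ × ℕ → ℕ × ℕ → Finset (ℕ × ℕ)) :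
    Finset (ℕ × ℕ) :=
  ((S ×ˢ S).filter fun p => Consecutive S p.1 p.2).biUnion fun p => A p.1 p.2

theorem mem_fill {S : Finset (ℕ × ℕ)} {A : ℕ × ℕ → ℕ × ℕ → Finset (ℕ × ℕ)} {w : ℕ × ℕ} :
    w ∈ fill S A ↔ ∃ u v, Consecutive S u v ∧ w ∈ A u v := by
  simp only [fill, Finset.mem_biUnion, Finset.mem_filter, Finset.mem_product]
  constructor
  · rintro ⟨p, ⟨-, h⟩, hw⟩; exact ⟨p.1, p.2, h, hw⟩
  · rintro ⟨u, v, h, hw⟩; exact ⟨(u, v), ⟨⟨h.1, h.2.1⟩, h⟩, hw⟩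

/-- Any choice of `f` new vectors in every gap extends a vector family. -/
theorem extend (h : IsVectorFamily f d K R) (hd : 0 < d) (hK : 1 ≤ K)
    {A : ℕ × ℕ → ℕ × ℕ → Finset (ℕ × ℕ)}
    (hA : ∀ u v, Consecutive (unionUpTo R K ∪ boundaryVec) u v →
      A u v ⊆ vecBetween (primVec (d ^ (K + 1)) \ primVec (d ^ K)) u v ∧ (A u v).card = f) :
    IsVectorFamily f d (K + 1)
      (Function.update R (K + 1) (fill (unionUpTo R K ∪ boundaryVec) A)) := by
  have hcg : ∀ i, 1 ≤ i → i ≤ K →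
      Function.update R (K + 1) (fill (unionUpTo R K ∪ boundaryVec) A) i = R i :=
    fun i _ hi => Function.update_of_ne (by omega) _ _
  have h' := h.congr hcg
  refine ⟨fun _ => h'.1 hK, fun j h1 h2 => ?_⟩
  rcases (Nat.lt_succ_iff.1 h2).lt_or_eq with h3 | rfl
  · exact h'.2 j h1 h3
  rw [Function.update_self, unionUpTo_congr hcg]
  have hsub : fill (unionUpTo R j ∪ boundaryVec) A ⊆ primVec (d ^ (j + 1)) \ primVec (d ^ j) := by
    intro w hw
    obtain ⟨u, v, huv, hw⟩ := mem_fill.1 hw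
    exact (mem_vecBetween.1 ((hA u v huv).1 hw)).1
  refine ⟨hsub, fun u v huv => ?_⟩
  rw [← (hA u v huv).2]
  congr 1
  ext w
  rw [mem_vecBetween]
  constructor
  · rintro ⟨hw, h4, h5⟩
    have hwc := (mem_primVec.1 (Finset.mem_sdiff.1 (hsub hw)).1).2.2
    obtain ⟨u', v', huv', hw⟩ := mem_fill.1 hw
    have h6 := mem_vecBetween.1 ((hA u' v' huv').1 hw)
    obtain ⟨rfl, rfl⟩ := huv.unique (h.coprimeSet hd le_rfl) hwc huv' h4 h5 h6.2.1 h6.2.2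
    exact hw
  · intro hw
    exact ⟨mem_fill.2 ⟨u, v, huv, hw⟩, (mem_vecBetween.1 ((hA u v huv).1 hw)).2⟩

theorem exists_extension (hv : ValidPair f d) (h : IsVectorFamily f d K R) :
    ∃ R' : ℕ → Finset (ℕ × ℕ), (∀ i, 1 ≤ i → i ≤ K → R' i = R i) ∧
      IsVectorFamily f d (K + 1) R' := by
  have hd := hv.2.1
  rcases Nat.eq_zero_or_pos K with rfl | hK
  -- `primVec 1` contains only `(1, 1)`, so validity for `m = 1` supplies both halves of the first
  -- set.
  · obtain ⟨A₁, h1, h2⟩ := Finset.exists_subset_card_eq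
      (hv.2.2.2 1 one_pos (1, 0) (1, 1) (by unfold Consecutive; decide))
    obtain ⟨A₂, h3, h4⟩ := Finset.exists_subset_card_eq
      (hv.2.2.2 1 one_pos (1, 1) (0, 1) (by unfold Consecutive; decide))
    rw [mul_one] at h1 h3
    exact ⟨fun _ => A₁ ∪ A₂ ∪ {(1, 1)}, fun i _ _ => by omega,
      fun _ => ⟨A₁, A₂, h1, h2, h3, h4, rfl⟩, fun j _ _ => by omega⟩
  · have hex : ∀ u v, ∃ A : Finset (ℕ × ℕ), Consecutive (unionUpTo R K ∪ boundaryVec) u v →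
        A ⊆ vecBetween (primVec (d ^ (K + 1)) \ primVec (d ^ K)) u v ∧ A.card = f := by
      intro u v
      by_cases huv : Consecutive (unionUpTo R K ∪ boundaryVec) u v
      · obtain ⟨A, hA⟩ := hv.exists_subset (Nat.pow_pos hd) (h.subset_primVec hd le_rfl) huv
        rw [← pow_succ'] at hA
        exact ⟨A, fun _ => hA⟩
      · exact ⟨∅, fun h => absurd h huv⟩
    choose A hA using hex
    exact ⟨_, fun i _ hi => Function.update_of_ne (by omega) _ _, h.extend hd hK hA⟩

/-- The number of gaps between two vectors grows by the factor `f + 1`. -/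
theorem card_gaps_succ (h : IsVectorFamily f d K R) (hd : 0 < d) {j : ℕ} (h1 : 1 ≤ j) (hj : j < K)
    {u v : ℕ × ℕ} (hu : u ∈ unionUpTo R j ∪ boundaryVec) (hv : v ∈ unionUpTo R j ∪ boundaryVec)
    (huv : SlopeLT u v) :
    (vecBetween (unionUpTo R (j + 1)) u v).card + 1 =
      (f + 1) * ((vecBetween (unionUpTo R j) u v).card + 1) := by
  classical
  set U := unionUpTo R j with hU
  have hC : CoprimeSet (U ∪ boundaryVec) := h.coprimeSet hd hj.le
  obtain ⟨hR, hgap⟩ := h.2 j h1 hj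
  have hRc : ∀ w ∈ R (j + 1), Nat.Coprime w.1 w.2 := fun w hw =>
    (mem_primVec.1 (Finset.mem_sdiff.1 (hR hw)).1).2.2
  have hdisj : Disjoint (vecBetween U u v) (vecBetween (R (j + 1)) u v) := by
    rw [Finset.disjoint_left]
    intro w hw hw'
    exact (Finset.mem_sdiff.1 (hR (mem_vecBetween.1 hw').1)).2
      (h.subset_primVec hd hj.le (mem_vecBetween.1 hw).1)
  have hsplit : vecBetween (unionUpTo R (j + 1)) u v =
      vecBetween U u v ∪ vecBetween (R (j + 1)) u v := by
    rw [unionUpTo_succ, vecBetween, Finset.filter_union]; rfl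
  -- The left ends of the gaps of level `j` between `u` and `v`; each of these gaps receives `f` new
  -- vectors.
  set X := insert u (vecBetween U u v) with hX
  have hXU : ∀ x ∈ X, x ∈ U ∪ boundaryVec ∧ SlopeLT x v ∧ ¬ SlopeLT x u := by
    intro x hx
    rcases Finset.mem_insert.1 hx with rfl | hx
    · exact ⟨hu, huv, SlopeLT.irrefl _⟩
    · have := mem_vecBetween.1 hx
      exact ⟨Finset.mem_union_left _ this.1, this.2.2, this.2.1.asymm⟩
  have hXcard : X.card = (vecBetween U u v).card + 1 := by
    rw [hX, Finset.card_insert_of_notMem]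
    intro hx
    exact SlopeLT.irrefl _ (mem_vecBetween.1 hx).2.1
  have hnext : ∀ x ∈ X, ∃ y, Consecutive (U ∪ boundaryVec) x y ∧ ¬ SlopeLT v y := by
    intro x hx
    obtain ⟨h2, h3, -⟩ := hXU x hx
    obtain ⟨y, hy, hxy, hmin⟩ := exists_next hC hv h3
    exact ⟨y, ⟨h2, hy, hxy, fun w hw hh => hmin w hw hh.1 hh.2⟩, hmin v hv h3⟩
  choose! y hy hyv using hnext
  have hpart : vecBetween (R (j + 1)) u v = X.biUnion fun x => vecBetween (R (j + 1)) x (y x) := by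
    ext w
    simp only [Finset.mem_biUnion, mem_vecBetween]
    constructor
    · rintro ⟨hw, huw, hwv⟩
      obtain ⟨x, z, hxz, hwx, hwz, hxu, -⟩ :=
        exists_consecutive hC (hRc w hw) hu hv huw.asymm hwv
      have hne : x ≠ w := by
        rintro rfl
        rcases Finset.mem_union.1 hxz.1 with hx | hx
        · exact (Finset.mem_sdiff.1 (hR hw)).2 (h.subset_primVec hd hj.le hx)
        · have := mem_primVec.1 (Finset.mem_sdiff.1 (hR hw)).1
          rcases mem_boundaryVec.1 hx with rfl | rfl <;> simp at this
      have hxw : SlopeLT x w := by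
        rcases slopeLT_trichotomy (hC x hxz.1) (hRc w hw) with h2 | h2 | h2
        · exact h2
        · exact absurd h2 hne
        · exact absurd h2 hwx
      have hxX : x ∈ X := by
        rcases slopeLT_trichotomy (hC x hxz.1) (hC u hu) with h2 | rfl | h2
        · exact absurd h2 hxu
        · exact Finset.mem_insert_self _ _
        · refine Finset.mem_insert_of_mem (mem_vecBetween.2 ⟨?_, h2, hxw.trans hwv⟩)
          rcases Finset.mem_union.1 hxz.1 with hx | hx
          · exact hx
          · rcases mem_boundaryVec.1 hx with rfl | rfl
            · simp [SlopeLT] at h2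
            · simp [SlopeLT] at hxw
      have : z = y x := hxz.unique_right hC (hy x hxX)
      exact ⟨x, hxX, hw, hxw, this ▸ hwz⟩
    · rintro ⟨x, hx, hw, hxw, hwy⟩
      obtain ⟨h2, h3, h4⟩ := hXU x hx
      refine ⟨hw, slopeLT_of_not_of_slopeLT (hC u hu) (hC x h2) (hRc w hw) h4 hxw, ?_⟩
      exact slopeLT_of_slopeLT_of_not (hRc w hw) (hC _ (hy x hx).2.1) (hC v hv) hwy (hyv x hx)
  have hcard : (vecBetween (R (j + 1)) u v).card = X.card * f := by
    rw [hpart, Finset.card_biUnion, Finset.sum_congr rfl fun x hx => hgap x (y x) (hy x hx),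
      Finset.sum_const, smul_eq_mul]
    intro x hx x' hx' hne
    rw [Function.onFun, Finset.disjoint_left]
    intro w hw hw'
    have h2 := mem_vecBetween.1 hw
    have h3 := mem_vecBetween.1 hw'
    exact hne ((hy x hx).unique hC (hRc w h2.1) (hy x' hx') h2.2.1 h2.2.2 h3.2.1 h3.2.2).1
  rw [hsplit, Finset.card_union_of_disjoint hdisj, hcard, hXcard]
  ring

theorem card_gaps (h : IsVectorFamily f d K R) (hd : 0 < d) {i j : ℕ} (h1 : 1 ≤ i) (hij : i ≤ j)
    (hj : j ≤ K) {u v : ℕ × ℕ} (hu : u ∈ unionUpTo R i ∪ boundaryVec)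
    (hv : v ∈ unionUpTo R i ∪ boundaryVec) (huv : SlopeLT u v) :
    (vecBetween (unionUpTo R j) u v).card + 1 =
      (f + 1) ^ (j - i) * ((vecBetween (unionUpTo R i) u v).card + 1) := by
  induction j, hij using Nat.le_induction with
  | base => simp
  | succ j hij ih =>
    have hmono : unionUpTo R i ∪ boundaryVec ⊆ unionUpTo R j ∪ boundaryVec :=
      Finset.union_subset_union_left (unionUpTo_mono R hij)
    rw [h.card_gaps_succ hd (h1.trans hij) (by omega) (hmono hu) (hmono hv) huv, ih (by omega),
      Nat.sub_add_comm hij, pow_succ]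
    ring

/-- Passing a gap of level `i`, right end included, passes this many vectors of all levels: the
price of a path of level `i`. -/
theorem card_gaps_consecutive (h : IsVectorFamily f d K R) (hd : 0 < d) {i : ℕ} (h1 : 1 ≤ i)
    (hi : i ≤ K) {u v : ℕ × ℕ} (huv : Consecutive (unionUpTo R i ∪ boundaryVec) u v) :
    (vecBetween (unionUpTo R K) u v).card + 1 = (f + 1) ^ (K - i) := by
  rw [h.card_gaps hd h1 hi le_rfl huv.1 huv.2.1 huv.2.2.1]
  have : vecBetween (unionUpTo R i) u v = ∅ := by
    rw [Finset.eq_empty_iff_forall_notMem]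
    intro w hw
    rw [mem_vecBetween] at hw
    exact huv.2.2.2 w (Finset.mem_union_left _ hw.1) hw.2
  simp [this]

/-- Counting `(1, 1)` too, there are `(f + 1) ^ K` vectors up to the diagonal. This matches the
bound of `sum_pow_level_le`, so no slope above `1` is ever needed. -/
theorem card_gaps_one (h : IsVectorFamily f d K R) (hd : 0 < d) (hK : 1 ≤ K) :
    (vecBetween (unionUpTo R K) (1, 0) (1, 1)).card + 1 = (f + 1) ^ K := by
  have h11 := h.one_one_mem le_rfl hK
  rw [h.card_gaps hd le_rfl hK le_rfl (by simp [boundaryVec]) (Finset.mem_union_left _ h11)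
    (by decide)]
  obtain ⟨S₁, S₂, hS₁, hc₁, hS₂, -, hR⟩ := h.1 hK
  have : vecBetween (unionUpTo R 1) (1, 0) (1, 1) = S₁ := by
    ext w
    simp only [mem_vecBetween, unionUpTo, Finset.Icc_self, Finset.singleton_biUnion, hR,
      Finset.mem_union, Finset.mem_singleton]
    constructor
    · rintro ⟨(h1 | h1) | rfl, h2, h3⟩
      · exact h1
      · exact absurd h3 (mem_vecBetween.1 (hS₂ h1)).2.1.asymm
      · exact absurd h3 (SlopeLT.irrefl _)
    · intro h1
      exact ⟨Or.inl (Or.inl h1), (mem_vecBetween.1 (hS₁ h1)).2⟩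
  rw [this, hc₁, ← pow_succ, Nat.sub_add_cancel hK]

end IsVectorFamily

/-! ### The vector assignment and the drawing step never fail. -/

namespace PathDecomposition

open OrderedTree

variable {n : ℕ} {T : OrderedTree n} (B : PathDecomposition T)

/-- The left to right order of the paths of a decomposition. -/
def PathLT (i k : Fin B.t) : Prop := T.LeftOf (B.leaf i) (B.leaf k)

theorem wellFounded_pathLT : WellFounded B.PathLT := by
  have : IsTrans (Fin B.t) B.PathLT := ⟨fun _ _ _ h h' => LeftOf.trans h h'⟩
  have : Std.Irrefl B.PathLT := ⟨fun _ => LeftOf.irrefl _⟩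
  exact Finite.wellFounded_of_trans_of_irrefl _

open Classical in
/-- The paths strictly to the left of a path. -/
noncomputable def leftPaths (k : Fin B.t) : Finset (Fin B.t) :=
  Finset.univ.filter fun i => B.PathLT i k

theorem mem_leftPaths {i k : Fin B.t} : i ∈ B.leftPaths k ↔ B.PathLT i k := by simp [leftPaths]

theorem leftPaths_sum_lt {c : ℕ} (hc : 1 < c) {j : Fin B.t → ℕ} (hj : ∀ k, B.IsLevel c k (j k))
    (k : Fin B.t) : ∑ i ∈ B.leftPaths k, c ^ (Nat.clog c n - j i) + c ^ (Nat.clog c n - j k) ≤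
      c ^ Nat.clog c n := by
  classical
  refine le_trans ?_ (sum_pow_level_le hc hj)
  rw [add_comm, ← Finset.sum_insert (s := B.leftPaths k) (a := k)
    (f := fun i => c ^ (Nat.clog c n - j i))]
  · exact Finset.sum_le_sum_of_subset (Finset.subset_univ _)
  · rw [mem_leftPaths]; exact LeftOf.irrefl _

/-- The paths to the left of the path `k` are those to the left of `i` and `i` itself, if `i` is
the nearest of them. -/
theorem insert_leftPaths_subset {i k : Fin B.t} (h : B.PathLT i k) :
    insert i (B.leftPaths i) ⊆ B.leftPaths k := by
  intro x hx
  rw [mem_leftPaths]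
  rcases Finset.mem_insert.1 hx with rfl | hx
  · exact h
  · exact LeftOf.trans (B.mem_leftPaths.1 hx) h

/-- Optimal Draw never runs out of vectors. -/
theorem exists_isAssignment {f d : ℕ} (hf : 0 < f) (hd : 0 < d) {R : ℕ → Finset (ℕ × ℕ)}
    (hR : IsVectorFamily f d (Nat.clog (f + 1) n) R) :
    ∃ a : Fin B.t → ℕ × ℕ, IsAssignment B (f + 1) R a := by
  classical
  have hc : 1 < f + 1 := by omega
  choose j hj using exists_isLevel (B := B) hc
  set K := Nat.clog (f + 1) n with hK
  have hj1 : ∀ k, 1 ≤ j k := fun k => (hj k).1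
  have hjK : ∀ k, j k ≤ K := fun k => (hj k).2.1
  let Good (k : Fin B.t) (left : ∀ i, B.PathLT i k → ℕ × ℕ) (q : ℕ × ℕ) : Prop :=
    q ∈ unionUpTo R (j k) ∧ (∀ i h, SlopeLT (left i h) q) ∧
      ∀ w ∈ unionUpTo R (j k), (∀ i h, SlopeLT (left i h) w) → ¬ SlopeLT w q
  -- Recursion along the left-to-right order; `(0, 0)` is a default value, which `key` shows never
  -- to be used.
  let step : ∀ k, (∀ i, B.PathLT i k → ℕ × ℕ) → ℕ × ℕ := fun k left =>
    if h : ∃ q, Good k left q then h.choose else (0, 0)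
  let a : Fin B.t → ℕ × ℕ := B.wellFounded_pathLT.fix step
  have ha : ∀ k, a k = step k fun i _ => a i := fun k => B.wellFounded_pathLT.fix_eq step k
  -- The budget consumed when the slope of `p` has been reached; `key` bounds it by the total weight
  -- of the paths treated so far.
  let rank : ℕ × ℕ → ℕ := fun p => ((unionUpTo R K).filter fun w => ¬ SlopeLT p w).card
  have hUc : ∀ w ∈ unionUpTo R K, Nat.Coprime w.1 w.2 := fun w hw =>
    hR.coprimeSet hd le_rfl w (Finset.mem_union_left _ hw)
  have key : ∀ k, Good k (fun i _ => a i) (a k) ∧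
      rank (a k) ≤ ∑ i ∈ B.leftPaths k, (f + 1) ^ (K - j i) + (f + 1) ^ (K - j k) := by
    intro k
    induction k using B.wellFounded_pathLT.induction with
    | _ k ih =>
      have hC := hR.coprimeSet hd (hjK k)
      have hUK := unionUpTo_mono R (hjK k)
      have hK1 : 1 ≤ K := (hj1 k).trans (hjK k)
      have h11 : (1, 1) ∈ unionUpTo R (j k) := hR.one_one_mem (hj1 k) (hjK k)
      have hleft : ∀ i, B.PathLT i k → a i ∈ unionUpTo R K := fun i hi =>
        unionUpTo_mono R (hjK i) (ih i hi).1.1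
      -- the largest slope used so far
      obtain ⟨p, hp, hpmax, hprank, hpv⟩ : ∃ p : ℕ × ℕ, Nat.Coprime p.1 p.2 ∧
          (∀ w, Nat.Coprime w.1 w.2 → 1 ≤ w.2 →
            ((∀ i, B.PathLT i k → SlopeLT (a i) w) ↔ SlopeLT p w)) ∧
          rank p ≤ ∑ i ∈ B.leftPaths k, (f + 1) ^ (K - j i) ∧ ¬ SlopeLT p (1, 0) := by
        rcases (B.leftPaths k).eq_empty_or_nonempty with he | hne
        -- The leftmost path starts from the boundary vector `(1, 0)`, whose rank is `0`.
        · refine ⟨(1, 0), by simp, fun w _ hw => ⟨fun _ => slopeLT_zero_left hw, ?_⟩, ?_, by decide⟩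
          · intro _ i hi
            rw [← mem_leftPaths, he] at hi
            simp at hi
          · rw [he, Finset.sum_empty, Nat.le_zero, Finset.card_eq_zero,
              Finset.filter_eq_empty_iff]
            intro w hw
            rw [not_not]
            exact slopeLT_zero_left (mem_primVec.1 (hR.subset_primVec hd le_rfl hw)).2.1.1
        · obtain ⟨i, hi, hmax⟩ := Finset.exists_max_image _ (fun i => slopeKey (a i)) hne
          have hik := B.mem_leftPaths.1 hi
          have hic := hUc _ (hleft i hik)
          refine ⟨a i, hic, fun w hw _ => ⟨fun h => h i hik, fun h i' hi' => ?_⟩, ?_, ?_⟩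
          · rw [slopeLT_iff (hUc _ (hleft i' hi')) hw]
            rw [slopeLT_iff hic hw] at h
            exact (hmax i' (B.mem_leftPaths.2 hi')).trans_lt h
          · refine (ih i hik).2.trans ?_
            rw [add_comm, ← Finset.sum_insert (s := B.leftPaths i) (a := i)
              (f := fun i => (f + 1) ^ (K - j i))]
            · exact Finset.sum_le_sum_of_subset (B.insert_leftPaths_subset hik)
            · rw [mem_leftPaths]; exact LeftOf.irrefl _
          · exact (slopeLT_zero_left
              (mem_primVec.1 (hR.subset_primVec hd le_rfl (hleft i hik))).2.1.1).asymm
      have hpos : ∀ w ∈ unionUpTo R (j k), 1 ≤ w.2 := fun w hw =>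
        (mem_primVec.1 (hR.subset_primVec hd (hjK k) hw)).2.1.1
      have hco : ∀ w ∈ unionUpTo R (j k), Nat.Coprime w.1 w.2 := fun w hw => hUc w (hUK hw)
      have hsum : ∑ i ∈ B.leftPaths k, (f + 1) ^ (K - j i) + (f + 1) ^ (K - j k) ≤ (f + 1) ^ K :=
        B.leftPaths_sum_lt hc hj k
      -- If the diagonal had been reached, all `(f + 1) ^ K` vectors would be consumed, leaving no
      -- room for the weight of path `k` itself.
      have hp11 : SlopeLT p (1, 1) := by
        by_contra hcon
        have hge : (f + 1) ^ K ≤ rank p := by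
          rw [← hR.card_gaps_one hd hK1, ← Finset.card_insert_of_notMem (a := ((1, 1) : ℕ × ℕ))]
          · apply Finset.card_le_card
            intro w hw
            rcases Finset.mem_insert.1 hw with rfl | hw
            · simp [hUK h11, hcon]
            · rw [mem_vecBetween] at hw
              rw [Finset.mem_filter]
              refine ⟨hw.1, fun h => hcon (h.trans hw.2.2)⟩
          · intro h
            exact SlopeLT.irrefl _ (mem_vecBetween.1 h).2.2
        have : 0 < (f + 1) ^ (K - j k) := by positivity
        omega
      -- The gap of level `j k` that contains `p`, possibly as its left end `u`. Its right end `q`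
      -- is the vector to be assigned.
      obtain ⟨u, q, huq, hpu, hpq, -, hq11⟩ := exists_consecutive hC hp
        (Finset.mem_union_right _ (mem_boundaryVec.2 (Or.inl rfl)))
        (Finset.mem_union_left _ h11) hpv hp11
      have hqU : q ∈ unionUpTo R (j k) := by
        rcases Finset.mem_union.1 huq.2.1 with h | h
        · exact h
        · rcases mem_boundaryVec.1 h with rfl | rfl
          · exact absurd hpq hpv
          · exact absurd (by decide) hq11
      have hgood : ∃ q, Good k (fun i _ => a i) q := by
        refine ⟨q, hqU, (hpmax q (hco q hqU) (hpos q hqU)).2 hpq, fun w hw hw' hwq => ?_⟩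
        have hpw := (hpmax w (hco w hw) (hpos w hw)).1 hw'
        exact huq.2.2.2 w (Finset.mem_union_left _ hw)
          ⟨slopeLT_of_not_of_slopeLT (hC u huq.1) hp (hco w hw) hpu hpw, hwq⟩
      have hak : Good k (fun i _ => a i) (a k) := by
        have : a k = hgood.choose := by rw [ha k]; exact dif_pos hgood
        rw [this]
        exact hgood.choose_spec
      refine ⟨hak, ?_⟩
      have hpak : SlopeLT p (a k) := (hpmax _ (hco _ hak.1) (hpos _ hak.1)).1 hak.2.1
      have hakq : a k = q := by
        rcases slopeLT_trichotomy (hco _ hak.1) (hco q hqU) with h | h | h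
        · exact absurd ⟨slopeLT_of_not_of_slopeLT (hC u huq.1) hp (hco _ hak.1) hpu hpak, h⟩
            (huq.2.2.2 _ (Finset.mem_union_left _ hak.1))
        · exact h
        · exact absurd h (hak.2.2 q hqU ((hpmax q (hco q hqU) (hpos q hqU)).2 hpq))
      rw [hakq]
      refine le_trans ?_ (Nat.add_le_add_right hprank _)
      rw [← hR.card_gaps_consecutive hd (hj1 k) (hjK k) huq]
      -- Moving from `p` to `q` consumes only vectors inside the gap from `u` to `q`, and `q`.
      have hsub : ((unionUpTo R K).filter fun w => ¬ SlopeLT q w) ⊆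
          ((unionUpTo R K).filter fun w => ¬ SlopeLT p w) ∪
            insert q (vecBetween (unionUpTo R K) u q) := by
        intro w hw
        rw [Finset.mem_filter] at hw
        by_cases hpw : SlopeLT p w
        · refine Finset.mem_union_right _ ?_
          rcases slopeLT_trichotomy (hUc w hw.1) (hco q hqU) with h | rfl | h
          · exact Finset.mem_insert_of_mem (mem_vecBetween.2
              ⟨hw.1, slopeLT_of_not_of_slopeLT (hC u huq.1) hp (hUc w hw.1) hpu hpw, h⟩)
          · exact Finset.mem_insert_self _ _
          · exact absurd h hw.2
        · exact Finset.mem_union_left _ (by simp [hw.1, hpw])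
      refine (Finset.card_le_card hsub).trans ((Finset.card_union_le _ _).trans ?_)
      exact Nat.add_le_add_left (Finset.card_insert_le _ _) _
  exact ⟨a, fun k => ⟨j k, hj k, (key k).1⟩⟩

open Classical in
/-- The displacement of a vertex with respect to its parent. -/
noncomputable def edgeVec (a : Fin B.t → ℕ × ℕ) (v : Fin n) : ℕ × ℕ :=
  if h : ∃ k, v ∈ B.lowerEnds k then a h.choose else (0, 0)

theorem edgeVec_eq (a : Fin B.t → ℕ × ℕ) {v : Fin n} {k : Fin B.t} (h : v ∈ B.lowerEnds k) :
    B.edgeVec a v = a k := by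
  have hex : ∃ k, v ∈ B.lowerEnds k := ⟨k, h⟩
  rw [edgeVec, dif_pos hex, B.lowerEnds_unique hex.choose_spec h]

/-- Every vertex but the root is a lower end of exactly one path, so the drawing rule is a recursion
over parents. -/
theorem isDrawnBy_iff {a : Fin B.t → ℕ × ℕ} {pos : Fin n → ℤ × ℤ} :
    IsDrawnBy B a pos ↔ pos T.root = (0, 0) ∧ ∀ v, v ≠ T.root →
      pos v = ((pos (T.par v)).1 + ((B.edgeVec a v).1 : ℤ),
        (pos (T.par v)).2 + ((B.edgeVec a v).2 : ℤ)) := by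
  refine and_congr_right fun _ => ⟨fun h v hv => ?_, fun h k v hv u hu => ?_⟩
  · obtain ⟨k, hk⟩ := B.exists_mem_lowerEnds hv
    rw [B.edgeVec_eq a hk]
    exact h k v hk _ (isChild_par hv)
  · rw [← B.edgeVec_eq a hv, ← hu.par_eq]
    exact h v hu.ne_root

theorem exists_isDrawnBy (a : Fin B.t → ℕ × ℕ) : ∃ pos : Fin n → ℤ × ℤ, IsDrawnBy B a pos := by
  classical
  let step : ∀ v : Fin n, (∀ u, T.depth u < T.depth v → ℤ × ℤ) → ℤ × ℤ := fun v rec =>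
    if h : v = T.root then (0, 0) else
      ((rec (T.par v) (by have := depth_par h; omega)).1 + ((B.edgeVec a v).1 : ℤ),
        (rec (T.par v) (by have := depth_par h; omega)).2 + ((B.edgeVec a v).2 : ℤ))
  have wf : WellFounded fun u v : Fin n => T.depth u < T.depth v := (measure T.depth).wf
  refine ⟨wf.fix step, B.isDrawnBy_iff.2 ⟨?_, fun v hv => ?_⟩⟩
  · rw [wf.fix_eq]; simp [step]
  · rw [wf.fix_eq]; simp only [step, dif_neg hv]

end PathDecomposition

/-! ### Slope disjoint drawings are monotone and free of crossings. -/

namespace SimpleGraph.Walk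

variable {V : Type*} {G : SimpleGraph V}

theorem pairwise_support_append {g : V → ℝ} {u v w : V} {p : G.Walk u v} {q : G.Walk v w}
    (hp : p.support.Pairwise fun a b => g a < g b) (hq : q.support.Pairwise fun a b => g a < g b) :
    (p.append q).support.Pairwise fun a b => g a < g b := by
  induction p with
  | nil => exact hq
  | cons h p ih =>
    rw [support_cons, List.pairwise_cons] at hp
    rw [cons_append, support_cons, List.pairwise_cons]
    refine ⟨fun b hb => ?_, ih hp.2 hq⟩
    rcases (mem_support_append_iff _ _).1 hb with hb | hb
    · exact hp.1 b hb
    · have h1 := hp.1 _ p.end_mem_support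
      rw [← cons_tail_support, List.pairwise_cons] at hq
      rw [← cons_tail_support] at hb
      rcases List.mem_cons.1 hb with rfl | hb
      · exact h1
      · exact h1.trans (hq.1 b hb)

end SimpleGraph.Walk

namespace OrderedTree

variable {n : ℕ} {T : OrderedTree n}

/-- A function that increases along the edges below `c` increases from the parent of `c`. -/
theorem IsChild.lt_of_forall {g : Fin n → ℝ} {x c : Fin n} (hc : T.IsChild x c)
    (h : ∀ a, T.Anc c a → g (T.par a) < g a) {a : Fin n} (ha : T.Anc c a) : g x < g a := by
  induction a using rootInduction (T := T) with
  | root => exact absurd (anc_root_iff.1 ha) hc.ne_root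
  | step a hne ih =>
    by_cases hca : c = a
    · subst hca
      have := h c ha
      rwa [hc.par_eq] at this
    · exact (ih (ha.par_of_ne hca)).trans (h a ha)

theorem IsChild.par_eq_or_lt {g : Fin n → ℝ} {x c : Fin n} (hc : T.IsChild x c)
    (h : ∀ a, T.Anc c a → g (T.par a) < g a) {a : Fin n} (ha : T.Anc c a) :
    T.par a = x ∨ g x < g (T.par a) := by
  by_cases hca : c = a
  · subst hca; exact Or.inl hc.par_eq
  · exact Or.inr (hc.lt_of_forall h (ha.par_of_ne hca))

theorem Anc.exists_walk {g : Fin n → ℝ} {x w : Fin n} (hxw : T.Anc x w)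
    (h : ∀ a, T.Anc x a → a ≠ x → T.Anc a w → g (T.par a) < g a) :
    ∃ p : T.graph.Walk x w, p.support.Pairwise fun a b => g a < g b := by
  induction w using rootInduction (T := T) with
  | root =>
    obtain rfl := anc_root_iff.1 hxw
    exact ⟨.nil, by simp⟩
  | step w hw ih =>
    by_cases hne : x = w
    · subst hne; exact ⟨.nil, by simp⟩
    · obtain ⟨p, hp⟩ := ih (hxw.par_of_ne hne)
        fun a h1 h2 h3 => h a h1 h2 (h3.trans (par_anc w))
      refine ⟨p.append (.cons (isChild_par hw).1 .nil),
        SimpleGraph.Walk.pairwise_support_append hp ?_⟩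
      simpa using h w hxw (Ne.symm hne) (anc_refl _)

/-- A slope disjoint drawing: the displacements of the vertices with respect to their parents are
coprime and positive, and their slopes increase from left to right. -/
structure IsSlopeDisjoint (T : OrderedTree n) (vec : Fin n → ℕ × ℕ) (pos : Fin n → ℤ × ℤ) :
    Prop where
  pos_eq : ∀ v, v ≠ T.root →
    pos v = ((pos (T.par v)).1 + ((vec v).1 : ℤ), (pos (T.par v)).2 + ((vec v).2 : ℤ))
  fst_pos : ∀ v, v ≠ T.root → 0 < (vec v).1
  snd_pos : ∀ v, v ≠ T.root → 0 < (vec v).2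
  coprime : ∀ v, v ≠ T.root → Nat.Coprime (vec v).1 (vec v).2
  slopeLT : ∀ v w, v ≠ T.root → w ≠ T.root → T.LeftOf v w → SlopeLT (vec v) (vec w)

/-- The projection of a point in the direction `l`. -/
def proj (l z : ℝ × ℝ) : ℝ := l.1 * z.1 + l.2 * z.2

theorem eq_of_mem_segment {l a b z : ℝ × ℝ} (hz : z ∈ segment ℝ a b) (hab : proj l a < proj l b)
    (h : proj l b ≤ proj l z) : z = b := by
  obtain ⟨s, t, hs, ht, hst, rfl⟩ := hz
  have e : proj l (s • a + t • b) = s * proj l a + t * proj l b := by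
    simp [proj]; ring
  rw [e] at h
  have hs0 : s = 0 := by
    have ht' : t = 1 - s := by linarith
    subst ht'
    by_contra hne
    have : 0 < s := lt_of_le_of_ne hs (Ne.symm hne)
    nlinarith
  have ht1 : t = 1 := by linarith
  simp [hs0, ht1]

theorem proj_mem_segment {l a b z : ℝ × ℝ} (hz : z ∈ segment ℝ a b) (hab : proj l a < proj l b) :
    proj l a ≤ proj l z ∧ proj l z ≤ proj l b := by
  obtain ⟨s, t, hs, ht, hst, rfl⟩ := hz
  have e : proj l (s • a + t • b) = s * proj l a + t * proj l b := by
    simp [proj]; ring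
  have hs' : s = 1 - t := by linarith
  rw [e]
  subst hs'
  constructor <;> nlinarith

namespace IsSlopeDisjoint

variable {vec : Fin n → ℕ × ℕ} {pos : Fin n → ℤ × ℤ} (h : T.IsSlopeDisjoint vec pos)

include h

theorem proj_pos {l : ℝ × ℝ} {v : Fin n} (hv : v ≠ T.root) :
    proj l (toPlane (pos v)) = proj l (toPlane (pos (T.par v))) +
      (l.1 * (vec v).1 + l.2 * (vec v).2) := by
  rw [h.pos_eq v hv]
  simp [proj, toPlane]
  ring

theorem proj_par_lt {v : Fin n} (hv : v ≠ T.root) :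
    proj (1, 1) (toPlane (pos (T.par v))) < proj (1, 1) (toPlane (pos v)) := by
  rw [h.proj_pos hv]
  have h1 : (0 : ℝ) < (vec v).1 := by exact_mod_cast h.fst_pos v hv
  have h2 : (0 : ℝ) < (vec v).2 := by exact_mod_cast h.snd_pos v hv
  simp only [one_mul]
  linarith

/-- The directions below two siblings are separated by a line. -/
theorem exists_separating {x c₁ c₂ : Fin n} (h1 : T.IsChild x c₁) (h2 : T.IsChild x c₂)
    (h12 : [c₁, c₂].Sublist (T.adj x)) :
    ∃ l : ℝ × ℝ, l ≠ 0 ∧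
      (∀ a, T.Anc c₁ a → -proj l (toPlane (pos (T.par a))) < -proj l (toPlane (pos a))) ∧
      (∀ a, T.Anc c₂ a → proj l (toPlane (pos (T.par a))) < proj l (toPlane (pos a))) := by
  classical
  have hroot : ∀ {c a}, T.IsChild x c → T.Anc c a → a ≠ T.root := by
    rintro c a hc ha rfl
    exact hc.ne_root (anc_root_iff.1 ha)
  have hlt : ∀ {a b}, T.Anc c₁ a → T.Anc c₂ b → SlopeLT (vec a) (vec b) := fun ha hb =>
    h.slopeLT _ _ (hroot h1 ha) (hroot h2 hb) ⟨x, c₁, c₂, h1, h2, h12, ha, hb⟩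
  -- `i` is the steepest edge on the left side and `k` the flattest on the right side. The line with
  -- direction `vec i + vec k` separates the two sides, and `l` is its normal.
  obtain ⟨i, hi, hmax⟩ := Finset.exists_max_image (Finset.univ.filter fun a => T.Anc c₁ a)
    (fun a => slopeKey (vec a)) ⟨c₁, by simp [anc_refl]⟩
  obtain ⟨k, hk, hmin⟩ := Finset.exists_min_image (Finset.univ.filter fun a => T.Anc c₂ a)
    (fun a => slopeKey (vec a)) ⟨c₂, by simp [anc_refl]⟩
  simp only [Finset.mem_filter, Finset.mem_univ, true_and] at hi hk hmax hmin
  have hri := hroot h1 hi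
  have hrk := hroot h2 hk
  refine ⟨(-(((vec i).2 : ℝ) + (vec k).2), ((vec i).1 : ℝ) + (vec k).1), ?_, ?_, ?_⟩
  · intro h0
    have h3 := congrArg Prod.snd h0
    have h4 : (0 : ℝ) < (vec i).1 := by exact_mod_cast h.fst_pos i hri
    have h5 : (0 : ℝ) ≤ (vec k).1 := by positivity
    simp at h3
    linarith
  · intro a ha
    have hra := hroot h1 ha
    have e1 : ¬ SlopeLT (vec i) (vec a) := by
      rw [slopeLT_iff (h.coprime i hri) (h.coprime a hra), not_lt]
      exact hmax a ha
    have e2 := hlt ha hk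
    unfold SlopeLT at e1 e2
    have e1' : ((vec a).2 : ℝ) * (vec i).1 ≤ (vec i).2 * (vec a).1 := by exact_mod_cast not_lt.1 e1
    have e2' : ((vec a).2 : ℝ) * (vec k).1 < (vec k).2 * (vec a).1 := by exact_mod_cast e2
    rw [h.proj_pos hra]
    simp only
    nlinarith
  · intro a ha
    have hra := hroot h2 ha
    have e1 : ¬ SlopeLT (vec a) (vec k) := by
      rw [slopeLT_iff (h.coprime a hra) (h.coprime k hrk), not_lt]
      exact hmin a ha
    have e2 := hlt hi ha
    unfold SlopeLT at e1 e2
    have e1' : ((vec k).2 : ℝ) * (vec a).1 ≤ (vec a).2 * (vec k).1 := by exact_mod_cast not_lt.1 e1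
    have e2' : ((vec i).2 : ℝ) * (vec a).1 < (vec a).2 * (vec i).1 := by exact_mod_cast e2
    rw [h.proj_pos hra]
    simp only
    nlinarith

theorem exists_monotone_of_anc {u w : Fin n} (huw : T.Anc u w) :
    ∃ (l : ℝ × ℝ) (p : T.graph.Walk u w), l ≠ 0 ∧
      p.support.Pairwise fun a b => proj l (toPlane (pos a)) < proj l (toPlane (pos b)) := by
  obtain ⟨p, hp⟩ := huw.exists_walk (g := fun a => proj (1, 1) (toPlane (pos a)))
    fun a h1 h2 _ => h.proj_par_lt fun h0 => h2 (by subst h0; exact (anc_root_iff.1 h1).symm)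
  exact ⟨(1, 1), p, by simp, hp⟩

/-- The path climbs from `u` to the branching vertex and then descends to `w`. Away from that vertex
`l` decreases on the left side and increases on the right side, so it increases along the whole
path. -/
theorem exists_monotone_of_leftOf {u w : Fin n} (huw : T.LeftOf u w) :
    ∃ (l : ℝ × ℝ) (p : T.graph.Walk u w), l ≠ 0 ∧
      p.support.Pairwise fun a b => proj l (toPlane (pos a)) < proj l (toPlane (pos b)) := by
  obtain ⟨x, c₁, c₂, h1, h2, h12, hu, hw⟩ := huw
  obtain ⟨l, hl, hl1, hl2⟩ := h.exists_separating h1 h2 h12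
  have hstep : ∀ {c v a}, T.IsChild x c → T.Anc c v → T.Anc x a → a ≠ x → T.Anc a v →
      T.Anc c a := by
    intro c v a hc hv hxa hne hav
    obtain ⟨e, he, hea⟩ := hxa.exists_child (Ne.symm hne)
    rwa [hc.eq_of_anc he hv (hea.trans hav)]
  obtain ⟨p, hp⟩ := (h1.anc.trans hu).exists_walk (g := fun a => -proj l (toPlane (pos a)))
    fun a h3 h4 h5 => hl1 a (hstep h1 hu h3 h4 h5)
  obtain ⟨q, hq⟩ := (h2.anc.trans hw).exists_walk (g := fun a => proj l (toPlane (pos a)))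
    fun a h3 h4 h5 => hl2 a (hstep h2 hw h3 h4 h5)
  refine ⟨l, p.reverse.append q, hl, SimpleGraph.Walk.pairwise_support_append ?_ hq⟩
  rw [SimpleGraph.Walk.support_reverse, List.pairwise_reverse]
  exact hp.imp fun h => neg_lt_neg_iff.1 h

theorem exists_monotone (u w : Fin n) :
    ∃ p : T.graph.Walk u w, p.IsPath ∧ IsMonotoneWalk pos p := by
  have key : ∃ (l : ℝ × ℝ) (p : T.graph.Walk u w), l ≠ 0 ∧
      p.support.Pairwise fun a b => proj l (toPlane (pos a)) < proj l (toPlane (pos b)) := by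
    have hrev : (∃ (l : ℝ × ℝ) (p : T.graph.Walk w u), l ≠ 0 ∧
        p.support.Pairwise fun a b => proj l (toPlane (pos a)) < proj l (toPlane (pos b))) →
        ∃ (l : ℝ × ℝ) (p : T.graph.Walk u w), l ≠ 0 ∧
        p.support.Pairwise fun a b => proj l (toPlane (pos a)) < proj l (toPlane (pos b)) := by
      rintro ⟨l, p, hl, hp⟩
      refine ⟨-l, p.reverse, neg_ne_zero.2 hl, ?_⟩
      rw [SimpleGraph.Walk.support_reverse, List.pairwise_reverse]
      refine hp.imp fun h => ?_
      simp only [proj, Prod.fst_neg, Prod.snd_neg] at h ⊢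
      linarith
    by_cases h1 : T.Anc u w
    · exact h.exists_monotone_of_anc h1
    by_cases h2 : T.Anc w u
    · exact hrev (h.exists_monotone_of_anc h2)
    rcases leftOf_or_leftOf_of_not_anc h1 h2 with h3 | h3
    · exact h.exists_monotone_of_leftOf h3
    · exact hrev (h.exists_monotone_of_leftOf h3)
  obtain ⟨l, p, hl, hp⟩ := key
  refine ⟨p, ?_, l, hl, hp⟩
  rw [SimpleGraph.Walk.isPath_def]
  exact hp.imp fun {a b} h hab => by subst hab; exact lt_irrefl _ h

/-- The first and the last vertex of a nontrivial monotone walk have different projections. -/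
theorem injective : Function.Injective pos := by
  intro u w huw
  obtain ⟨p, -, l, -, hp⟩ := h.exists_monotone u w
  cases p with
  | nil => rfl
  | cons hadj p =>
    rw [SimpleGraph.Walk.support_cons, List.pairwise_cons] at hp
    have := hp.1 w p.end_mem_support
    rw [huw] at this
    exact absurd this (lt_irrefl _)

/-- In direction `(1, 1)` the edge above `v` ends where the subtree of `v` begins, so a common point
is `v`, and `v` is then the parent of `w`. -/
theorem exists_common_of_anc {v w : Fin n} (hv : v ≠ T.root) (hw : w ≠ T.root) (hne : v ≠ w)
    (hvw : T.Anc v w) {z : ℝ × ℝ}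
    (hz : z ∈ segment ℝ (toPlane (pos (T.par v))) (toPlane (pos v)))
    (hz' : z ∈ segment ℝ (toPlane (pos (T.par w))) (toPlane (pos w))) :
    ∃ t : Fin n, t ∈ s(T.par v, v) ∧ t ∈ s(T.par w, w) ∧ z = toPlane (pos t) := by
  have hvp := hvw.par_of_ne hne
  have h1 := (proj_mem_segment hz (h.proj_par_lt hv)).2
  have h2 := (proj_mem_segment hz' (h.proj_par_lt hw)).1
  obtain ⟨c, hc, hcw⟩ := hvw.exists_child hne
  rcases hc.par_eq_or_lt (g := fun a => proj (1, 1) (toPlane (pos a)))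
    (fun a ha => h.proj_par_lt fun h0 => hc.ne_root (by subst h0; exact anc_root_iff.1 ha)) hcw
    with h3 | h3
  · refine ⟨v, by simp, by simp [h3], eq_of_mem_segment hz (h.proj_par_lt hv) ?_⟩
    rwa [h3] at h2
  · exact absurd (h3.trans_le (h2.trans h1)) (lt_irrefl _)

/-- The branching vertex `x` has the largest projection on `l` among the points of the left side and
the smallest among those of the right side, so the two edges can meet only there. -/
theorem exists_common_of_leftOf {v w : Fin n} (hvw : T.LeftOf v w) {z : ℝ × ℝ}
    (hz : z ∈ segment ℝ (toPlane (pos (T.par v))) (toPlane (pos v)))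
    (hz' : z ∈ segment ℝ (toPlane (pos (T.par w))) (toPlane (pos w))) :
    ∃ t : Fin n, t ∈ s(T.par v, v) ∧ t ∈ s(T.par w, w) ∧ z = toPlane (pos t) := by
  obtain ⟨x, c₁, c₂, h1, h2, h12, hv, hw⟩ := hvw
  obtain ⟨l, hl, hl1, hl2⟩ := h.exists_separating h1 h2 h12
  have e1 := neg_lt_neg_iff.1 (hl1 v hv)
  have e2 := hl2 w hw
  rw [segment_symm] at hz
  have h3 := (proj_mem_segment hz e1).2
  have h4 := (proj_mem_segment hz' e2).1
  rcases h1.par_eq_or_lt (g := fun a => -proj l (toPlane (pos a))) hl1 hv with h5 | h5 <;>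
    rcases h2.par_eq_or_lt (g := fun a => proj l (toPlane (pos a))) hl2 hw with h6 | h6
  · refine ⟨x, by simp [h5], by simp [h6], ?_⟩
    rw [h5] at hz e1
    rw [h6] at h4
    exact eq_of_mem_segment hz e1 h4
  · rw [h5] at h3; linarith
  · rw [h6] at h4; linarith
  · linarith

theorem isMonotoneDrawing : IsMonotoneDrawing T.graph pos := by
  refine ⟨⟨h.injective, ?_⟩, h.exists_monotone⟩
  have core : ∀ v w : Fin n, v ≠ T.root → w ≠ T.root → v ≠ w → ∀ z : ℝ × ℝ,
      z ∈ segment ℝ (toPlane (pos (T.par v))) (toPlane (pos v)) →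
      z ∈ segment ℝ (toPlane (pos (T.par w))) (toPlane (pos w)) →
      ∃ t : Fin n, t ∈ s(T.par v, v) ∧ t ∈ s(T.par w, w) ∧ z = toPlane (pos t) := by
    intro v w hv hw hne z hz hz'
    by_cases h1 : T.Anc v w
    · exact h.exists_common_of_anc hv hw hne h1 hz hz'
    by_cases h2 : T.Anc w v
    · obtain ⟨t, h3, h4, h5⟩ := h.exists_common_of_anc hw hv hne.symm h2 hz' hz
      exact ⟨t, h4, h3, h5⟩
    rcases leftOf_or_leftOf_of_not_anc h1 h2 with h3 | h3
    · exact h.exists_common_of_leftOf h3 hz hz'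
    · obtain ⟨t, h3, h4, h5⟩ := h.exists_common_of_leftOf h3 hz' hz
      exact ⟨t, h4, h3, h5⟩
  have edge : ∀ u v, T.graph.Adj u v → ∃ c, c ≠ T.root ∧ s(T.par c, c) = s(u, v) ∧
      segment ℝ (toPlane (pos (T.par c))) (toPlane (pos c)) =
        segment ℝ (toPlane (pos u)) (toPlane (pos v)) := by
    intro u v huv
    rcases isChild_or_isChild_of_adj huv with hc | hc
    · exact ⟨v, hc.ne_root, by rw [hc.par_eq], by rw [hc.par_eq]⟩
    · exact ⟨u, hc.ne_root, by rw [hc.par_eq, Sym2.eq_swap], by rw [hc.par_eq, segment_symm]⟩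
  intro u v x y huv hxy hne z hz hz'
  obtain ⟨c, hc, e1, e2⟩ := edge u v huv
  obtain ⟨c', hc', e3, e4⟩ := edge x y hxy
  rw [← e2] at hz
  rw [← e4] at hz'
  rw [← e1, ← e3] at hne ⊢
  exact core c c' hc hc' (by rintro rfl; exact hne rfl) z hz hz'

end IsSlopeDisjoint

end OrderedTree

/-! ### The size of the grid. -/

namespace PathDecomposition

open OrderedTree

variable {n : ℕ} {T : OrderedTree n} {B : PathDecomposition T} {f d : ℕ}
  {R : ℕ → Finset (ℕ × ℕ)} {a : Fin B.t → ℕ × ℕ} {pos : Fin n → ℤ × ℤ}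

/-- An edge has the vector of a path whose leaf lies below it, and `LeftOf` is inherited by
descendants; so the order of the vectors carries over from leaves to edges. -/
theorem isSlopeDisjoint (hd : 0 < d) (hR : IsVectorFamily f d (Nat.clog (f + 1) n) R)
    (ha : IsAssignment B (f + 1) R a) (hpos : IsDrawnBy B a pos) :
    T.IsSlopeDisjoint (B.edgeVec a) pos := by
  have hmem : ∀ v, v ≠ T.root → B.edgeVec a v ∈ primVec (d ^ Nat.clog (f + 1) n) := by
    intro v hv
    obtain ⟨k, hk⟩ := B.exists_mem_lowerEnds hv
    obtain ⟨j, hj, hak, -⟩ := ha k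
    rw [B.edgeVec_eq a hk]
    exact hR.subset_primVec hd le_rfl (unionUpTo_mono R hj.2.1 hak)
  refine ⟨(B.isDrawnBy_iff.1 hpos).2, fun v hv => (mem_primVec.1 (hmem v hv)).1.1,
    fun v hv => (mem_primVec.1 (hmem v hv)).2.1.1, fun v hv => (mem_primVec.1 (hmem v hv)).2.2,
    fun v w hv hw hvw => ?_⟩
  obtain ⟨i, hi⟩ := B.exists_mem_lowerEnds hv
  obtain ⟨k, hk⟩ := B.exists_mem_lowerEnds hw
  rw [B.edgeVec_eq a hi, B.edgeVec_eq a hk]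
  obtain ⟨j, -, -, hleft, -⟩ := ha k
  exact hleft i (hvw.mono (B.mem_lowerEnds.1 hi).2.1 (B.mem_lowerEnds.1 hk).2.1)

/-- The sum of the sizes of the vectors on the path from the root to a vertex. -/
theorem sum_pow_level_path_le {c : ℕ} (hc : 1 < c) (hdc : d < c)
    (hB : B.IsLengthDecreasing) {lev : Fin n → ℕ}
    (hlev : ∀ k, ∀ w ∈ B.lowerEnds k, B.IsLevel c k (lev w)) (v : Fin n) {S : Finset (Fin n)}
    (hS : ∀ w ∈ S, w ≠ T.root ∧ T.Anc w v) :
    ((∑ w ∈ S, d ^ lev w : ℕ) : ℝ) ≤ (c : ℝ) * d / (c - d) * ((n : ℝ) - 1) := by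
  classical
  have hn : 1 ≤ n := Fin.pos T.root
  set K := Nat.clog c n with hK
  have hlv : ∀ w ∈ S, ∃ k, w ∈ B.lowerEnds k ∧ B.IsLevel c k (lev w) := fun w hw => by
    obtain ⟨k, hk⟩ := B.exists_mem_lowerEnds (hS w hw).1
    exact ⟨k, hk, hlev k w hk⟩
  -- The vertices of level `j` above `v` may lie on several paths. By `depth_le`, applied to the
  -- path of each such `w`, the distance from the parent of `w` down to `v` is at most the length of
  -- a path of level `j`; these distances are positive and distinct.
  have hcard : ∀ j, 1 ≤ j → (S.filter fun w => lev w = j).card * c ^ (j - 1) ≤ n - 1 := by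
    intro j hj
    have hsub : (S.filter fun w => lev w = j).image (fun w => T.depth v + 1 - T.depth w) ⊆
        Finset.Icc 1 ((n - 1) / c ^ (j - 1)) := by
      intro m hm
      obtain ⟨w, hw, rfl⟩ := Finset.mem_image.1 hm
      rw [Finset.mem_filter] at hw
      obtain ⟨k, hk, hl⟩ := hlv w hw.1
      rw [hw.2] at hl
      have hwv := (hS w hw.1).2
      have h1 := hwv.depth_le
      have h2 := hB.depth_le hk hwv
      obtain ⟨h3, -, h4⟩ := B.mem_lowerEnds.1 hk
      have h5 : T.depth (B.attach k) < T.depth w := by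
        by_contra hcon
        exact h4 (h3.eq_of_depth_le (by omega)).symm
      have h6 := hl.length_mul_le (by omega)
      rw [Finset.mem_Icc, Nat.le_div_iff_mul_le (by positivity)]
      refine ⟨by omega, le_trans (Nat.mul_le_mul_right _ ?_) h6⟩
      omega
    have hinj : Set.InjOn (fun w => T.depth v + 1 - T.depth w)
        (S.filter fun w => lev w = j : Finset (Fin n)) := by
      intro x hx y hy hxy
      simp only [Finset.coe_filter, Set.mem_ofPred_eq] at hx hy
      have h1 := (hS x hx.1).2
      have h2 := (hS y hy.1).2
      have h3 := h1.depth_le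
      have h4 := h2.depth_le
      simp only at hxy
      rcases h1.total h2 with h5 | h5
      · exact h5.eq_of_depth_le (by omega)
      · exact (h5.eq_of_depth_le (by omega)).symm
    have h7 := Finset.card_le_card hsub
    rw [Finset.card_image_of_injOn hinj, Nat.card_Icc, Nat.add_sub_cancel] at h7
    exact (Nat.le_div_iff_mul_le (by positivity)).1 h7
  have hmaps : ∀ w ∈ S, lev w ∈ Finset.Icc 1 K := fun w hw => by
    obtain ⟨k, -, hl⟩ := hlv w hw
    exact Finset.mem_Icc.2 ⟨hl.1, hl.2.1⟩
  have hsum : ∑ w ∈ S, d ^ lev w =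
      ∑ j ∈ Finset.Icc 1 K, (S.filter fun w => lev w = j).card * d ^ j := by
    rw [← Finset.sum_fiberwise_of_maps_to hmaps]
    refine Finset.sum_congr rfl fun j _ => ?_
    rw [Finset.sum_congr rfl (g := fun _ => d ^ j) fun w hw => by rw [(Finset.mem_filter.1 hw).2],
      Finset.sum_const, smul_eq_mul]
  have hcR : (0 : ℝ) < c := by exact_mod_cast (show 0 < c by omega)
  have hdc' : (d : ℝ) < c := by exact_mod_cast hdc
  have hn' : (0 : ℝ) ≤ (n : ℝ) - 1 := by
    have : (1 : ℝ) ≤ n := by exact_mod_cast hn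
    linarith
  rw [hsum]
  push_cast
  -- Level `j` contributes at most `(n - 1) / c ^ (j - 1)` terms `d ^ j`: a geometric series of
  -- ratio `d / c < 1`.
  calc ∑ j ∈ Finset.Icc 1 K, ((S.filter fun w => lev w = j).card : ℝ) * (d : ℝ) ^ j
      ≤ ∑ j ∈ Finset.Icc 1 K, ((n : ℝ) - 1) * d * ((d : ℝ) / c) ^ (j - 1) := by
        refine Finset.sum_le_sum fun j hj => ?_
        have h1 := (Finset.mem_Icc.1 hj).1
        have h2 : ((S.filter fun w => lev w = j).card : ℝ) * (c : ℝ) ^ (j - 1) ≤ (n : ℝ) - 1 := by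
          have := hcard j h1
          have h3 : (((S.filter fun w => lev w = j).card * c ^ (j - 1) : ℕ) : ℝ) ≤
              ((n - 1 : ℕ) : ℝ) := by exact_mod_cast this
          push_cast [hn] at h3
          exact h3
        obtain ⟨i, rfl⟩ : ∃ i, j = i + 1 := ⟨j - 1, by omega⟩
        rw [Nat.add_sub_cancel] at h2 ⊢
        rw [div_pow, pow_succ]
        have h4 : ((S.filter fun w => lev w = i + 1).card : ℝ) ≤ ((n : ℝ) - 1) / (c : ℝ) ^ i := by
          rw [le_div_iff₀ (by positivity)]; exact h2
        calc _ ≤ ((n : ℝ) - 1) / (c : ℝ) ^ i * ((d : ℝ) ^ i * d) :=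
              mul_le_mul_of_nonneg_right h4 (by positivity)
          _ = _ := by ring
    _ = ((n : ℝ) - 1) * d * ∑ i ∈ Finset.range K, ((d : ℝ) / c) ^ i := by
        rw [← Finset.mul_sum, Finset.range_eq_Ico]
        congr 1
        rw [Finset.sum_Ico_eq_sum_range]
        have : Finset.Icc 1 K = Finset.Ico 1 (K + 1) := by ext; simp
        rw [this, Finset.sum_Ico_eq_sum_range]
        simp
    _ ≤ ((n : ℝ) - 1) * d * (1 - (d : ℝ) / c)⁻¹ := by
        refine mul_le_mul_of_nonneg_left ?_ (by positivity)
        rw [← tsum_geometric_of_lt_one (by positivity) (by rwa [div_lt_one hcR])]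
        exact (summable_geometric_of_lt_one (by positivity)
          (by rwa [div_lt_one hcR])).sum_le_tsum _ fun _ _ => by positivity
    _ = (c : ℝ) * d / (c - d) * ((n : ℝ) - 1) := by
        have : (c : ℝ) - d ≠ 0 := by linarith
        rw [show (1 - (d : ℝ) / c) = (c - d) / c by field_simp]
        field_simp

theorem exists_isOnGrid (hd : 0 < d) (hdf : d ≤ f) (hB : B.IsLengthDecreasing)
    (hR : IsVectorFamily f d (Nat.clog (f + 1) n) R)
    (ha : IsAssignment B (f + 1) R a) (hpos : IsDrawnBy B a pos) :
    ∃ I : ℕ, (I : ℝ) ≤ ((f : ℝ) + 1) * (d : ℝ) / (((f : ℝ) + 1) - (d : ℝ)) * (n : ℝ) ∧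
      IsOnGrid pos I := by
  classical
  choose j hj hak _ _ using ha
  let lev : Fin n → ℕ := fun v => if h : ∃ k, v ∈ B.lowerEnds k then j h.choose else 0
  have hlev_eq : ∀ k, ∀ w ∈ B.lowerEnds k, lev w = j k := by
    intro k w hw
    have hex : ∃ k, w ∈ B.lowerEnds k := ⟨k, hw⟩
    simp only [lev, dif_pos hex]
    rw [B.lowerEnds_unique hex.choose_spec hw]
  have hlev : ∀ k, ∀ w ∈ B.lowerEnds k, B.IsLevel (f + 1) k (lev w) := fun k w hw => by
    rw [hlev_eq k w hw]; exact hj k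
  have hvec : ∀ v, v ≠ T.root → B.edgeVec a v ∈ primVec (d ^ lev v) := by
    intro v hv
    obtain ⟨k, hk⟩ := B.exists_mem_lowerEnds hv
    rw [B.edgeVec_eq a hk, hlev_eq k v hk]
    exact hR.subset_primVec hd (hj k).2.1 (hak k)
  obtain ⟨hroot, hstep⟩ := B.isDrawnBy_iff.1 hpos
  let S : Fin n → Finset (Fin n) := fun v => Finset.univ.filter fun w => w ≠ T.root ∧ T.Anc w v
  have hS : ∀ v, v ≠ T.root → S v = insert v (S (T.par v)) := by
    intro v hv
    ext w
    simp only [S, Finset.mem_filter, Finset.mem_univ, true_and, Finset.mem_insert]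
    constructor
    · rintro ⟨h1, h2⟩
      rcases anc_iff.1 h2 with rfl | h3
      · exact Or.inl rfl
      · exact Or.inr ⟨h1, h3.2⟩
    · rintro (rfl | ⟨h1, h2⟩)
      · exact ⟨hv, anc_refl _⟩
      · exact ⟨h1, h2.trans (par_anc v)⟩
  have hbound : ∀ v, 0 ≤ (pos v).1 ∧ (pos v).1 ≤ (∑ w ∈ S v, d ^ lev w : ℕ) ∧
      0 ≤ (pos v).2 ∧ (pos v).2 ≤ (∑ w ∈ S v, d ^ lev w : ℕ) := by
    intro v
    induction v using rootInduction (T := T) with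
    | root => rw [hroot]; exact ⟨le_rfl, by positivity, le_rfl, by positivity⟩
    | step v hv ih =>
      obtain ⟨h1, h2, -⟩ := mem_primVec.1 (hvec v hv)
      have hnot : v ∉ S (T.par v) := by
        simp only [S, Finset.mem_filter, Finset.mem_univ, true_and, not_and]
        exact fun _ => (isChild_par hv).not_anc
      rw [hS v hv, Finset.sum_insert hnot, hstep v hv]
      have h3 : (((B.edgeVec a v).1 : ℕ) : ℤ) ≤ ((d ^ lev v : ℕ) : ℤ) := by exact_mod_cast h1.2
      have h4 : (((B.edgeVec a v).2 : ℕ) : ℤ) ≤ ((d ^ lev v : ℕ) : ℤ) := by exact_mod_cast h2.2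
      rw [Nat.cast_add]
      simp only
      omega
  have hn : (1 : ℝ) ≤ n := by exact_mod_cast Fin.pos T.root
  have hdR : (1 : ℝ) ≤ d := by exact_mod_cast hd
  have hdf' : (d : ℝ) ≤ f := by exact_mod_cast hdf
  set q : ℝ := ((f : ℝ) + 1) * (d : ℝ) / (((f : ℝ) + 1) - (d : ℝ)) with hq
  -- Coordinates up to `q * (n - 1)` need one more column than that; since `q ≥ 1`, the factor `n`
  -- absorbs it.
  have hq1 : 1 ≤ q := by
    rw [hq, le_div_iff₀ (by linarith)]
    nlinarith
  have hle : ∀ v, ((∑ w ∈ S v, d ^ lev w : ℕ) : ℝ) ≤ q * ((n : ℝ) - 1) := by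
    intro v
    have := sum_pow_level_path_le (d := d) (c := f + 1) (by omega) (by omega) hB hlev v (S := S v)
      (fun w hw => by simpa [S] using hw)
    push_cast at this ⊢
    exact this
  have hcoord : ∀ v, (∑ w ∈ S v, d ^ lev w : ℕ) < ⌊q * ((n : ℝ) - 1)⌋₊ + 1 := fun v =>
    Nat.lt_succ_of_le (Nat.le_floor (hle v))
  refine ⟨⌊q * ((n : ℝ) - 1)⌋₊ + 1, ?_, fun v => ?_⟩
  · have := Nat.floor_le (show 0 ≤ q * ((n : ℝ) - 1) by
      apply mul_nonneg <;> linarith)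
    push_cast
    nlinarith
  · obtain ⟨h1, h2, h3, h4⟩ := hbound v
    have h5 : ((∑ w ∈ S v, d ^ lev w : ℕ) : ℤ) < ((⌊q * ((n : ℝ) - 1)⌋₊ + 1 : ℕ) : ℤ) := by
      exact_mod_cast hcoord v
    exact ⟨h1, by omega, h3, by omega⟩

end PathDecomposition

/-! ### Length decreasing decompositions obtained from heights. -/

namespace OrderedTree

variable {n : ℕ} {T : OrderedTree n}

/-- `h` is the height of the vertices other than the root, `lf w` is a deepest leaf below `w`,
chosen consistently along a path, and `len l` is the length of the longest path with the same
choice `l`. -/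
structure IsLongPathData (T : OrderedTree n) (h : Fin n → ℕ) (lf : Fin n → Fin n)
    (len : Fin n → ℕ) : Prop where
  height_lt : ∀ u w, u ≠ T.root → T.IsChild u w → h w + 1 ≤ h u
  exists_child : ∀ w, w ≠ T.root → ¬ T.IsLeaf w →
    ∃ b, T.IsChild w b ∧ h b + 1 = h w ∧ lf w = lf b
  leaf : ∀ l, T.IsLeaf l → h l = 0 ∧ lf l = l
  exists_top : ∀ l, T.IsLeaf l → ∃ w, w ≠ T.root ∧ lf w = l ∧ len l = h w + 1 ∧
    ∀ x, x ≠ T.root → lf x = l → h x ≤ h w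

namespace IsLongPathData

variable {h : Fin n → ℕ} {lf : Fin n → Fin n} {len : Fin n → ℕ}

theorem spec (H : T.IsLongPathData h lf len) {w : Fin n} (hw : w ≠ T.root) :
    T.IsLeaf (lf w) ∧ T.Anc w (lf w) ∧ T.depth (lf w) = T.depth w + h w := by
  induction hm : h w using Nat.strong_induction_on generalizing w with
  | _ m ih =>
    by_cases hl : T.IsLeaf w
    · obtain ⟨h1, h2⟩ := H.leaf w hl
      rw [h2]
      exact ⟨hl, anc_refl _, by omega⟩
    · obtain ⟨b, hb, h1, h2⟩ := H.exists_child w hw hl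
      obtain ⟨h3, h4, h5⟩ := ih (h b) (by omega) hb.ne_root rfl
      rw [h2]
      have := hb.depth
      exact ⟨h3, hb.anc.trans h4, by omega⟩

/-- The chosen children, followed from `w`, trace the way down to `lf w`, and every vertex on it
makes the same choice. -/
theorem lf_eq_of_anc (H : T.IsLongPathData h lf len) {w x : Fin n} (hw : w ≠ T.root)
    (hwx : T.Anc w x) (hx : T.Anc x (lf w)) : lf x = lf w := by
  induction hm : h w using Nat.strong_induction_on generalizing w with
  | _ m ih =>
    by_cases hwx' : w = x
    · rw [hwx']
    by_cases hl : T.IsLeaf w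
    · exact absurd (hl.eq_of_anc hwx) hwx'
    · obtain ⟨b, hb, h1, h2⟩ := H.exists_child w hw hl
      obtain ⟨c, hc, hcx⟩ := hwx.exists_child hwx'
      have hbl := (H.spec hb.ne_root).2.1
      rw [h2] at hx ⊢
      have := hc.eq_of_anc hb (hcx.trans hx) hbl
      subst this
      exact ih (h c) (by omega) hb.ne_root hcx hx rfl

theorem height_add_le (H : T.IsLongPathData h lf len) {u v : Fin n} (hu : u ≠ T.root)
    (huv : T.Anc u v) : h v + T.depth v ≤ h u + T.depth u := by
  induction v using rootInduction (T := T) with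
  | root => exact absurd (anc_root_iff.1 huv) hu
  | step v hv ih =>
    by_cases hne : u = v
    · rw [hne]
    · have h1 := huv.par_of_ne hne
      have h2 := ih h1
      have hpar : T.par v ≠ T.root := by
        intro h0
        rw [h0] at h1
        exact hu (anc_root_iff.1 h1)
      have h3 := H.height_lt _ _ hpar (isChild_par hv)
      have := depth_par hv
      omega

/-- The vertices with a common value of `lf` form a path, hanging from the parent of its uppermost
vertex `top l`. In order of decreasing length these paths are a greedy decomposition: the path
through the parent of `top l` is longer and so comes earlier, and below an uncovered vertex no leaf
is deeper than the end of its own path. Since the last two conclusions refer only to `len` and `lf`,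
a program need not sort. -/
theorem exists_pathDecomposition (H : T.IsLongPathData h lf len) :
    ∃ B : PathDecomposition T, B.IsLengthDecreasing ∧ (∀ k, B.length k = len (B.leaf k)) ∧
      ∀ k w, w ≠ T.root → (w ∈ B.lowerEnds k ↔ lf w = B.leaf k) := by
  classical
  have htop := H.exists_top
  choose! top htop_root htop_lf htop_len htop_max using htop
  have htl : ∀ {l}, T.IsLeaf l → T.Anc (top l) l := fun {l} hl => by
    have := (H.spec (htop_root l hl)).2.1
    rwa [htop_lf l hl] at this
  have hpath : ∀ {l w}, T.IsLeaf l → w ≠ T.root → (lf w = l ↔ T.Anc (top l) w ∧ T.Anc w l) := by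
    intro l w hl hw
    constructor
    · intro hlw
      have hwl := (H.spec hw).2.1
      rw [hlw] at hwl
      refine ⟨?_, hwl⟩
      rcases (htl hl).total hwl with h1 | h1
      · exact h1
      · have h2 := H.height_add_le hw h1
        have h3 := htop_max l hl w hw hlw
        exact (h1.eq_of_depth_le (by omega)) ▸ anc_refl _
    · rintro ⟨h1, h2⟩
      have := H.lf_eq_of_anc (htop_root l hl) h1 (by rwa [htop_lf l hl])
      rw [this, htop_lf l hl]
  let s : Finset (Fin n) := Finset.univ.filter fun v => T.IsLeaf v
  let e : Fin s.card ≃ s := s.equivFin.symm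
  -- Negated, because `Tuple.sort` sorts in increasing order.
  let key : Fin s.card → ℤ := fun i => -(len (e i) : ℤ)
  let σ := Tuple.sort key
  let leaf : Fin s.card → Fin n := fun i => e (σ i)
  let attach : Fin s.card → Fin n := fun i => T.par (top (leaf i))
  have hleaf : ∀ i, T.IsLeaf (leaf i) := fun i =>
    (Finset.mem_filter.1 (e (σ i)).2).2
  have hanti : ∀ i k, i ≤ k → len (leaf k) ≤ len (leaf i) := by
    intro i k hik
    have := Tuple.monotone_sort key hik
    simp only [key, Function.comp] at this
    simpa using this
  have hinj : Function.Injective leaf := fun i k hik => σ.injective (e.injective (Subtype.ext hik))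
  have hrange : ∀ l, T.IsLeaf l → ∃ i, leaf i = l := by
    intro l hl
    refine ⟨σ.symm (e.symm ⟨l, by simp [s, hl]⟩), ?_⟩
    simp [leaf]
  have hatt_anc : ∀ i, T.Anc (attach i) (leaf i) := fun i =>
    (par_anc _).trans (htl (hleaf i))
  have hlen : ∀ i, T.graph.dist (leaf i) (attach i) = len (leaf i) := by
    intro i
    rw [dist_of_anc' (hatt_anc i)]
    have h1 := depth_par (htop_root _ (hleaf i))
    have h2 := (H.spec (htop_root _ (hleaf i))).2.2
    rw [htop_lf _ (hleaf i)] at h2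
    rw [htop_len _ (hleaf i)]
    simp only [attach]
    omega
  have hmem : ∀ i w, w ≠ T.root → lf w = leaf i → w ∈ T.pathUp (leaf i) (attach i) := by
    intro i w hw hlw
    obtain ⟨h1, h2⟩ := (hpath (hleaf i) hw).1 hlw
    exact ⟨(par_anc _).trans h1, h2⟩
  -- the path through a vertex is longer than the paths attached to it
  have hattach_lt : ∀ i, attach i ≠ T.root → ∃ m, m < i ∧ lf (attach i) = leaf m := by
    intro i hi
    obtain ⟨m, hm⟩ := hrange _ (H.spec hi).1
    refine ⟨m, ?_, hm.symm⟩
    by_contra hcon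
    have h1 := hanti i m (not_lt.1 hcon)
    have h2 := htop_max _ (hleaf m) _ hi hm.symm
    have h3 : h (top (leaf i)) + 1 ≤ h (attach i) :=
      H.height_lt _ _ hi (isChild_par (htop_root _ (hleaf i)))
    rw [htop_len _ (hleaf m), htop_len _ (hleaf i)] at h1
    omega
  have hAtt : ∀ k, T.IsAttachment (T.unionBefore leaf attach k) (leaf k) (attach k) := by
    intro k
    refine ⟨?_, hatt_anc k, ?_⟩
    · by_cases h0 : attach k = T.root
      · exact Or.inl h0
      · obtain ⟨m, hm, hlm⟩ := hattach_lt k h0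
        exact Or.inr ⟨m, hm, hmem m _ h0 hlm⟩
    · intro w hw hwl
      rcases (hatt_anc k).total hwl with h1 | h1
      · by_cases hwa : attach k = w
        · rw [hwa]
        exfalso
        have hwr : w ≠ T.root := by
          rintro rfl
          exact hwa (anc_root_iff.1 h1)
        obtain ⟨c, hc, hcw⟩ := h1.exists_child hwa
        have hct : c = top (leaf k) := hc.eq_of_anc (isChild_par (htop_root _ (hleaf k)))
          (hcw.trans hwl) (htl (hleaf k))
        have hlw : lf w = leaf k := (hpath (hleaf k) hwr).2 ⟨hct ▸ hcw, hwl⟩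
        rcases hw with hw | ⟨i, hik, hw1, hw2⟩
        · exact hwr hw
        -- Path `i` also contains its attachment, which belongs to a still earlier path; hence the
        -- two cases.
        · by_cases hwi : attach i = w
          · obtain ⟨m, hm, hlm⟩ := hattach_lt i (hwi ▸ hwr)
            rw [hwi, hlw] at hlm
            have := hinj hlm
            omega
          · obtain ⟨c', hc', hcw'⟩ := hw1.exists_child hwi
            have hct' : c' = top (leaf i) := hc'.eq_of_anc
              (isChild_par (htop_root _ (hleaf i))) (hcw'.trans hw2) (htl (hleaf i))
            have hlw' : lf w = leaf i := (hpath (hleaf i) hwr).2 ⟨hct' ▸ hcw', hw2⟩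
            rw [hlw] at hlw'
            exact hik.ne' (hinj hlw')
      · exact h1
  let B : PathDecomposition T :=
    { t := s.card
      leaf := leaf
      leaf_injective := hinj
      range_leaf := by
        ext l
        exact ⟨by rintro ⟨i, rfl⟩; exact hleaf i, fun hl => hrange l hl⟩
      attach := attach
      isAttachment := hAtt }
  refine ⟨B, ?_, hlen, ?_⟩
  · intro k l hl hun u hu
    have hul := hu.2.1
    rw [dist_of_anc' hul]
    by_cases hne : u = l
    · rw [hne]; omega
    -- The vertex `y` just below the attachment is uncovered, so its path stands at position `k` or
    -- later. The length of that path is at least `h y + 1`, which bounds the distance from `l` to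
    -- `u`.
    obtain ⟨y, hy, hyl⟩ := hul.exists_child hne
    have hyr := hy.ne_root
    obtain ⟨m, hm⟩ := hrange _ (H.spec hyr).1
    have hkm : k ≤ m := by
      by_contra hcon
      have : y ∈ T.unionBefore leaf attach k :=
        Or.inr ⟨m, not_le.1 hcon, hmem m y hyr hm.symm⟩
      exact hy.not_anc (hu.2.2 y this hyl)
    have h1 := hanti k m hkm
    have h2 := htop_max _ (hleaf m) y hyr hm.symm
    have h3 := H.height_add_le hyr hyl
    have h4 := hy.depth
    have h5 : B.length k = len (leaf k) := hlen k
    rw [h5]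
    rw [htop_len _ (hleaf m)] at h1
    omega
  · intro k w hw
    rw [B.mem_lowerEnds]
    change T.Anc (attach k) w ∧ T.Anc w (leaf k) ∧ w ≠ attach k ↔ lf w = leaf k
    rw [hpath (hleaf k) hw]
    constructor
    · rintro ⟨h1, h2, h3⟩
      obtain ⟨c, hc, hcw⟩ := h1.exists_child (Ne.symm h3)
      have hct : c = top (leaf k) := hc.eq_of_anc (isChild_par (htop_root _ (hleaf k)))
        (hcw.trans h2) (htl (hleaf k))
      exact ⟨hct ▸ hcw, h2⟩
    · rintro ⟨h1, h2⟩
      refine ⟨(par_anc _).trans h1, h2, ?_⟩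
      rintro rfl
      exact (isChild_par (htop_root _ (hleaf k))).not_anc h1

end IsLongPathData

end OrderedTree

/-! ### Farey sequences -/

theorem Nat.coprime_of_mul_eq_mul_add_one {a b c d : ℕ} (h : a * d = b * c + 1) :
    Nat.Coprime a b := by
  have h1 : Nat.gcd a b ∣ 1 := by
    have h2 : Nat.gcd a b ∣ b * c + 1 := h ▸ (Nat.gcd_dvd_left a b).mul_right d
    exact (Nat.dvd_add_right ((Nat.gcd_dvd_right a b).mul_right c)).1 h2
  exact Nat.dvd_one.1 h1

/-- Two neighbours of the Farey sequence of order `N`, as vectors (denominator, numerator). -/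
structure IsFareyPair (N : ℕ) (p : (ℕ × ℕ) × (ℕ × ℕ)) : Prop where
  fst_pos : 0 < p.1.1
  fst_pos' : 0 < p.2.1
  det : p.1.1 * p.2.2 = p.1.2 * p.2.1 + 1
  fst_le : p.1.1 ≤ N
  fst_le' : p.2.1 ≤ N
  lt_add : N < p.1.1 + p.2.1

/-- The pair of neighbours of order `N` with the same first member. -/
def fareyRefine (N : ℕ) (p : (ℕ × ℕ) × (ℕ × ℕ)) : (ℕ × ℕ) × (ℕ × ℕ) :=
  (p.1, (p.2.1 + (N - p.2.1) / p.1.1 * p.1.1, p.2.2 + (N - p.2.1) / p.1.1 * p.1.2))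

/-- The next pair of neighbours of order `N`. -/
def fareyNext (N : ℕ) (p : (ℕ × ℕ) × (ℕ × ℕ)) : (ℕ × ℕ) × (ℕ × ℕ) :=
  (p.2, ((N + p.1.1) / p.2.1 * p.2.1 - p.1.1, (N + p.1.1) / p.2.1 * p.2.2 - p.1.2))

namespace IsFareyPair

variable {N : ℕ} {p : (ℕ × ℕ) × (ℕ × ℕ)}

theorem slopeLT (h : IsFareyPair N p) : SlopeLT p.1 p.2 := by
  have := h.det
  unfold SlopeLT
  linarith [mul_comm p.1.1 p.2.2]

theorem coprime_left (h : IsFareyPair N p) : Nat.Coprime p.1.1 p.1.2 :=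
  Nat.coprime_of_mul_eq_mul_add_one h.det

theorem coprime_right (h : IsFareyPair N p) : Nat.Coprime p.2.1 p.2.2 := by
  have := h.det
  rw [mul_comm p.1.2, mul_comm] at this
  exact (Nat.coprime_of_mul_eq_mul_add_one this).symm

theorem snd_pos (h : IsFareyPair N p) : 0 < p.2.2 := by
  by_contra h0
  have := h.det
  rw [Nat.eq_zero_of_not_pos h0] at this
  simp at this

/-- Farey neighbours are consecutive. -/
theorem not_between (h : IsFareyPair N p) {w : ℕ × ℕ} (hw : w.1 ≤ N) :
    ¬ (SlopeLT p.1 w ∧ SlopeLT w p.2) := by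
  rintro ⟨h1, h2⟩
  unfold SlopeLT at h1 h2
  -- Cramer's rule: by `det`, `w.1` is a combination of the two denominators, with positive
  -- coefficients if `w` lies strictly between. Then `w.1` is at least their sum, which exceeds `N`.
  have e : w.1 + p.1.1 * (w.2 * p.2.1) + p.2.1 * (p.1.2 * w.1) =
      p.1.1 * (p.2.2 * w.1) + p.2.1 * (w.2 * p.1.1) := by
    have := h.det
    zify at this ⊢
    linear_combination (-(w.1 : ℤ)) * this
  have e1 : p.1.1 * (w.2 * p.2.1 + 1) ≤ p.1.1 * (p.2.2 * w.1) := Nat.mul_le_mul_left _ h2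
  have e2 : p.2.1 * (p.1.2 * w.1 + 1) ≤ p.2.1 * (w.2 * p.1.1) := Nat.mul_le_mul_left _ h1
  have := h.lt_add
  nlinarith

/-- Adding multiples of the first vector to the second preserves the determinant; the multiple is
the largest that keeps the denominator at most `N'`. -/
theorem refine (h : IsFareyPair N p) {N' : ℕ} (hN : N ≤ N') :
    IsFareyPair N' (fareyRefine N' p) := by
  obtain ⟨h1, h2, h3, h4, h5, h6⟩ := h
  have q1 := Nat.div_mul_le_self (N' - p.2.1) p.1.1
  have q2 := Nat.lt_div_mul_add (a := N' - p.2.1) h1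
  refine ⟨h1, by simp only [fareyRefine]; omega, ?_, by simp only [fareyRefine]; omega,
    by simp only [fareyRefine]; omega, by simp only [fareyRefine]; omega⟩
  simp only [fareyRefine]
  set q := (N' - p.2.1) / p.1.1
  linarith [mul_comm (q * p.1.1) p.1.2, mul_left_comm p.1.1 q p.1.2, mul_assoc q p.1.1 p.1.2,
    mul_add p.1.1 p.2.2 (q * p.1.2), mul_add p.1.2 p.2.1 (q * p.1.1)]

/-- The recurrence for successive Farey fractions: the vectors that have determinant one with `p.2`
differ by multiples of `p.2`, and the one with the largest denominator up to `N` is taken. -/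
theorem next (h : IsFareyPair N p) : IsFareyPair N (fareyNext N p) := by
  obtain ⟨h1, h2, h3, h4, h5, h6⟩ := h
  have q1 := Nat.div_mul_le_self (N + p.1.1) p.2.1
  have q2 := Nat.lt_div_mul_add (a := N + p.1.1) h2
  set k := (N + p.1.1) / p.2.1 with hk
  have hge : p.1.2 ≤ k * p.2.2 := by
    refine Nat.le_of_mul_le_mul_left (c := p.2.1) ?_ h2
    have : p.2.2 * p.1.1 ≤ p.2.2 * (k * p.2.1) := Nat.mul_le_mul_left _ (by omega)
    nlinarith
  refine ⟨h2, by simp only [fareyNext, ← hk]; omega, ?_, h5, by simp only [fareyNext, ← hk]; omega,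
    by simp only [fareyNext, ← hk]; omega⟩
  simp only [fareyNext, ← hk]
  have hle : p.1.1 ≤ k * p.2.1 := by omega
  zify [hge, hle] at h3 ⊢
  linear_combination h3

theorem iterate (h : IsFareyPair N p) (m : ℕ) : IsFareyPair N ((fareyNext N)^[m] p) := by
  induction m with
  | zero => exact h
  | succ m ih => rw [Function.iterate_succ_apply']; exact ih.next

theorem snd_lt_fst (h : IsFareyPair N p) (hs : p.2.2 ≤ p.2.1) : p.1.2 < p.1.1 := by
  have h1 : p.1.2 * p.2.1 < p.1.1 * p.2.1 := by
    have := h.det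
    have := Nat.mul_le_mul_left p.1.1 hs
    omega
  exact Nat.lt_of_mul_lt_mul_right h1

theorem mem_right (h : IsFareyPair N p) (hs : p.2.2 ≤ p.2.1) : p.2 ∈ primVec N :=
  mem_primVec.2 ⟨⟨h.fst_pos', h.fst_le'⟩, ⟨h.snd_pos, hs.trans h.fst_le'⟩, h.coprime_right⟩

theorem mem_left (h : IsFareyPair N p) (hs : p.2.2 ≤ p.2.1) :
    p.1 ∈ primVec N ∪ boundaryVec := by
  rcases Nat.eq_zero_or_pos p.1.2 with h0 | h0
  · have := h.det
    rw [h0, zero_mul, zero_add] at this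
    exact Finset.mem_union_right _ (mem_boundaryVec.2
      (Or.inl (Prod.ext (Nat.eq_one_of_mul_eq_one_right this) h0)))
  · exact Finset.mem_union_left _ (mem_primVec.2 ⟨⟨h.fst_pos, h.fst_le⟩,
      ⟨h0, (h.snd_lt_fst hs).le.trans h.fst_le⟩, h.coprime_left⟩)

/-- A Farey pair bounds first coordinates only. For slopes at most `1` this bounds the second
coordinates too, which is why the construction stays below the diagonal. -/
theorem consecutive (h : IsFareyPair N p) (hs : p.2.2 ≤ p.2.1) :
    Consecutive (primVec N ∪ boundaryVec) p.1 p.2 := by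
  refine ⟨h.mem_left hs, Finset.mem_union_left _ (h.mem_right hs), h.slopeLT, fun w hw => ?_⟩
  apply h.not_between
  rcases Finset.mem_union.1 hw with hw | hw
  · exact (mem_primVec.1 hw).1.2
  · have := h.fst_pos.trans_le h.fst_le
    rcases mem_boundaryVec.1 hw with rfl | rfl
    · exact this
    · exact Nat.zero_le _

end IsFareyPair

section Iterates

variable {N d : ℕ} {p : (ℕ × ℕ) × (ℕ × ℕ)}

/-- The pairs of neighbours of order `M` from the first member of `p` on. -/
def fareyIter (M : ℕ) (p : (ℕ × ℕ) × (ℕ × ℕ)) (m : ℕ) : (ℕ × ℕ) × (ℕ × ℕ) :=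
  (fareyNext M)^[m] (fareyRefine M p)

theorem fareyIter_succ (M : ℕ) (p : (ℕ × ℕ) × (ℕ × ℕ)) (m : ℕ) :
    fareyIter M p (m + 1) = fareyNext M (fareyIter M p m) := Function.iterate_succ_apply' _ _ _

theorem fareyIter_succ_fst (M : ℕ) (p : (ℕ × ℕ) × (ℕ × ℕ)) (m : ℕ) :
    (fareyIter M p (m + 1)).1 = (fareyIter M p m).2 := by rw [fareyIter_succ]; rfl

theorem IsFareyPair.fareyIter (h : IsFareyPair N p) {M : ℕ} (hM : N ≤ M) (m : ℕ) :
    IsFareyPair M (fareyIter M p m) := (h.refine hM).iterate m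

theorem IsFareyPair.strictMono (h : IsFareyPair N p) {M : ℕ} (hM : N ≤ M) :
    StrictMono fun m => slopeKey (_root_.fareyIter M p m).1 := by
  refine strictMono_nat_of_lt_succ fun m => ?_
  rw [fareyIter_succ_fst, ← slopeLT_iff (h.fareyIter hM m).coprime_left
    (h.fareyIter hM m).coprime_right]
  exact (h.fareyIter hM m).slopeLT

/-- Between two neighbours of order `N` there are at least `f` members of the Farey sequence of
order `d * N`. -/
theorem ValidPair.fareyIter_slopeLT {f : ℕ} (hv : ValidPair f d) (hN : 0 < N)
    (h : IsFareyPair N p) (hs : p.2.2 ≤ p.2.1) {m : ℕ} (hm : m ≤ f) :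
    SlopeLT (fareyIter (d * N) p m).1 p.2 := by
  classical
  have hM : N ≤ d * N := Nat.le_mul_of_pos_left _ hv.2.1
  have hF := h.fareyIter hM
  by_contra hcon
  have hcard := hv.2.2.2 N hN _ _ (h.consecutive hs)
  -- If term `m` were at or beyond `p.2`, each vector of the gap would be one of the terms `1, …, m
  -- - 1`, fewer than the `f` vectors that validity provides.
  have hsub : vecBetween (primVec (d * N) \ primVec N) p.1 p.2 ⊆
      (Finset.Ico 1 m).image fun i => (fareyIter (d * N) p i).1 := by
    intro w hw
    rw [mem_vecBetween, Finset.mem_sdiff] at hw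
    obtain ⟨⟨hwM, -⟩, hpw, hws⟩ := hw
    have hwc := (mem_primVec.1 hwM).2.2
    have hwm : SlopeLT w (fareyIter (d * N) p m).1 :=
      slopeLT_of_slopeLT_of_not hwc h.coprime_right (hF m).coprime_left hws hcon
    have hex : ∃ i, SlopeLT w (fareyIter (d * N) p i).1 := ⟨m, hwm⟩
    have hmin := fun i => Nat.find_min hex (m := i)
    have hspec := Nat.find_spec hex
    have hle := Nat.find_min' hex hwm
    have hne : Nat.find hex ≠ 0 := by
      intro h0
      rw [h0] at hspec
      exact hpw.asymm hspec
    obtain ⟨i, hi⟩ := Nat.exists_eq_succ_of_ne_zero hne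
    have h1 := hmin i (by omega)
    rw [hi, Nat.succ_eq_add_one, fareyIter_succ_fst] at hspec
    have h2 := (hF i).not_between (mem_primVec.1 hwM).1.2
    have hwi : w = (fareyIter (d * N) p i).1 := by
      rcases slopeLT_trichotomy hwc (hF i).coprime_left with h3 | h3 | h3
      · exact absurd h3 h1
      · exact h3
      · exact absurd ⟨h3, hspec⟩ h2
    refine Finset.mem_image.2 ⟨i, Finset.mem_Ico.2 ⟨?_, by omega⟩, hwi.symm⟩
    rw [Nat.one_le_iff_ne_zero]
    rintro rfl
    rw [hwi] at hpw
    exact SlopeLT.irrefl _ hpw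
  have := (hcard.trans (Finset.card_le_card hsub)).trans Finset.card_image_le
  rw [Nat.card_Ico] at this
  have hf := hv.1
  omega

/-- The denominator of `p.2` is admissible for the finer sequence too, so no step of that sequence
can jump over `p.2`. -/
theorem ValidPair.not_slopeLT_fareyIter {f : ℕ} (hv : ValidPair f d) (hN : 0 < N)
    (h : IsFareyPair N p) (hs : p.2.2 ≤ p.2.1) {m : ℕ} (hm : m ≤ f) :
    ¬ SlopeLT p.2 (fareyIter (d * N) p m).2 := by
  have hM : N ≤ d * N := Nat.le_mul_of_pos_left _ hv.2.1
  intro hcon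
  exact (h.fareyIter hM m).not_between (h.fst_le'.trans hM)
    ⟨hv.fareyIter_slopeLT hN h hs hm, hcon⟩

theorem le_of_not_slopeLT {v w : ℕ × ℕ} (hv : 0 < v.1) (hvw : v.2 ≤ v.1) (h : ¬ SlopeLT v w) :
    w.2 ≤ w.1 := by
  unfold SlopeLT at h
  have h1 : w.2 * v.1 ≤ w.1 * v.1 := by
    have := Nat.mul_le_mul_right w.1 hvw
    linarith [mul_comm v.1 w.1]
  exact Nat.le_of_mul_le_mul_right h1 hv

theorem ValidPair.fareyIter_mem {f : ℕ} (hv : ValidPair f d) (hN : 0 < N)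
    (h : IsFareyPair N p) (hs : p.2.2 ≤ p.2.1) {m : ℕ} (hm : m ≤ f) (hm1 : 1 ≤ m) :
    (fareyIter (d * N) p m).1 ∈ vecBetween (primVec (d * N) \ primVec N) p.1 p.2 := by
  have hM : N ≤ d * N := Nat.le_mul_of_pos_left _ hv.2.1
  have hF := h.fareyIter hM
  have h1 : SlopeLT p.1 (fareyIter (d * N) p m).1 := by
    have := h.strictMono hM (show 0 < m by omega)
    exact (slopeLT_iff h.coprime_left (hF m).coprime_left).2 this
  have h2 := hv.fareyIter_slopeLT hN h hs hm
  obtain ⟨i, rfl⟩ : ∃ i, m = i + 1 := ⟨m - 1, by omega⟩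
  rw [fareyIter_succ_fst] at h1 h2 ⊢
  refine mem_vecBetween.2 ⟨Finset.mem_sdiff.2 ⟨(hF i).mem_right ?_, fun h3 => ?_⟩, h1, h2⟩
  · exact le_of_not_slopeLT h.fst_pos' hs h2.asymm
  · exact h.not_between (mem_primVec.1 h3).1.2 ⟨h1, h2⟩

end Iterates

/-! ### The canonical vector family below the diagonal -/

/-- The `i`-th vector of the level `j` together with its successor in the Farey sequence of order
`d ^ j`; level `j + 1` has `c` times as many vectors as level `j`. -/
def gapPair (c d : ℕ) : ℕ → ℕ → (ℕ × ℕ) × (ℕ × ℕ)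
  | 0, _ => ((1, 0), (1, 1))
  | j + 1, i => fareyIter (d ^ (j + 1)) (gapPair c d j (i / c)) (i % c)

/-- The vectors of level `j`, the last one being `(1, 1)`. -/
def gapVec (c d j i : ℕ) : ℕ × ℕ := if i = c ^ j then (1, 1) else (gapPair c d j i).1

section Gap

variable {f d : ℕ}

theorem gapPair_spec (hv : ValidPair f d) (j : ℕ) {i : ℕ} (hi : i < (f + 1) ^ j) :
    IsFareyPair (d ^ j) (gapPair (f + 1) d j i) ∧
      (gapPair (f + 1) d j i).2.2 ≤ (gapPair (f + 1) d j i).2.1 := by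
  induction j generalizing i with
  | zero => exact ⟨⟨by simp [gapPair], by simp [gapPair], by simp [gapPair], by simp [gapPair],
      by simp [gapPair], by simp [gapPair]⟩, by simp [gapPair]⟩
  | succ j ih =>
    have hq : i / (f + 1) < (f + 1) ^ j := Nat.div_lt_of_lt_mul (by rwa [pow_succ'] at hi)
    obtain ⟨h1, h2⟩ := ih hq
    have hm : i % (f + 1) ≤ f := Nat.lt_succ_iff.1 (Nat.mod_lt _ (by omega))
    have hpos : 0 < d ^ j := Nat.pow_pos hv.2.1
    refine ⟨h1.fareyIter (Nat.pow_le_pow_right hv.2.1 (by omega)) _, ?_⟩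
    refine le_of_not_slopeLT h1.fst_pos' h2 ?_
    have := hv.not_slopeLT_fareyIter hpos h1 h2 hm
    rwa [← pow_succ'] at this

theorem gapPair_mul_add (c d j i m : ℕ) (hm : m < c) :
    gapPair c d (j + 1) (c * i + m) = fareyIter (d ^ (j + 1)) (gapPair c d j i) m := by
  have hc : 0 < c := by omega
  simp only [gapPair]
  rw [Nat.mul_add_mod, Nat.mod_eq_of_lt hm, Nat.mul_add_div hc, Nat.div_eq_of_lt hm, add_zero]

/-- For children of one node this is the monotonicity of the Farey sequence. For different parents,
the children of the first stay in its gap, and those of the second start at its left end. -/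
theorem slopeKey_gapPair_le (hv : ValidPair f d) (j : ℕ) {i i' : ℕ} (hii : i < i')
    (hi : i' < (f + 1) ^ j) :
    slopeKey (gapPair (f + 1) d j i).2 ≤ slopeKey (gapPair (f + 1) d j i').1 := by
  induction j generalizing i i' with
  | zero => simp at hi; omega
  | succ j ih =>
    have hpow : (f + 1) ^ (j + 1) = (f + 1) * (f + 1) ^ j := pow_succ' _ _
    have hpos : 0 < d ^ j := Nat.pow_pos hv.2.1
    have hle : d ^ j ≤ d ^ (j + 1) := Nat.pow_le_pow_right hv.2.1 (by omega)
    have hq' : i' / (f + 1) < (f + 1) ^ j := Nat.div_lt_of_lt_mul (by rwa [hpow] at hi)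
    have hqq : i / (f + 1) ≤ i' / (f + 1) := Nat.div_le_div_right hii.le
    have hm : i % (f + 1) ≤ f := Nat.lt_succ_iff.1 (Nat.mod_lt _ (by omega))
    obtain ⟨h1, h2⟩ := gapPair_spec hv j (hqq.trans_lt hq')
    obtain ⟨h1', h2'⟩ := gapPair_spec hv j hq'
    simp only [gapPair]
    rcases hqq.eq_or_lt with heq | hlt
    · rw [← heq, ← fareyIter_succ_fst]
      apply (h1.strictMono hle).monotone
      have e1 := Nat.div_add_mod i (f + 1)
      have e2 := Nat.div_add_mod i' (f + 1)
      rw [← heq] at e2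
      omega
    · have a1 := hv.not_slopeLT_fareyIter hpos h1 h2 hm
      rw [← pow_succ', slopeLT_iff h1.coprime_right (h1.fareyIter hle _).coprime_right,
        not_lt] at a1
      refine a1.trans ((ih hlt hq').trans ?_)
      exact (h1'.strictMono hle).monotone (Nat.zero_le _)

theorem coprime_gapVec (hv : ValidPair f d) (j : ℕ) {i : ℕ} (hi : i ≤ (f + 1) ^ j) :
    Nat.Coprime (gapVec (f + 1) d j i).1 (gapVec (f + 1) d j i).2 := by
  unfold gapVec
  split_ifs with h
  · simp
  · exact (gapPair_spec hv j (lt_of_le_of_ne hi h)).1.coprime_left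

theorem slopeKey_gapVec_lt (hv : ValidPair f d) (j : ℕ) {i i' : ℕ} (hii : i < i')
    (hi : i' ≤ (f + 1) ^ j) :
    slopeKey (gapVec (f + 1) d j i) < slopeKey (gapVec (f + 1) d j i') := by
  have hi1 : i < (f + 1) ^ j := hii.trans_le hi
  obtain ⟨h1, h2⟩ := gapPair_spec hv j hi1
  have h3 := h1.slopeLT
  rw [slopeLT_iff h1.coprime_left h1.coprime_right] at h3
  unfold gapVec
  rw [if_neg hi1.ne]
  split_ifs with h
  · refine h3.trans_le (not_lt.1 ?_)
    rw [← slopeLT_iff (by simp) h1.coprime_right]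
    unfold SlopeLT
    simp only [one_mul]
    omega
  · exact h3.trans_le (slopeKey_gapPair_le hv j hii (lt_of_le_of_ne hi h))

theorem slopeLT_gapVec (hv : ValidPair f d) (j : ℕ) {i i' : ℕ} (hi : i ≤ (f + 1) ^ j)
    (hi' : i' ≤ (f + 1) ^ j) :
    SlopeLT (gapVec (f + 1) d j i) (gapVec (f + 1) d j i') ↔ i < i' := by
  rw [slopeLT_iff (coprime_gapVec hv j hi) (coprime_gapVec hv j hi')]
  constructor
  · intro h
    by_contra hcon
    rcases (not_lt.1 hcon).eq_or_lt with rfl | h1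
    · exact lt_irrefl _ h
    · exact lt_irrefl _ (h.trans (slopeKey_gapVec_lt hv j h1 hi))
  · exact fun h => slopeKey_gapVec_lt hv j h hi'

theorem gapVec_injective (hv : ValidPair f d) (j : ℕ) {i i' : ℕ} (hi : i ≤ (f + 1) ^ j)
    (hi' : i' ≤ (f + 1) ^ j) (h : gapVec (f + 1) d j i = gapVec (f + 1) d j i') : i = i' := by
  rcases lt_trichotomy i i' with h1 | h1 | h1
  · have := slopeKey_gapVec_lt hv j h1 hi'
    rw [h] at this
    exact absurd this (lt_irrefl _)
  · exact h1
  · have := slopeKey_gapVec_lt hv j h1 hi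
    rw [h] at this
    exact absurd this (lt_irrefl _)

theorem gapVec_zero (j : ℕ) : gapVec (f + 1) d (j + 1) 0 = (1, 0) := by
  have hpos : ∀ j, (0 : ℕ) ≠ (f + 1) ^ j := fun j => (Nat.pow_pos (by omega)).ne
  have key : ∀ j, (gapPair (f + 1) d j 0).1 = (1, 0) := by
    intro j
    induction j with
    | zero => rfl
    | succ j ih =>
      simp only [gapPair, Nat.zero_div, Nat.zero_mod]
      exact ih
  rw [gapVec, if_neg (hpos _), key]

/-- Child `0` of a node repeats the vector of the node. Iterated, this puts the vectors of level `j`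
at the multiples of `c ^ (K - j)` in level `K`. -/
theorem gapVec_mul (c d j i : ℕ) (hc : 0 < c) :
    gapVec c d (j + 1) (c * i) = gapVec c d j i := by
  unfold gapVec
  have : c * i = c ^ (j + 1) ↔ i = c ^ j := by
    rw [pow_succ', Nat.mul_right_inj (by omega)]
  simp only [this]
  split_ifs with h
  · rfl
  · have := gapPair_mul_add c d j i 0 hc
    rw [add_zero] at this
    rw [this]
    rfl

theorem gapVec_mul_pow (c d j k i : ℕ) (hc : 0 < c) :
    gapVec c d (j + k) (i * c ^ k) = gapVec c d j i := by
  induction k with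
  | zero => simp
  | succ k ih =>
    rw [← ih, ← add_assoc, pow_succ, ← mul_assoc, mul_comm _ c, gapVec_mul _ _ _ _ hc]

end Gap

section GapFamily

variable {f d : ℕ}

/-- The `f` new vectors of level `j + 1` that follow the `i`-th vector of level `j`. -/
def gapFill (f d j i : ℕ) : Finset (ℕ × ℕ) :=
  (Finset.Icc 1 f).image fun m => gapVec (f + 1) d (j + 1) ((f + 1) * i + m)

theorem gap_index_lt {j i m : ℕ} (hi : i < (f + 1) ^ j) (hm : m ≤ f) :
    (f + 1) * i + m < (f + 1) ^ (j + 1) := by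
  rw [pow_succ']
  calc (f + 1) * i + m < (f + 1) * (i + 1) := by rw [mul_add]; omega
    _ ≤ _ := Nat.mul_le_mul_left _ hi

theorem card_gapFill (hv : ValidPair f d) {j i : ℕ} (hi : i < (f + 1) ^ j) :
    (gapFill f d j i).card = f := by
  rw [gapFill, Finset.card_image_of_injOn, Nat.card_Icc, Nat.add_sub_cancel]
  intro m hm m' hm' h
  simp only [Finset.coe_Icc, Set.mem_Icc] at hm hm'
  have := gapVec_injective hv (j + 1) (gap_index_lt hi hm.2).le (gap_index_lt hi hm'.2).le h
  omega

/-- The right end `v` of the gap need not be the Farey successor of the left end, but by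
`not_between` it does not lie before that successor. -/
theorem gapFill_subset (hv : ValidPair f d) {j i : ℕ} (hi : i < (f + 1) ^ j) {v : ℕ × ℕ}
    (hvc : Nat.Coprime v.1 v.2) (hvd : v.1 ≤ d ^ j) (hlt : SlopeLT (gapVec (f + 1) d j i) v) :
    gapFill f d j i ⊆
      vecBetween (primVec (d ^ (j + 1)) \ primVec (d ^ j)) (gapVec (f + 1) d j i) v := by
  intro w hw
  obtain ⟨m, hm, rfl⟩ := Finset.mem_image.1 hw
  rw [Finset.mem_Icc] at hm
  obtain ⟨h1, h2⟩ := gapPair_spec hv j hi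
  have hpos : 0 < d ^ j := Nat.pow_pos hv.2.1
  have h3 := hv.fareyIter_mem hpos h1 h2 hm.2 hm.1
  rw [← pow_succ', ← gapPair_mul_add _ _ _ _ _ (show m < f + 1 by omega), mem_vecBetween] at h3
  rw [gapVec, if_neg hi.ne] at hlt ⊢
  rw [gapVec, if_neg (gap_index_lt hi hm.2).ne]
  refine mem_vecBetween.2 ⟨h3.1, h3.2.1, ?_⟩
  refine slopeLT_of_slopeLT_of_not
    (mem_primVec.1 (Finset.mem_sdiff.1 h3.1).1).2.2 h1.coprime_right hvc h3.2.2 fun h => ?_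
  exact h1.not_between hvd ⟨hlt, h⟩

theorem gapVec_not_slopeLT (hv : ValidPair f d) (j : ℕ) {i : ℕ} (hi : i ≤ (f + 1) ^ j) :
    ¬ SlopeLT (1, 1) (gapVec (f + 1) d j i) := by
  have h1 : gapVec (f + 1) d j ((f + 1) ^ j) = (1, 1) := if_pos rfl
  rw [← h1, slopeLT_gapVec hv j le_rfl hi]
  omega

/-- The members of `S` with slope at most `1` are the vectors `gapVec (f + 1) d j i`. -/
def IsGapSet (f d j : ℕ) (S : Finset (ℕ × ℕ)) : Prop :=
  ∀ w, (w ∈ S ∧ ¬ SlopeLT (1, 1) w) ↔ ∃ i, 1 ≤ i ∧ i ≤ (f + 1) ^ j ∧ w = gapVec (f + 1) d j i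

theorem exists_gap_family_one (hv : ValidPair f d) :
    ∃ R, IsVectorFamily f d 1 R ∧ IsGapSet f d 1 (unionUpTo R 1) := by
  obtain ⟨A₂, h3, h4⟩ := Finset.exists_subset_card_eq
    (hv.2.2.2 1 one_pos (1, 1) (0, 1) (by unfold Consecutive; decide))
  rw [mul_one] at h3
  have hlt : (0 : ℕ) < (f + 1) ^ 0 := by simp
  have h0 : gapVec (f + 1) d 0 0 = (1, 0) := rfl
  have hsub := gapFill_subset hv hlt (v := (1, 1)) (by simp) (by simp) (by rw [h0]; decide)
  rw [h0, zero_add, pow_one, pow_zero] at hsub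
  let R : ℕ → Finset (ℕ × ℕ) := fun _ => gapFill f d 0 0 ∪ A₂ ∪ {(1, 1)}
  have hu : unionUpTo R 1 = gapFill f d 0 0 ∪ A₂ ∪ {(1, 1)} := by simp [unionUpTo, R]
  refine ⟨R, ⟨fun _ => ⟨gapFill f d 0 0, A₂, hsub, card_gapFill hv hlt, h3, h4, rfl⟩,
    fun j _ _ => by omega⟩, fun w => ?_⟩
  rw [hu]
  simp only [Finset.mem_union, Finset.mem_singleton]
  constructor
  · rintro ⟨(hw | hw) | rfl, h1⟩
    · obtain ⟨m, hm, rfl⟩ := Finset.mem_image.1 hw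
      rw [Finset.mem_Icc] at hm
      exact ⟨m, hm.1, by rw [pow_one]; omega, by simp⟩
    · exact absurd (mem_vecBetween.1 (h3 hw)).2.1 h1
    · exact ⟨f + 1, by omega, by simp, by simp [gapVec]⟩
  · rintro ⟨i, hi, hi', rfl⟩
    refine ⟨?_, gapVec_not_slopeLT hv 1 hi'⟩
    rw [pow_one] at hi'
    rcases hi'.eq_or_lt with rfl | hlt'
    · exact Or.inr (by simp [gapVec])
    · exact Or.inl (Or.inl (Finset.mem_image.2 ⟨i, Finset.mem_Icc.2 ⟨hi, by omega⟩, by simp⟩))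

/-- A gap that starts below the diagonal is filled with the next `f` Farey terms. Above the diagonal
the choice is arbitrary, since the drawing to be computed uses no vector there. -/
theorem exists_gap_family (hv : ValidPair f d) (K : ℕ) :
    ∃ R, IsVectorFamily f d K R ∧ ∀ j, 1 ≤ j → j ≤ K → IsGapSet f d j (unionUpTo R j) := by
  classical
  induction K with
  | zero => exact ⟨fun _ => ∅, ⟨fun h => by omega, fun j _ _ => by omega⟩, fun j _ _ => by omega⟩
  | succ K ih =>
    rcases Nat.eq_zero_or_pos K with rfl | hK
    · obtain ⟨R, h1, h2⟩ := exists_gap_family_one hv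
      refine ⟨R, h1, fun j hj hj' => ?_⟩
      obtain rfl : j = 1 := by omega
      exact h2
    obtain ⟨R, hR, hgap⟩ := ih
    have hd := hv.2.1
    have hC := hR.coprimeSet hd le_rfl
    have hprim := hR.subset_primVec hd le_rfl
    have hfst : ∀ v ∈ unionUpTo R K ∪ boundaryVec, v.1 ≤ d ^ K := by
      intro v hvm
      rcases Finset.mem_union.1 hvm with h | h
      · exact (mem_primVec.1 (hprim h)).1.2
      · rcases mem_boundaryVec.1 h with rfl | rfl
        · exact Nat.pow_pos hd
        · exact Nat.zero_le _
    have hex : ∀ u v, ∃ A : Finset (ℕ × ℕ), Consecutive (unionUpTo R K ∪ boundaryVec) u v →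
        (A ⊆ vecBetween (primVec (d ^ (K + 1)) \ primVec (d ^ K)) u v ∧ A.card = f) ∧
        ∀ i, i < (f + 1) ^ K → u = gapVec (f + 1) d K i → A = gapFill f d K i := by
      intro u v
      by_cases huv : Consecutive (unionUpTo R K ∪ boundaryVec) u v
      · by_cases hi : ∃ i, i < (f + 1) ^ K ∧ u = gapVec (f + 1) d K i
        · obtain ⟨i, hi, rfl⟩ := hi
          refine ⟨gapFill f d K i, fun _ => ⟨⟨gapFill_subset hv hi (hC v huv.2.1)
            (hfst v huv.2.1) huv.2.2.1, card_gapFill hv hi⟩, fun i' hi' h => ?_⟩⟩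
          rw [gapVec_injective hv K hi.le hi'.le h]
        · obtain ⟨A, hA⟩ := hv.exists_subset (Nat.pow_pos hd) hprim huv
          rw [← pow_succ'] at hA
          exact ⟨A, fun _ => ⟨hA, fun i hi' h => absurd ⟨i, hi', h⟩ hi⟩⟩
      · exact ⟨∅, fun h => absurd h huv⟩
    choose A hA using hex
    have hcg : ∀ j, j ≤ K → ∀ i, 1 ≤ i → i ≤ j →
        Function.update R (K + 1) (IsVectorFamily.fill (unionUpTo R K ∪ boundaryVec) A) i = R i :=
      fun j hj i _ hi => Function.update_of_ne (by omega) _ _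
    refine ⟨_, hR.extend hd hK fun u v huv => (hA u v huv).1, fun j hj hj' => ?_⟩
    rcases (Nat.lt_succ_iff_lt_or_eq.1 (Nat.lt_succ_of_le hj')) with hlt | rfl
    · rw [unionUpTo_congr (hcg j (by omega))]
      exact hgap j hj (by omega)
    rw [unionUpTo_succ, unionUpTo_congr (hcg K le_rfl), Function.update_self]
    have hgK := hgap K hK le_rfl
    have h11 : (1, 1) ∈ unionUpTo R K := hR.one_one_mem hK le_rfl
    -- the vectors below the diagonal among the gap starts
    have hstart : ∀ i, i < (f + 1) ^ K → gapVec (f + 1) d K i ∈ unionUpTo R K ∪ boundaryVec := by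
      intro i hi
      rcases Nat.eq_zero_or_pos i with rfl | h0
      · obtain ⟨K', rfl⟩ : ∃ K', K = K' + 1 := ⟨K - 1, by omega⟩
        rw [gapVec_zero]
        simp [boundaryVec]
      · exact Finset.mem_union_left _ ((hgK _).2 ⟨i, h0, hi.le, rfl⟩).1
    intro w
    rw [Finset.mem_union, IsVectorFamily.mem_fill]
    constructor
    · rintro ⟨hw | ⟨u, v, huv, hw⟩, h1⟩
      · obtain ⟨i, hi, hi', rfl⟩ := (hgK w).1 ⟨hw, h1⟩
        refine ⟨(f + 1) * i, Nat.mul_pos (by omega) hi, ?_, (gapVec_mul _ _ _ _ (by omega)).symm⟩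
        rw [pow_succ']
        exact Nat.mul_le_mul_left _ hi'
      · have hb := mem_vecBetween.1 ((hA u v huv).1.1 hw)
        have hwc := (mem_primVec.1 (Finset.mem_sdiff.1 hb.1).1).2.2
        have hu1 : SlopeLT u (1, 1) :=
          slopeLT_of_slopeLT_of_not (hC u huv.1) hwc (by simp) hb.2.1 h1
        have hui : ∃ i, i < (f + 1) ^ K ∧ u = gapVec (f + 1) d K i := by
          rcases Finset.mem_union.1 huv.1 with hu | hu
          · obtain ⟨i, hi, hi', rfl⟩ := (hgK u).1 ⟨hu, hu1.asymm⟩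
            refine ⟨i, lt_of_le_of_ne hi' ?_, rfl⟩
            rintro rfl
            rw [gapVec, if_pos rfl] at hu1
            exact SlopeLT.irrefl _ hu1
          · rcases mem_boundaryVec.1 hu with rfl | rfl
            · obtain ⟨K', rfl⟩ : ∃ K', K = K' + 1 := ⟨K - 1, by omega⟩
              exact ⟨0, Nat.pow_pos (by omega), (gapVec_zero _).symm⟩
            · exact absurd hu1 (by decide)
        obtain ⟨i, hi, hui⟩ := hui
        rw [(hA u v huv).2 i hi hui] at hw
        obtain ⟨m, hm, rfl⟩ := Finset.mem_image.1 hw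
        rw [Finset.mem_Icc] at hm
        exact ⟨_, by omega, (gap_index_lt hi hm.2).le, rfl⟩
    · rintro ⟨i, hi, hi', rfl⟩
      refine ⟨?_, gapVec_not_slopeLT hv (K + 1) hi'⟩
      -- Index `i` is the `m`-th place after vector `q` of the previous level: an old vector if `m =
      -- 0`, a new one otherwise.
      have e := Nat.div_add_mod i (f + 1)
      have hm := Nat.mod_lt i (show 0 < f + 1 by omega)
      set q := i / (f + 1)
      set m := i % (f + 1)
      rcases Nat.eq_zero_or_pos m with h0 | h0
      · left
        rw [h0, add_zero] at e
        rw [← e, gapVec_mul _ _ _ _ (by omega)]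
        refine ((hgK _).2 ⟨q, ?_, ?_, rfl⟩).1
        · rw [Nat.one_le_iff_ne_zero]
          rintro h
          rw [h] at e
          omega
        · rw [← e, pow_succ'] at hi'
          exact Nat.le_of_mul_le_mul_left hi' (by omega)
      · right
        have hq : q < (f + 1) ^ K := by
          rw [pow_succ'] at hi'
          by_contra hcon
          have := Nat.mul_le_mul_left (f + 1) (not_lt.1 hcon)
          omega
        have hqm := hstart q hq
        have hq1 : SlopeLT (gapVec (f + 1) d K q) (1, 1) := by
          have h1 : gapVec (f + 1) d K ((f + 1) ^ K) = (1, 1) := if_pos rfl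
          rw [← h1, slopeLT_gapVec hv K hq.le le_rfl]
          exact hq
        obtain ⟨v, hvm, hlt, hmin⟩ := exists_next hC (Finset.mem_union_left _ h11) hq1
        have huv : Consecutive (unionUpTo R K ∪ boundaryVec) (gapVec (f + 1) d K q) v :=
          ⟨hqm, hvm, hlt, fun w hw h => hmin w hw h.1 h.2⟩
        refine ⟨_, v, huv, ?_⟩
        rw [(hA _ v huv).2 q hq rfl, ← e]
        exact Finset.mem_image.2 ⟨m, Finset.mem_Icc.2 ⟨h0, by omega⟩, rfl⟩

end GapFamily

/-- The indices reached by moving, in the `i`-th step, to the next multiple of `s i`. -/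
def multipleSeq (s : ℕ → ℕ) : ℕ → ℕ
  | 0 => 0
  | i + 1 => (multipleSeq s i / s i + 1) * s i

theorem multipleSeq_lt_succ {s : ℕ → ℕ} {i : ℕ} (h : 0 < s i) :
    multipleSeq s i < multipleSeq s (i + 1) := by
  have := Nat.lt_div_mul_add (a := multipleSeq s i) h
  rw [multipleSeq, add_mul, one_mul]
  exact this

theorem multipleSeq_succ_le (s : ℕ → ℕ) (i : ℕ) :
    multipleSeq s (i + 1) ≤ multipleSeq s i + s i := by
  rw [multipleSeq, add_mul, one_mul]
  exact Nat.add_le_add_right (Nat.div_mul_le_self _ _) _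

theorem multipleSeq_le_sum (s : ℕ → ℕ) (i : ℕ) :
    multipleSeq s i ≤ ∑ m ∈ Finset.range i, s m := by
  induction i with
  | zero => simp [multipleSeq]
  | succ i ih =>
    rw [Finset.sum_range_succ]
    exact (multipleSeq_succ_le s i).trans (Nat.add_le_add_right ih _)

theorem multipleSeq_lt {s : ℕ → ℕ} {t : ℕ} (hs : ∀ i, i < t → 0 < s i) {i j : ℕ} (hij : i < j)
    (hj : j ≤ t) : multipleSeq s i < multipleSeq s j := by
  induction j, hij using Nat.le_induction with
  | base => exact multipleSeq_lt_succ (hs i (by omega))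
  | succ j hij ih => exact (ih (by omega)).trans (multipleSeq_lt_succ (hs j (by omega)))

/-! ### The canonical assignment as a walk through multiples of strides. -/

namespace OrderedTree

variable {n : ℕ} {T : OrderedTree n}

/-- `LV 0, …, LV (t - 1)` are the leaves from left to right. -/
structure IsLeafOrder (T : OrderedTree n) (t : ℕ) (LV : ℕ → Fin n) : Prop where
  isLeaf : ∀ i, i < t → T.IsLeaf (LV i)
  exists_eq : ∀ l, T.IsLeaf l → ∃ i, i < t ∧ LV i = l
  leftOf : ∀ i j, i < t → j < t → (T.LeftOf (LV i) (LV j) ↔ i < j)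

theorem IsLeafOrder.injOn {t : ℕ} {LV : ℕ → Fin n} (h : T.IsLeafOrder t LV) {i j : ℕ} (hi : i < t)
    (hj : j < t) (hij : LV i = LV j) : i = j := by
  rcases lt_trichotomy i j with h1 | h1 | h1
  · rw [← h.leftOf i j hi hj, hij] at h1; exact absurd h1 (LeftOf.irrefl _)
  · exact h1
  · rw [← h.leftOf j i hj hi, hij] at h1; exact absurd h1 (LeftOf.irrefl _)

/-- The number `s` of vectors of the last level that are passed by a path of `m` edges. -/
def IsStride (n c m s : ℕ) : Prop :=
  ∃ j, 1 ≤ j ∧ j ≤ Nat.clog c n ∧ n - 1 ≤ m * c ^ j ∧ (1 < j → m * c ^ (j - 1) < n - 1) ∧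
    s = c ^ (Nat.clog c n - j)

variable {f d : ℕ} {h : Fin n → ℕ} {lf : Fin n → Fin n} {len : Fin n → ℕ} {t : ℕ}
  {LV : ℕ → Fin n} {s : ℕ → ℕ}

/-- A move to the next multiple advances by at most the stride. The strides are the weights of the
paths, one for each leaf, so `sum_pow_level_le` bounds their sum. -/
theorem IsLongPathData.multipleSeq_le (hv : ValidPair f d) (H : T.IsLongPathData h lf len)
    (hLV : T.IsLeafOrder t LV) (hs : ∀ i, i < t → IsStride n (f + 1) (len (LV i)) (s i)) :
    multipleSeq s t ≤ (f + 1) ^ Nat.clog (f + 1) n := by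
  classical
  obtain ⟨B, -, hlen, -⟩ := H.exists_pathDecomposition
  have hf := hv.1
  have hidx : ∀ k : Fin B.t, ∃ i, i < t ∧ LV i = B.leaf k := fun k =>
    hLV.exists_eq _ (B.isLeaf_leaf k)
  have hk : ∀ i, i < t → ∃ k : Fin B.t, B.leaf k = LV i := fun i hi =>
    B.exists_leaf_eq (hLV.isLeaf i hi)
  choose idx hidx_lt hidx_eq using hidx
  choose j hj1 hjK hj3 hj4 hj5 using fun k => hs (idx k) (hidx_lt k)
  have hlev : ∀ k, B.IsLevel (f + 1) k (j k) := fun k => by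
    refine (PathDecomposition.isLevel_iff (by omega)).2 ⟨hj1 k, hjK k, ?_, ?_⟩
    · rw [hlen, ← hidx_eq]; exact hj3 k
    · rw [hlen, ← hidx_eq]; exact hj4 k
  refine (multipleSeq_le_sum s t).trans
    (le_trans ?_ (PathDecomposition.sum_pow_level_le (by omega) hlev))
  rw [Finset.sum_congr rfl fun k _ => (hj5 k).symm]
  have hinj : Function.Injective idx := fun k k' hkk => by
    apply B.leaf_injective
    rw [← hidx_eq k, ← hidx_eq k', hkk]
  rw [← Finset.sum_image (f := s) (g := idx) (s := Finset.univ) fun a _ b _ hab => hinj hab]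
  refine Finset.sum_le_sum_of_subset fun i hi => ?_
  rw [Finset.mem_range] at hi
  obtain ⟨k, hk⟩ := hk i hi
  refine Finset.mem_image.2 ⟨k, Finset.mem_univ _, ?_⟩
  exact hLV.injOn (hidx_lt k) hi (by rw [hidx_eq, hk])

/-- The drawing computed from a long path decomposition, the left to right order of the leaves, and
the canonical vectors is a drawing by Optimal Draw. -/
theorem IsLongPathData.optimalDraw (hv : ValidPair f d) (H : T.IsLongPathData h lf len)
    (hLV : T.IsLeafOrder t LV) (hs : ∀ i, i < t → IsStride n (f + 1) (len (LV i)) (s i))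
    {ix : Fin n → ℕ} (hix : ∀ i, i < t → ix (LV i) = multipleSeq s (i + 1)) {vec : Fin n → ℕ × ℕ}
    (hvec : ∀ v, v ≠ T.root →
      vec v = gapVec (f + 1) d (Nat.clog (f + 1) n) (ix (lf v))) :
    ∃ (B : PathDecomposition T) (R : ℕ → Finset (ℕ × ℕ)) (a : Fin B.t → ℕ × ℕ),
      B.IsLengthDecreasing ∧ IsVectorFamily f d (Nat.clog (f + 1) n) R ∧
      IsAssignment B (f + 1) R a ∧ ∀ v, v ≠ T.root → B.edgeVec a v = vec v := by
  obtain ⟨B, hB, hlen, hlow⟩ := H.exists_pathDecomposition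
  set K := Nat.clog (f + 1) n with hK
  obtain ⟨R, hR, hgap⟩ := exists_gap_family hv K
  have hf := hv.1
  let a : Fin B.t → ℕ × ℕ := fun k => gapVec (f + 1) d K (ix (B.leaf k))
  refine ⟨B, R, a, hB, hR, ?_, fun v hvr => ?_⟩
  · have hspos : ∀ i, i < t → 0 < s i := by
      intro i hi
      obtain ⟨j, -, -, -, -, h5⟩ := hs i hi
      rw [h5]; positivity
    have hmax := H.multipleSeq_le hv hLV hs
    have hle : ∀ i, i ≤ t → multipleSeq s i ≤ (f + 1) ^ K := by
      intro i hi
      rcases hi.eq_or_lt with rfl | hi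
      · exact hmax
      · exact (multipleSeq_lt hspos hi le_rfl).le.trans hmax
    intro k
    obtain ⟨i, hi, hik⟩ := hLV.exists_eq _ (B.isLeaf_leaf k)
    obtain ⟨j, h1, h2, h3, h4, h5⟩ := hs i hi
    have hleft : ∀ k', T.LeftOf (B.leaf k') (B.leaf k) →
        ∃ i', i' < i ∧ a k' = gapVec (f + 1) d K (multipleSeq s (i' + 1)) := by
      intro k' hk'
      obtain ⟨i', hi', hik'⟩ := hLV.exists_eq _ (B.isLeaf_leaf k')
      rw [← hik, ← hik', hLV.leftOf _ _ hi' hi] at hk'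
      exact ⟨i', hk', by simp only [a]; rw [← hik', hix i' hi']⟩
    have hak : a k = gapVec (f + 1) d K (multipleSeq s (i + 1)) := by
      simp only [a]; rw [← hik, hix i hi]
    have hpow : (f + 1) ^ K = (f + 1) ^ j * s i := by
      rw [h5, ← pow_add]; congr 1; omega
    -- Index `m` of level `j` is index `m * s i` of level `K`, so the next multiple of `s i` is the
    -- next vector of level at most `j`.
    have hmul : ∀ m, gapVec (f + 1) d K (m * s i) = gapVec (f + 1) d j m := by
      intro m
      have := gapVec_mul_pow (f + 1) d j (K - j) m (by omega)
      rwa [Nat.add_sub_cancel' h2, ← h5] at this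
    refine ⟨j, (PathDecomposition.isLevel_iff (by omega)).2 ⟨h1, h2, ?_, ?_⟩, ?_, ?_, ?_⟩
    · rw [hlen, ← hik]; exact h3
    · rw [hlen, ← hik]; exact h4
    · have := hle (i + 1) (by omega)
      rw [hak]
      rw [multipleSeq] at this ⊢
      rw [hmul]
      refine ((hgap j h1 h2 _).2 ⟨_, Nat.le_add_left 1 _, ?_, rfl⟩).1
      rw [hpow] at this
      exact Nat.le_of_mul_le_mul_right this (hspos i hi)
    · intro k' hk'
      obtain ⟨i', hi', h6⟩ := hleft k' hk'
      rw [h6, hak, slopeLT_gapVec hv K (hle _ (by omega)) (hle _ (by omega))]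
      exact multipleSeq_lt hspos (by omega) (by omega)
    -- An admissible `w` of smaller slope would be below the diagonal, hence at a multiple of `s i`
    -- beyond the index of the previous leaf (or `0`) but before the next multiple.
    · intro w hw hlw hcon
      have h11 : ¬ SlopeLT (1, 1) w := by
        intro hh
        have := hh.trans hcon
        rw [hak] at this
        exact gapVec_not_slopeLT hv K (hle _ (by omega)) this
      obtain ⟨m, hm1, hm2, rfl⟩ := (hgap j h1 h2 w).1 ⟨hw, h11⟩
      have hms : m * s i ≤ (f + 1) ^ K := by
        rw [hpow]; exact Nat.mul_le_mul_right _ hm2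
      rw [← hmul, hak, slopeLT_gapVec hv K hms (hle _ (by omega)), multipleSeq] at hcon
      have h7 := Nat.lt_of_mul_lt_mul_right hcon
      have h8 : m * s i ≤ multipleSeq s i :=
        (Nat.le_div_iff_mul_le (hspos i hi)).1 (by omega)
      rcases Nat.eq_zero_or_pos i with rfl | h0
      · rw [multipleSeq] at h8
        have := Nat.mul_pos hm1 (hspos 0 hi)
        omega
      · obtain ⟨k', hk'⟩ := B.exists_leaf_eq (hLV.isLeaf (i - 1) (by omega))
        have h9 := hlw k' (by rw [hk', ← hik, hLV.leftOf _ _ (by omega) hi]; omega)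
        simp only [a] at h9
        rw [hk', hix _ (by omega), ← hmul, slopeLT_gapVec hv K (hle _ (by omega)) hms,
          Nat.sub_add_cancel h0] at h9
        omega
  · obtain ⟨k, hk⟩ := B.exists_mem_lowerEnds hvr
    rw [B.edgeVec_eq a hk, hvec v hvr, (hlow k v hvr).1 hk]

end OrderedTree

/-! ### Running RAM programs -/

namespace RAM

/-- All words of the state are at most `M`. -/
def State.Bdd (M : ℕ) (s : State) : Prop := (∀ x, s.reg x ≤ M) ∧ ∀ a i, s.arr a i ≤ M

@[simp] theorem State.setReg_reg (s : State) (x v y : ℕ) :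
    (s.setReg x v).reg y = if y = x then v else s.reg y := by
  simp [State.setReg, Function.update_apply]

@[simp] theorem State.setReg_arr (s : State) (x v : ℕ) : (s.setReg x v).arr = s.arr := rfl

@[simp] theorem State.setArr_reg (s : State) (a i v : ℕ) : (s.setArr a i v).reg = s.reg := rfl

@[simp] theorem State.setArr_arr (s : State) (a i v b : ℕ) :
    (s.setArr a i v).arr b = if b = a then Function.update (s.arr a) i v else s.arr b := by
  by_cases h : b = a
  · subst h; simp [State.setArr]
  · simp [State.setArr, h]

theorem State.Bdd.setReg {M : ℕ} {s : State} (h : s.Bdd M) {x v : ℕ} (hv : v ≤ M) :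
    (s.setReg x v).Bdd M := by
  refine ⟨fun y => ?_, h.2⟩
  rw [State.setReg_reg]
  split_ifs
  · exact hv
  · exact h.1 y

theorem State.Bdd.setArr {M : ℕ} {s : State} (h : s.Bdd M) {a i v : ℕ} (hv : v ≤ M) :
    (s.setArr a i v).Bdd M := by
  refine ⟨h.1, fun b k => ?_⟩
  rw [State.setArr_arr]
  split_ifs
  · rw [Function.update_apply]
    split_ifs
    · exact hv
    · exact h.2 a k
  · exact h.2 b k

/-- The size of an expression, the constants being written in unary. -/
def Expr.size : Expr → ℕ
  | lit k => k + 1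
  | reg _ => 1
  | get _ i => i.size + 1
  | op _ e₁ e₂ => e₁.size + e₂.size + 1

theorem Op.eval_lt (o : Op) (a b : ℕ) : o.eval a b < (a + 1) * (b + 1) + 1 := by
  have : (a + 1) * (b + 1) = a * b + a + b + 1 := by ring
  have h1 := Nat.div_le_self a b
  have h2 : 0 ≤ a * b := Nat.zero_le _
  cases o <;> simp only [Op.eval] <;> (try split_ifs) <;> omega

/-- An operation at most multiplies the bounds of its operands, so the size of the expression serves
as the exponent; unary constants make `lit k` fit as well. Hence only stored words need an
invariant, and intermediate values are bounded by a fixed power. -/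
theorem Expr.eval_lt {M : ℕ} {s : State} (h : s.Bdd M) (e : Expr) :
    e.eval s < (M + 2) ^ e.size := by
  induction e with
  | lit k =>
    simp only [Expr.eval, Expr.size]
    exact (Nat.lt_succ_self k).trans (Nat.lt_pow_self (by omega))
  | reg x =>
    have := h.1 x
    simp only [Expr.eval, Expr.size, pow_one]
    omega
  | get a i ih =>
    have h1 := h.2 a (i.eval s)
    have h2 : 1 ≤ (M + 2) ^ i.size := Nat.pow_pos (by omega)
    simp only [Expr.eval, Expr.size, pow_succ]
    nlinarith
  | op o e₁ e₂ ih₁ ih₂ =>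
    have h1 := o.eval_lt (e₁.eval s) (e₂.eval s)
    have h2 : (e₁.eval s + 1) * (e₂.eval s + 1) ≤ (M + 2) ^ e₁.size * (M + 2) ^ e₂.size :=
      Nat.mul_le_mul ih₁ ih₂
    have h3 : 1 ≤ (M + 2) ^ e₁.size * (M + 2) ^ e₂.size := Nat.mul_pos (Nat.pow_pos (by omega))
      (Nat.pow_pos (by omega))
    simp only [Expr.eval, Expr.size, pow_succ, pow_add]
    nlinarith

theorem Expr.fits {M W : ℕ} {s : State} (h : s.Bdd M) (e : Expr) (hW : (M + 2) ^ e.size ≤ W) :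
    e.Fits W s := by
  induction e with
  | lit k => exact (Expr.eval_lt h (.lit k)).le.trans hW
  | reg x => exact (Expr.eval_lt h (.reg x)).le.trans hW
  | get a i ih =>
    exact ⟨ih ((Nat.pow_le_pow_right (by omega) (by simp [Expr.size])).trans hW),
      (Expr.eval_lt h (.get a i)).le.trans hW⟩
  | op o e₁ e₂ ih₁ ih₂ =>
    exact ⟨ih₁ ((Nat.pow_le_pow_right (by omega) (by simp [Expr.size]; omega)).trans hW),
      ih₂ ((Nat.pow_le_pow_right (by omega) (by simp [Expr.size]; omega)).trans hW),
      (Expr.eval_lt h (.op o e₁ e₂)).le.trans hW⟩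

namespace Prog

/-- The size of a program. -/
def size : Prog → ℕ
  | skip => 0
  | assign _ e => e.size
  | store _ i e => i.size + e.size
  | seq p q => p.size + q.size
  | ite e p q => e.size + p.size + q.size
  | loop e p => e.size + p.size

/-- The final state of a program without loops. -/
def run : Prog → State → State
  | skip, s => s
  | assign x e, s => s.setReg x (e.eval s)
  | store a i e, s => s.setArr a (i.eval s) (e.eval s)
  | seq p q, s => q.run (p.run s)
  | ite e p q, s => if e.eval s = 0 then q.run s else p.run s
  | loop _ _, s => s

/-- A program without loops stores only words up to `M`. -/
def Safe (M : ℕ) : Prog → State → Prop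
  | skip, _ => True
  | assign _ e, s => e.eval s ≤ M
  | store _ _ e, s => e.eval s ≤ M
  | seq p q, s => p.Safe M s ∧ q.Safe M (p.run s)
  | ite e p q, s => if e.eval s = 0 then q.Safe M s else p.Safe M s
  | loop _ _, _ => False

/-- A bound on the running time of a program without loops. -/
def cost : Prog → ℕ
  | skip => 1
  | assign _ e => e.cost + 1
  | store _ i e => i.cost + e.cost + 1
  | seq p q => p.cost + q.cost
  | ite e p q => e.cost + 1 + p.cost + q.cost
  | loop _ _ => 0

/-- The arrays that are modified by a program. -/
def arrays : Prog → List ℕ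
  | skip => []
  | assign _ _ => []
  | store a _ _ => [a]
  | seq p q => p.arrays ++ q.arrays
  | ite _ p q => p.arrays ++ q.arrays
  | loop _ p => p.arrays

/-- The registers that are modified by a program. -/
def regs : Prog → List ℕ
  | skip => []
  | assign x _ => [x]
  | store _ _ _ => []
  | seq p q => p.regs ++ q.regs
  | ite _ p q => p.regs ++ q.regs
  | loop _ p => p.regs

end Prog

theorem Exec.arr_eq {W τ : ℕ} {p : Prog} {s s' : State} (h : Exec W p s τ s') {a : ℕ}
    (ha : a ∉ p.arrays) : s'.arr a = s.arr a := by
  induction h with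
  | skip | assign | loop_false => rfl
  | store s b i e hi he =>
    simp only [Prog.arrays, List.mem_singleton] at ha
    simp [ha]
  | seq _ _ ih₁ ih₂ =>
    simp only [Prog.arrays, List.mem_append, not_or] at ha
    rw [ih₂ ha.2, ih₁ ha.1]
  | ite_true _ _ _ ih =>
    simp only [Prog.arrays, List.mem_append, not_or] at ha
    exact ih ha.1
  | ite_false _ _ _ ih =>
    simp only [Prog.arrays, List.mem_append, not_or] at ha
    exact ih ha.2
  | loop_true _ _ _ _ ih₁ ih₂ =>
    rw [ih₂ ha, ih₁ ha]

theorem Exec.reg_eq {W τ : ℕ} {p : Prog} {s s' : State} (h : Exec W p s τ s') {x : ℕ}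
    (hx : x ∉ p.regs) : s'.reg x = s.reg x := by
  induction h with
  | skip | store | loop_false => rfl
  | assign s y e he =>
    simp only [Prog.regs, List.mem_singleton] at hx
    simp [hx]
  | seq _ _ ih₁ ih₂ =>
    simp only [Prog.regs, List.mem_append, not_or] at hx
    rw [ih₂ hx.2, ih₁ hx.1]
  | ite_true _ _ _ ih =>
    simp only [Prog.regs, List.mem_append, not_or] at hx
    exact ih hx.1
  | ite_false _ _ _ ih =>
    simp only [Prog.regs, List.mem_append, not_or] at hx
    exact ih hx.2
  | loop_true _ _ _ _ ih₁ ih₂ =>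
    rw [ih₂ hx, ih₁ hx]

/-- For loop-free code an execution reduces to evaluating `run` and `Safe`, which is a computation
for `simp`; invariants are needed only for loops. -/
theorem Prog.exec_run {M W : ℕ} {p : Prog} {s : State} (hs : s.Bdd M)
    (hW : (M + 2) ^ p.size ≤ W) (h : p.Safe M s) :
    ∃ τ, Exec W p s τ (p.run s) ∧ τ ≤ p.cost ∧ (p.run s).Bdd M := by
  have hX : 0 < M + 2 := by omega
  induction p generalizing s with
  | skip => exact ⟨1, .skip s, le_rfl, hs⟩
  | assign x e => exact ⟨_, .assign s x e (e.fits hs hW), le_rfl, hs.setReg h⟩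
  | store a i e =>
    exact ⟨_, .store s a i e
      (i.fits hs ((Nat.pow_le_pow_right hX (by simp [Prog.size])).trans hW))
      (e.fits hs ((Nat.pow_le_pow_right hX (by simp [Prog.size])).trans hW)), le_rfl, hs.setArr h⟩
  | seq p q ih₁ ih₂ =>
    obtain ⟨τ₁, h1, h2, h3⟩ :=
      ih₁ hs ((Nat.pow_le_pow_right hX (by simp [Prog.size])).trans hW) h.1
    obtain ⟨τ₂, h4, h5, h6⟩ :=
      ih₂ h3 ((Nat.pow_le_pow_right hX (by simp [Prog.size])).trans hW) h.2
    exact ⟨_, .seq h1 h4, Nat.add_le_add h2 h5, h6⟩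
  | ite e p q ih₁ ih₂ =>
    have hf := e.fits hs ((Nat.pow_le_pow_right hX
      (by simp only [Prog.size]; omega)).trans hW)
    by_cases he : e.eval s = 0
    · simp only [Prog.Safe, he, if_true] at h
      obtain ⟨τ, h1, h2, h3⟩ := ih₂ hs ((Nat.pow_le_pow_right hX
        (by simp only [Prog.size]; omega)).trans hW) h
      refine ⟨_, by simpa only [Prog.run, he, if_true] using Exec.ite_false hf he h1, ?_,
        by simpa only [Prog.run, he, if_true] using h3⟩
      simp only [Prog.cost]; omega
    · simp only [Prog.Safe, he, if_false] at h
      obtain ⟨τ, h1, h2, h3⟩ := ih₁ hs ((Nat.pow_le_pow_right hX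
        (by simp only [Prog.size]; omega)).trans hW) h
      refine ⟨_, by simpa only [Prog.run, he, if_false] using Exec.ite_true hf he h1, ?_,
        by simpa only [Prog.run, he, if_false] using h3⟩
      simp only [Prog.cost]; omega
  | loop e p _ => exact h.elim

/-- `p` halts from `s` within `t` steps in a state with property `Q`, all words being at most `W`
and the stored ones at most `M`. -/
def Runs (M W : ℕ) (p : Prog) (s : State) (t : ℕ) (Q : State → Prop) : Prop :=
  ∃ τ s', Exec W p s τ s' ∧ τ ≤ t ∧ s'.Bdd M ∧ Q s'

theorem Runs.mono {M W : ℕ} {p : Prog} {s : State} {t t' : ℕ} {Q Q' : State → Prop}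
    (h : Runs M W p s t Q) (ht : t ≤ t') (hQ : ∀ s', Q s' → Q' s') : Runs M W p s t' Q' := by
  obtain ⟨τ, s', h1, h2, h3, h4⟩ := h
  exact ⟨τ, s', h1, h2.trans ht, h3, hQ s' h4⟩

theorem Runs.of_run {M W : ℕ} {p : Prog} {s : State} (hs : s.Bdd M) (hW : (M + 2) ^ p.size ≤ W)
    (h : p.Safe M s) {Q : State → Prop} (hQ : Q (p.run s)) : Runs M W p s p.cost Q := by
  obtain ⟨τ, h1, h2, h3⟩ := Prog.exec_run hs hW h
  exact ⟨τ, _, h1, h2, h3, hQ⟩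

theorem Runs.seq {M W : ℕ} {p q : Prog} {s : State} {t₁ t₂ : ℕ} {P Q : State → Prop}
    (hp : Runs M W p s t₁ P)
    (hq : ∀ s', s'.Bdd M → P s' → (∀ a, a ∉ p.arrays → s'.arr a = s.arr a) →
      (∀ x, x ∉ p.regs → s'.reg x = s.reg x) → Runs M W q s' t₂ Q) :
    Runs M W (.seq p q) s (t₁ + t₂) Q := by
  obtain ⟨τ₁, s₁, h1, h2, h3, h4⟩ := hp
  obtain ⟨τ₂, s₂, h5, h6, h7, h8⟩ := hq s₁ h3 h4 (fun a ha => h1.arr_eq ha) fun x hx => h1.reg_eq hx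
  exact ⟨_, s₂, .seq h1 h5, Nat.add_le_add h2 h6, h7, h8⟩

/-- The loop rule, for a body without loops: an invariant that is indexed by a decreasing number. -/
theorem Runs.loop {M W : ℕ} {e : Expr} {p : Prog} (hW : (M + 2) ^ (Prog.loop e p).size ≤ W)
    (Inv : ℕ → State → Prop)
    (step : ∀ k s, s.Bdd M → Inv k s → e.eval s ≠ 0 →
      p.Safe M s ∧ ∃ k', k' < k ∧ Inv k' (p.run s))
    {s : State} (hs : s.Bdd M) {t : ℕ} (hI : Inv t s) :
    Runs M W (.loop e p) s ((t + 1) * (p.cost + e.cost + 1))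
      fun s' => (∃ k, Inv k s') ∧ e.eval s' = 0 := by
  have hX : 0 < M + 2 := by omega
  have hWe : (M + 2) ^ e.size ≤ W :=
    (Nat.pow_le_pow_right hX (by simp [Prog.size])).trans hW
  have hWp : (M + 2) ^ p.size ≤ W :=
    (Nat.pow_le_pow_right hX (by simp [Prog.size])).trans hW
  induction t using Nat.strong_induction_on generalizing s with
  | _ t ih =>
    by_cases he : e.eval s = 0
    · refine ⟨_, s, .loop_false (e.fits hs hWe) he, ?_, hs, ⟨t, hI⟩, he⟩
      nlinarith
    · obtain ⟨h1, k, hk, h2⟩ := step t s hs hI he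
      obtain ⟨τ, h4, h5, h6⟩ := Prog.exec_run hs hWp h1
      obtain ⟨τ', s', h7, h8, h9, h10⟩ := ih k hk h6 h2
      refine ⟨_, s', .loop_true (e.fits hs hWe) he h4 h7, ?_, h9, h10⟩
      have h11 : (k + 1) * (p.cost + e.cost + 1) ≤ t * (p.cost + e.cost + 1) :=
        Nat.mul_le_mul_right _ hk
      rw [add_mul]
      omega

end RAM

/-! ### Breadth first search as a process on lists. -/

namespace OrderedTree

variable {n : ℕ} {T : OrderedTree n}

/-- The children of a vertex from left to right. -/
noncomputable def childList (T : OrderedTree n) (u : Fin n) : List (Fin n) :=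
  (T.adj u).filter fun w => w ≠ T.par u

theorem adj_par_or_isChild {u w : Fin n} (h : w ∈ T.adj u) : w = T.par u ∨ T.IsChild u w := by
  rw [T.mem_adj] at h
  rcases isChild_or_isChild_of_adj h with h1 | h1
  · exact Or.inr h1
  · exact Or.inl h1.par_eq.symm

theorem mem_childList {u w : Fin n} : w ∈ T.childList u ↔ T.IsChild u w := by
  simp only [childList, List.mem_filter, decide_eq_true_eq]
  constructor
  · rintro ⟨h1, h2⟩
    exact (adj_par_or_isChild h1).resolve_left h2
  · intro h
    refine ⟨(T.mem_adj _ _).2 h.1, ?_⟩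
    rintro rfl
    exact h.not_anc (par_anc u)

/-- `Q 0, …, Q (n - 1)` are the vertices, parents before children, and siblings from left to
right. -/
structure IsTopOrder (T : OrderedTree n) (Q : ℕ → Fin n) : Prop where
  zero : Q 0 = T.root
  inj : ∀ i j, i < n → j < n → Q i = Q j → i = j
  surj : ∀ v, ∃ i, i < n ∧ Q i = v
  par_lt : ∀ k, 0 < k → k < n → ∃ k', k' < k ∧ Q k' = T.par (Q k)
  sibling : ∀ u i j, i < n → j < n → T.IsChild u (Q i) → T.IsChild u (Q j) →
    [Q i, Q j].Sublist (T.adj u) → i < j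

/-- The state of a breadth first search: `q` is the list of the vertices found, the children of the
first `h` of them and of the first `i` neighbours of the next one having been looked at. -/
structure IsBFS (T : OrderedTree n) (q : List (Fin n)) (h i : ℕ) : Prop where
  nodup : q.Nodup
  eq : q = T.root :: ((q.take h).flatMap T.childList ++
    ((T.adj (q.getD h T.root)).take i).filter fun w => w ≠ T.par (q.getD h T.root))
  par_lt : ∀ k, 0 < k → k < q.length →
    ∃ k', k' < k ∧ q.getD k' T.root = T.par (q.getD k T.root)

theorem isBFS_init : T.IsBFS [T.root] 0 0 :=
  ⟨by simp, by simp, fun k h1 h2 => by simp at h2; omega⟩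

namespace IsBFS

variable {q : List (Fin n)} {h i : ℕ}

theorem length_le (H : T.IsBFS q h i) : q.length ≤ n := by
  simpa using H.nodup.length_le_card

theorem skip (H : T.IsBFS q h i) {v : Fin n} (hv : q.getD h T.root = v)
    (hi : i < (T.adj v).length) (hw : (T.adj v)[i] = T.par v) : T.IsBFS q h (i + 1) := by
  refine ⟨H.nodup, ?_, H.par_lt⟩
  have heq := H.eq
  rw [hv] at heq ⊢
  conv_lhs => rw [heq]
  rw [List.take_add_one, List.getElem?_eq_getElem hi, Option.toList_some, List.filter_append, hw]
  simp

/-- The vertex `w` is new: `v` is its only parent, so it could have been found only while `v` was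
treated, at an earlier place of an adjacency list without repetitions. -/
theorem push (H : T.IsBFS q h i) (hh : h < q.length) {v w : Fin n} (hv : q.getD h T.root = v)
    (hi : i < (T.adj v).length) (hwv : (T.adj v)[i] = w) (hw : w ≠ T.par v) :
    T.IsBFS (q ++ [w]) h (i + 1) := by
  have hchild : T.IsChild v w :=
    (adj_par_or_isChild (hwv ▸ List.getElem_mem hi)).resolve_left hw
  have hg : ∀ k, k < q.length → (q ++ [w]).getD k T.root = q.getD k T.root := fun k hk => by
    rw [List.getD_append _ _ _ _ hk]
  have hqh : q[h] = v := by rw [← hv, List.getD_eq_getElem _ _ hh]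
  have heq := H.eq
  rw [hv] at heq
  have hnew : w ∉ q := by
    intro hmem
    rw [heq, List.mem_cons, List.mem_append, List.mem_flatMap, List.mem_filter] at hmem
    rcases hmem with h1 | ⟨u, h1, h2⟩ | ⟨h1, -⟩
    · exact hchild.ne_root h1
    · have h3 := (mem_childList.1 h2).unique hchild
      rw [h3, List.mem_take_iff_getElem] at h1
      obtain ⟨k, hk, hkv⟩ := h1
      rw [← hqh, H.nodup.getElem_inj_iff] at hkv
      omega
    · rw [List.mem_take_iff_getElem] at h1
      obtain ⟨k, hk, hkv⟩ := h1
      rw [← hwv, (T.adj_nodup v).getElem_inj_iff] at hkv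
      omega
  refine ⟨?_, ?_, ?_⟩
  · rw [List.nodup_append]
    refine ⟨H.nodup, by simp, ?_⟩
    intro a ha b hb
    rw [List.mem_singleton] at hb
    rintro rfl
    exact hnew (hb ▸ ha)
  · rw [hg h hh, List.take_append_of_le_length hh.le, hv, List.take_add_one,
      List.getElem?_eq_getElem hi, Option.toList_some, List.filter_append, hwv,
      List.filter_eq_self (l := [w]).2 (by simpa using hw), ← List.append_assoc,
      ← List.cons_append]
    conv_lhs => rw [heq]
  · intro k hk0 hk
    rw [List.length_append, List.length_singleton] at hk
    rcases (Nat.lt_succ_iff.1 hk).lt_or_eq with hlt | rfl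
    · obtain ⟨k', h1, h2⟩ := H.par_lt k hk0 hlt
      exact ⟨k', h1, by rw [hg k hlt, hg k' (by omega), h2]⟩
    · refine ⟨h, hh, ?_⟩
      rw [hg h hh, List.getD_append_right _ _ _ _ le_rfl, Nat.sub_self, hv]
      simpa using hchild.par_eq.symm

theorem advance (H : T.IsBFS q h i) (hh : h < q.length)
    (hi : i = (T.adj (q.getD h T.root)).length) : T.IsBFS q (h + 1) 0 := by
  refine ⟨H.nodup, ?_, H.par_lt⟩
  conv_lhs => rw [H.eq]
  rw [hi, List.take_length, List.take_add_one, List.getElem?_eq_getElem hh, Option.toList_some,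
    List.flatMap_append, List.getD_eq_getElem _ _ hh]
  simp [childList]

/-- When every vertex found is finished, the list contains the root and is closed under children,
hence contains all vertices. The children of a vertex occur in it as a block, in the order of the
adjacency list. -/
theorem isTopOrder (H : T.IsBFS q q.length i) :
    q.length = n ∧ T.IsTopOrder fun k => q.getD k T.root := by
  have heq := H.eq
  have hchild : ∀ u w, u ∈ q → T.IsChild u w → w ∈ q := by
    intro u w hu hc
    rw [heq]
    simp only [List.mem_cons, List.mem_append, List.mem_flatMap, List.take_length]
    exact Or.inr (Or.inl ⟨u, hu, mem_childList.2 hc⟩)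
  have hall : ∀ v, v ∈ q := by
    intro v
    induction v using rootInduction (T := T) with
    | root => rw [heq]; simp
    | step v hv ih => exact hchild _ _ ih (isChild_par hv)
  have hlen : q.length = n := by
    have h1 := List.toFinset_card_of_nodup H.nodup
    have h2 : q.toFinset = Finset.univ := by ext v; simp [hall v]
    rw [h2] at h1
    simpa using h1.symm
  have hget : ∀ k (hk : k < n), q.getD k T.root = q[k]'(hlen.symm ▸ hk) := fun k hk =>
    List.getD_eq_getElem _ _ (hlen.symm ▸ hk)
  refine ⟨hlen, ⟨?_, ?_, ?_, ?_, ?_⟩⟩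
  · rw [heq]; simp
  · intro i j hi hj hij
    rw [hget i hi, hget j hj, H.nodup.getElem_inj_iff] at hij
    exact hij
  · intro v
    obtain ⟨i, hi, rfl⟩ := List.getElem_of_mem (hall v)
    exact ⟨i, hlen ▸ hi, hget i (hlen ▸ hi)⟩
  · intro k h0 hk
    exact H.par_lt k h0 (hlen.symm ▸ hk)
  · intro u i j hi hj h1 h2 h3
    have e1 : [q.getD i T.root, q.getD j T.root].Sublist (T.childList u) := by
      have := h3.filter fun w => w ≠ T.par u
      have n1 : q.getD i T.root ≠ T.par u := fun h => h1.not_anc (h ▸ par_anc u)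
      have n2 : q.getD j T.root ≠ T.par u := fun h => h2.not_anc (h ▸ par_anc u)
      rwa [List.filter_eq_self.2 (by simpa [-List.getD_eq_getElem?_getD] using ⟨n1, n2⟩)] at this
    have e2 : (T.childList u).Sublist q := by
      rw [heq, List.take_length]
      refine List.Sublist.cons _ (List.Sublist.trans ?_ (List.sublist_append_left _ _))
      obtain ⟨a, b, hab⟩ := List.append_of_mem (hall u)
      rw [hab, List.flatMap_append, List.flatMap_cons]
      exact (List.sublist_append_left _ _).trans (List.sublist_append_right _ _)
    obtain ⟨i', j', hi', hj', hij, e3, e4⟩ :=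
      List.pair_sublist_iff_exists_getElem.1 (e1.trans e2)
    rw [hget i hi, H.nodup.getElem_inj_iff] at e3
    rw [hget j hj, H.nodup.getElem_inj_iff] at e4
    omega

end IsBFS

/-! ### The concatenated adjacency lists -/

/-- The position at which the adjacency list of `v` starts. -/
def start (T : OrderedTree n) (v : ℕ) : ℕ := (((List.ofFn T.adj).take v).flatten).length

theorem start_succ (v : Fin n) : T.start (v + 1) = T.start v + (T.adj v).length := by
  unfold start
  rw [List.take_add_one, List.getElem?_eq_getElem (by simp)]
  simp

theorem getD_start_add {v : Fin n} {i : ℕ} (hi : i < (T.adj v).length) :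
    (((List.ofFn T.adj).flatten).map fun w : Fin n => (w : ℕ)).getD (T.start v + i) 0 =
      ((T.adj v)[i] : Fin n) := by
  have hsplit : (List.ofFn T.adj).flatten = ((List.ofFn T.adj).take v).flatten ++
      (T.adj v ++ ((List.ofFn T.adj).drop (v + 1)).flatten) := by
    conv_lhs => rw [← List.take_append_drop (v : ℕ) (List.ofFn T.adj)]
    rw [List.flatten_append, List.drop_eq_getElem_cons (by simp), List.flatten_cons]
    simp
  rw [hsplit, List.map_append, List.getD_append_right]
  · rw [List.length_map]
    unfold start
    rw [Nat.add_sub_cancel_left, List.map_append, List.getD_append _ _ _ _ (by simpa using hi),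
      List.getD_eq_getElem _ _ (by simpa using hi)]
    simp
  · rw [List.length_map]; exact Nat.le_add_right _ _

/-- The handshake lemma for `n - 1` edges, in additive form to avoid truncated subtraction. -/
theorem sum_length_adj (T : OrderedTree n) : ∑ v, (T.adj v).length + 2 = 2 * n := by
  classical
  have h1 : ∀ v, (T.adj v).length = T.graph.degree v := by
    intro v
    rw [← SimpleGraph.card_neighborFinset_eq_degree, ← List.toFinset_card_of_nodup (T.adj_nodup v)]
    congr 1
    ext w
    simp [T.mem_adj]
  rw [Finset.sum_congr rfl fun v _ => h1 v, SimpleGraph.sum_degrees_eq_twice_card_edges]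
  have := T.isTree.card_edgeFinset
  rw [Fintype.card_fin] at this
  omega

theorem start_le (T : OrderedTree n) (v : ℕ) : T.start v ≤ 2 * n := by
  have h1 : T.start v ≤ ((List.ofFn T.adj).flatten).length :=
    ((List.take_sublist v _).flatten).length_le
  have h2 : ((List.ofFn T.adj).flatten).length = ∑ v, (T.adj v).length := by
    rw [List.length_flatten, List.map_ofFn, List.sum_ofFn]
    rfl
  have := T.sum_length_adj
  omega

end OrderedTree

/-! ### The breadth first search program. -/

namespace RAM

open OrderedTree

variable {n : ℕ} {T : OrderedTree n} {M W : ℕ}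

/-- The input arrays contain the adjacency lists of `T`. -/
structure HasTree (T : OrderedTree n) (s : State) : Prop where
  reg_n : s.reg 0 = n
  reg_root : s.reg 1 = T.root
  start : ∀ v, v ≤ n → s.arr 0 v = T.start v
  adj : ∀ (v : Fin n) (i : ℕ) (hi : i < (T.adj v).length),
    s.arr 1 (T.start v + i) = ((T.adj v)[i] : Fin n)

theorem hasTree_input (T : OrderedTree n) (f d : ℕ) : HasTree T (input T f d) where
  reg_n := rfl
  reg_root := rfl
  start v hv := by simp [input, hv, OrderedTree.start]
  adj v i hi := getD_start_add hi

/-- One step of the breadth first search with queue in array `5` and parents in array `4`; the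
registers `4`, `5`, `6` contain the number of finished vertices, the number of vertices found, and
the position in the adjacency lists. -/
def bfsStep : Prog :=
  .seq (.assign 7 (.get 5 (.reg 4))) <|
  .ite (.op .lt (.reg 6) (.get 0 (.op .add (.reg 7) (.lit 1))))
    (.seq (.assign 8 (.get 1 (.reg 6))) <|
     .seq (.assign 6 (.op .add (.reg 6) (.lit 1))) <|
     .ite (.op .eq (.reg 8) (.get 4 (.reg 7))) .skip
      (.seq (.store 4 (.reg 8) (.reg 7)) <|
       .seq (.store 5 (.reg 5) (.reg 8)) <|
       .assign 5 (.op .add (.reg 5) (.lit 1))))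
    (.seq (.assign 4 (.op .add (.reg 4) (.lit 1))) <|
     .assign 6 (.get 0 (.get 5 (.reg 4))))

/-- The initialization of the breadth first search. -/
def bfsInit : Prog :=
  .seq (.store 5 (.lit 0) (.reg 1)) <|
  .seq (.store 4 (.reg 1) (.reg 1)) <|
  .seq (.assign 4 (.lit 0)) <|
  .seq (.assign 5 (.lit 1)) <|
  .assign 6 (.get 0 (.reg 1))

def bfsLoop : Prog := .loop (.op .lt (.reg 4) (.reg 5)) bfsStep

/-- The number of steps made by the breadth first search. -/
def bfsSteps (T : OrderedTree n) (q : List (Fin n)) (h i : ℕ) : ℕ :=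
  ((q.take h).map fun v => (T.adj v).length + 1).sum + i

theorem sum_map_le_of_nodup {q : List (Fin n)} (hq : q.Nodup) (g : Fin n → ℕ) :
    (q.map g).sum ≤ ∑ v, g v := by
  classical
  rw [← List.sum_toFinset _ hq]
  exact Finset.sum_le_sum_of_subset (Finset.subset_univ _)

/-- A vertex costs one step for each neighbour and one for leaving it, at most `(2 n - 2) + n` in
all. So `3 n` minus the steps made is a loop measure. -/
theorem bfsSteps_le {q : List (Fin n)} (hq : q.Nodup) {h i : ℕ} (hh : h < q.length)
    (hi : i ≤ (T.adj (q.getD h T.root)).length) : bfsSteps T q h i + 1 ≤ 3 * n := by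
  have h1 : ((q.take (h + 1)).map fun v => (T.adj v).length + 1).sum =
      ((q.take h).map fun v => (T.adj v).length + 1).sum +
        ((T.adj (q.getD h T.root)).length + 1) := by
    rw [List.take_add_one, List.getElem?_eq_getElem hh, List.getD_eq_getElem _ _ hh,
      Option.toList_some, List.map_append, List.sum_append]
    simp only [List.map_cons, List.map_nil, List.sum_cons, List.sum_nil, add_zero]
  have h2 := sum_map_le_of_nodup (hq.sublist (List.take_sublist (h + 1) q))
    fun v => (T.adj v).length + 1
  rw [Finset.sum_add_distrib] at h2
  have h3 := T.sum_length_adj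
  simp only [Finset.sum_const, Finset.card_univ, Fintype.card_fin, smul_eq_mul, mul_one] at h2
  unfold bfsSteps
  omega

/-- The invariant of the breadth first search. -/
def BFSInv (T : OrderedTree n) (k : ℕ) (s : State) : Prop :=
  ∃ q h i, HasTree T s ∧ T.IsBFS q h i ∧ h ≤ q.length ∧ s.reg 4 = h ∧ s.reg 5 = q.length ∧
    (h < q.length → i ≤ (T.adj (q.getD h T.root)).length ∧
      s.reg 6 = T.start (q.getD h T.root) + i) ∧
    (∀ m, m < q.length → s.arr 5 m = (q.getD m T.root : Fin n)) ∧
    (∀ v ∈ q, s.arr 4 v = T.par v) ∧ k + bfsSteps T q h i = 3 * n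

theorem bfsStep_spec (hM : 2 * n + 2 ≤ M) {k : ℕ} {s : State} (hs : s.Bdd M) (hI : BFSInv T k s)
    (he : (Expr.op .lt (.reg 4) (.reg 5)).eval s ≠ 0) :
    bfsStep.Safe M s ∧ ∃ k', k' < k ∧ BFSInv T k' (bfsStep.run s) := by
  obtain ⟨q, h, i, hT, hq, hle, r4, r5, r6, a5, a4, hk⟩ := hI
  have hh : h < q.length := by
    by_contra hcon
    simp [Expr.eval, Op.eval, r4, r5, hcon] at he
  obtain ⟨hi, r6⟩ := r6 hh
  have hsteps := bfsSteps_le (T := T) hq.nodup hh hi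
  have hlen := hq.length_le
  obtain ⟨v, hv⟩ : ∃ v, q.getD h T.root = v := ⟨_, rfl⟩
  rw [hv] at hi r6
  have e7 : s.arr 5 h = (v : ℕ) := by rw [a5 h hh, hv]
  have hvq : v ∈ q := by
    rw [← hv, List.getD_eq_getElem _ _ hh]; exact List.getElem_mem hh
  have est : s.arr 0 ((v : ℕ) + 1) = T.start v + (T.adj v).length := by
    rw [hT.start _ (by omega), start_succ]
  have evM : (v : ℕ) ≤ M := by omega
  have hpM : (T.par v : ℕ) ≤ M := by omega
  have hsub : ∀ j, bfsSteps T q h j = bfsSteps T q h 0 + j := fun j => by unfold bfsSteps; omega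
  by_cases hlt : i < (T.adj v).length
  · have hadj : s.arr 1 (T.start v + i) = ((T.adj v)[i] : Fin n) := hT.adj v i hlt
    obtain ⟨w, hw⟩ : ∃ w, (T.adj v)[i] = w := ⟨_, rfl⟩
    rw [hw] at hadj
    have hstart := T.start_le (v + 1)
    rw [start_succ] at hstart
    have hk' := hsub i
    have hk'' := hsub (i + 1)
    by_cases hpar : w = T.par v
    · have hcond : (w : ℕ) = (T.par v : ℕ) := by rw [hpar]
      constructor
      · simp [bfsStep, Prog.Safe, Prog.run, Expr.eval, Op.eval, r4, r6, e7, est, hadj, hlt, a4 v hvq,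
          hcond]
        omega
      · have hrun : bfsStep.run s = ((s.setReg 7 v).setReg 8 w).setReg 6 (T.start v + i + 1) := by
          simp [bfsStep, Prog.run, Expr.eval, Op.eval, r4, r6, e7, est, hadj, hlt, a4 v hvq, hcond]
        rw [hrun]
        refine ⟨k - 1, by omega, q, h, i + 1, ⟨hT.reg_n, hT.reg_root, hT.start, hT.adj⟩,
          hq.skip hv hlt (hw.trans hpar), hle, r4, r5, fun _ => ?_, a5, a4, by omega⟩
        rw [hv]
        exact ⟨hlt, by simp; omega⟩
    · have hcond : (w : ℕ) ≠ (T.par v : ℕ) := fun h => hpar (Fin.ext h)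
      have hpush := hq.push hh hv hlt hw hpar
      have hlen' := hpush.length_le
      have hnd := hpush.nodup
      rw [List.length_append, List.length_singleton] at hlen'
      constructor
      · simp [bfsStep, Prog.Safe, Prog.run, Expr.eval, Op.eval, r4, r5, r6, e7, est, hadj, hlt,
          a4 v hvq, hcond]
        omega
      · have hrun : bfsStep.run s = (((((s.setReg 7 v).setReg 8 w).setReg 6
            (T.start v + i + 1)).setArr 4 w v).setArr 5 q.length w).setReg 5 (q.length + 1) := by
          simp [bfsStep, Prog.run, Expr.eval, Op.eval, r4, r5, r6, e7, est, hadj, hlt, a4 v hvq,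
            hcond]
        rw [hrun]
        have hg : ∀ k, k < q.length → (q ++ [w]).getD k T.root = q.getD k T.root := fun k hk => by
          rw [List.getD_append _ _ _ _ hk]
        have hst : bfsSteps T (q ++ [w]) h (i + 1) = bfsSteps T q h (i + 1) := by
          unfold bfsSteps; rw [List.take_append_of_le_length hle]
        refine ⟨k - 1, by omega, q ++ [w], h, i + 1, ⟨hT.reg_n, hT.reg_root, hT.start, hT.adj⟩,
          hpush, by simp; omega, r4, by simp, fun _ => ?_, ?_, ?_, by omega⟩
        · rw [hg h hh, hv]
          exact ⟨hlt, by simp; omega⟩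
        · intro m hm
          rw [List.length_append, List.length_singleton] at hm
          rcases (Nat.lt_succ_iff.1 hm).lt_or_eq with h1 | rfl
          · rw [hg m h1, ← a5 m h1]
            simp [h1.ne]
          · rw [List.getD_append_right _ _ _ _ le_rfl]
            simp
        · intro x hx
          have hvw : T.par w = v :=
            ((adj_par_or_isChild (hw ▸ List.getElem_mem hlt)).resolve_left hpar).par_eq
          by_cases hxw : x = w
          · rw [hxw, hvw]; simp
          · rw [← a4 x (by simpa [hxw] using hx)]
            have : (x : ℕ) ≠ w := fun h => hxw (Fin.ext h)
            simp [this]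
  · have hi' : i = (T.adj v).length := by omega
    have hst : bfsSteps T q (h + 1) 0 = bfsSteps T q h i + 1 := by
      unfold bfsSteps
      rw [List.take_add_one, List.getElem?_eq_getElem hh, Option.toList_some, List.map_append,
        List.sum_append, ← List.getD_eq_getElem _ T.root hh, hv, hi']
      simp only [List.map_cons, List.map_nil, List.sum_cons, List.sum_nil, add_zero]
      omega
    -- After the last vertex found, array `5` is read at an unused place. The loop then ends, so the
    -- value read only has to be bounded.
    have hrun : bfsStep.run s = ((s.setReg 7 v).setReg 4 (h + 1)).setReg 6
        (s.arr 0 (s.arr 5 (h + 1))) := by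
      simp [bfsStep, Prog.run, Expr.eval, Op.eval, r4, r6, e7, est, hlt]
    constructor
    · simp [bfsStep, Prog.Safe, Prog.run, Expr.eval, Op.eval, r4, r6, e7, est, hlt]
      have := hs.2 0 (s.arr 5 (h + 1))
      omega
    · rw [hrun]
      refine ⟨k - 1, by omega, q, h + 1, 0, ⟨hT.reg_n, hT.reg_root, hT.start, hT.adj⟩,
        hq.advance hh (by rw [hv]; exact hi'), hh, by simp, r5, fun hlt' => ⟨Nat.zero_le _, ?_⟩, a5,
        a4, by omega⟩
      simp only [State.setReg_reg, if_true, add_zero]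
      rw [a5 _ hlt', hT.start _ (Fin.is_lt _).le]

def bfs : Prog := .seq bfsInit bfsLoop

/-- The root is entered as its own parent, in agreement with `par`; not being its own neighbour, it
causes no child to be skipped. -/
theorem bfs_spec (hM : 2 * n + 2 ≤ M) (hW : (M + 2) ^ bfs.size ≤ W) {s : State} (hs : s.Bdd M)
    (hT : HasTree T s) :
    Runs M W bfs s (200 * (n + 1)) fun s' => ∃ Q : ℕ → Fin n, T.IsTopOrder Q ∧
      (∀ k, k < n → s'.arr 5 k = Q k) ∧ ∀ v : Fin n, s'.arr 4 v = T.par v := by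
  have hn : 0 < n := T.root.pos
  refine Runs.mono (t := bfsInit.cost + (3 * n + 1) * (bfsStep.cost +
    (Expr.op .lt (.reg 4) (.reg 5)).cost + 1)) (Runs.seq (P := BFSInv T (3 * n)) ?_
    fun s' hs' hI _ _ => ?_) ?_ fun _ h => h
  · refine Runs.of_run hs ((Nat.pow_le_pow_right (by omega) (by simp [bfs, Prog.size])).trans hW)
      ?_ ?_
    · have h1 := hs.2 0 T.root
      have h2 := hs.1 1
      simp [bfsInit, Prog.Safe, Prog.run, Expr.eval, hT.reg_root] at h2 ⊢
      omega
    · refine ⟨[T.root], 0, 0, ⟨hT.reg_n, hT.reg_root, hT.start, hT.adj⟩, isBFS_init, by simp,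
        ?_, ?_, fun _ => ⟨by simp, ?_⟩, ?_, ?_, ?_⟩
      · simp [bfsInit, Prog.run, Expr.eval]
      · simp [bfsInit, Prog.run, Expr.eval]
      · simp [bfsInit, Prog.run, Expr.eval, hT.reg_root]
        exact hT.start _ (Fin.is_lt _).le
      · intro m hm
        obtain rfl : m = 0 := by simpa using hm
        simp [bfsInit, Prog.run, Expr.eval, hT.reg_root]
      · intro v hv
        obtain rfl : v = T.root := by simpa using hv
        simp [bfsInit, Prog.run, Expr.eval, hT.reg_root, par_root]
      · simp [bfsSteps]
  · refine (Runs.loop ((Nat.pow_le_pow_right (by omega) (by simp [bfs, bfsLoop, Prog.size])).trans hW)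
      (BFSInv T) (fun k s hs hI he => bfsStep_spec hM hs hI he) hs' hI).mono le_rfl ?_
    rintro s'' ⟨⟨k, q, h, i, -, hq, hle, r4, r5, -, a5, a4, -⟩, he⟩
    have hh : h = q.length := by
      by_contra hcon
      have : h < q.length := by omega
      simp [Expr.eval, Op.eval, r4, r5, this] at he
    subst hh
    obtain ⟨h1, h2⟩ := hq.isTopOrder
    refine ⟨_, h2, fun k hk => a5 k (by omega), fun v => a4 v ?_⟩
    obtain ⟨j, hj, rfl⟩ := h2.surj v
    rw [List.getD_eq_getElem _ _ (by omega)]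
    exact List.getElem_mem _
  · simp [bfsInit, bfsStep, Prog.cost, Expr.cost]
    omega

end RAM

/-! ### For-loops and sweeps over the vertices. -/

namespace RAM

open OrderedTree

theorem Prog.Safe.run_arr {M : ℕ} {p : Prog} {s : State} (h : p.Safe M s) {a : ℕ}
    (ha : a ∉ p.arrays) : (p.run s).arr a = s.arr a := by
  induction p generalizing s with
  | skip | assign => rfl
  | store b i e =>
    simp only [Prog.arrays, List.mem_singleton] at ha
    simp [Prog.run, ha]
  | seq p q ih₁ ih₂ =>
    simp only [Prog.arrays, List.mem_append, not_or] at ha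
    rw [Prog.run, ih₂ h.2 ha.2, ih₁ h.1 ha.1]
  | ite e p q ih₁ ih₂ =>
    simp only [Prog.arrays, List.mem_append, not_or] at ha
    simp only [Prog.Safe] at h
    simp only [Prog.run]
    split_ifs at h ⊢
    · exact ih₂ h ha.2
    · exact ih₁ h ha.1
  | loop => exact h.elim

theorem Prog.Safe.run_reg {M : ℕ} {p : Prog} {s : State} (h : p.Safe M s) {x : ℕ}
    (hx : x ∉ p.regs) : (p.run s).reg x = s.reg x := by
  induction p generalizing s with
  | skip | store => rfl
  | assign y e =>
    simp only [Prog.regs, List.mem_singleton] at hx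
    simp [Prog.run, hx]
  | seq p q ih₁ ih₂ =>
    simp only [Prog.regs, List.mem_append, not_or] at hx
    rw [Prog.run, ih₂ h.2 hx.2, ih₁ h.1 hx.1]
  | ite e p q ih₁ ih₂ =>
    simp only [Prog.regs, List.mem_append, not_or] at hx
    simp only [Prog.Safe] at h
    simp only [Prog.run]
    split_ifs at h ⊢
    · exact ih₂ h hx.2
    · exact ih₁ h hx.1
  | loop => exact h.elim

/-- The loop "for `a ≤ k < N` do `p`", where `k` is in register `4` and `N` in register `x`. -/
def forLoop (a x : ℕ) (p : Prog) : Prog :=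
  .seq (.assign 4 (.lit a)) <|
  .loop (.op .lt (.reg 4) (.reg x)) (.seq p (.assign 4 (.op .add (.reg 4) (.lit 1))))

/-- The body leaves the counter and the limit alone, and the invariant does not depend on the
counter (`hstab`), so it survives the increment. -/
theorem Runs.forLoop {M W a x N : ℕ} {p : Prog} {s : State}
    (hW : (M + 2) ^ (forLoop a x p).size ≤ W) (hs : s.Bdd M) (hN : s.reg x = N) (ha : a ≤ N)
    (h4 : 4 ∉ p.regs) (hx : x ∉ p.regs) (hx4 : x ≠ 4) (Inv : ℕ → State → Prop)
    (hstab : ∀ k s v, Inv k s → Inv k (s.setReg 4 v))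
    (step : ∀ k s', s'.Bdd M → a ≤ k → k < N → s'.reg 4 = k →
      (∀ b, b ∉ p.arrays → s'.arr b = s.arr b) →
      (∀ y, y ∉ p.regs → y ≠ 4 → s'.reg y = s.reg y) → Inv k s' →
      p.Safe M s' ∧ Inv (k + 1) (p.run s'))
    (hI : Inv a s) :
    Runs M W (forLoop a x p) s ((N + 1) * (p.cost + 10)) (Inv N) := by
  have hNM : N ≤ M := hN ▸ hs.1 x
  refine Runs.mono (t := 2 + (N - a + 1) * ((Prog.seq p
    (.assign 4 (.op .add (.reg 4) (.lit 1)))).cost + (Expr.op .lt (.reg 4) (.reg x)).cost + 1))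
    (Runs.seq (P := fun s' => s' = s.setReg 4 a) ?_ ?_) ?_ fun _ h => h
  · exact Runs.of_run hs ((Nat.pow_le_pow_right (by omega)
      (by simp [RAM.forLoop, Prog.size])).trans hW) (by simpa [Prog.Safe, Expr.eval] using ha.trans hNM)
      rfl
  · rintro _ hs' rfl - -
    refine (Runs.loop ((Nat.pow_le_pow_right (by omega)
      (by simp [RAM.forLoop, Prog.size])).trans hW)
      (fun t s' => ∃ k, a ≤ k ∧ k ≤ N ∧ t = N - k ∧ s'.reg 4 = k ∧
        (∀ b, b ∉ p.arrays → s'.arr b = s.arr b) ∧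
        (∀ y, y ∉ p.regs → y ≠ 4 → s'.reg y = s.reg y) ∧ Inv k s') ?_ hs'
      ⟨a, le_rfl, ha, rfl, by simp, fun _ _ => rfl, fun y _ hy => by simp [hy],
        hstab _ _ _ hI⟩).mono le_rfl ?_
    · rintro t s' hs' ⟨k, hak, hkN, ht, hr4, harr, hreg, hIk⟩ he
      have hrx : s'.reg x = N := by rw [hreg x hx hx4, hN]
      have hk : k < N := by
        by_contra hcon
        simp [Expr.eval, Op.eval, hr4, hrx, hcon] at he
      obtain ⟨h1, h2⟩ := step k s' hs' hak hk hr4 harr hreg hIk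
      have hr : (p.run s').reg 4 = k := by rw [h1.run_reg h4, hr4]
      refine ⟨⟨h1, ?_⟩, N - (k + 1), by omega, k + 1, by omega, hk, rfl, ?_, ?_, ?_, ?_⟩
      · simp only [Prog.Safe, Expr.eval, Op.eval, hr]; omega
      · simp [Prog.run, Expr.eval, Op.eval, hr]
      · intro b hb
        rw [← harr b hb, ← h1.run_arr hb]
        rfl
      · intro y hy hy4
        rw [← hreg y hy hy4, ← h1.run_reg hy]
        simp [Prog.run, hy4]
      · exact hstab _ _ _ h2
    · rintro s'' ⟨⟨t, k, hak, hkN, ht, hr4, harr, hreg, hIk⟩, he⟩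
      have hrx : s''.reg x = N := by rw [hreg x hx hx4, hN]
      have hk : k = N := by
        by_contra hcon
        have : k < N := by omega
        simp [Expr.eval, Op.eval, hr4, hrx, this] at he
      exact hk ▸ hIk
  · simp only [Prog.cost, Expr.cost]
    have : (N - a + 1) * (p.cost + (1 + 1 + 1 + 1) + (1 + 1 + 1) + 1) ≤ (N + 1) * (p.cost + 8) :=
      Nat.mul_le_mul (by omega) (by omega)
    have h2 : (N + 1) * (p.cost + 10) = (N + 1) * (p.cost + 8) + (N + 1) * 2 := by ring
    omega

/-- Treat the vertices except the root in the order of the queue in array `5`: the vertex is in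
register `5`, its parent in register `6`. -/
def sweepUp (p : Prog) : Prog :=
  forLoop 1 0 (.seq (.assign 5 (.get 5 (.reg 4))) <| .seq (.assign 6 (.get 4 (.reg 5))) p)

/-- Treat the vertices except the root in the reverse order. -/
def sweepDown (p : Prog) : Prog :=
  forLoop 1 0 (.seq (.assign 5 (.get 5 (.op .sub (.reg 0) (.reg 4)))) <|
    .seq (.assign 6 (.get 4 (.reg 5))) p)

variable {n : ℕ} {T : OrderedTree n} {M W : ℕ}

/-- The state contains a topological order in array `5` and the parents in array `4`. -/
structure HasOrder (T : OrderedTree n) (Q : ℕ → Fin n) (s : State) : Prop where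
  isTopOrder : T.IsTopOrder Q
  reg_n : s.reg 0 = n
  queue : ∀ k, k < n → s.arr 5 k = Q k
  par : ∀ v : Fin n, s.arr 4 v = T.par v

theorem HasOrder.congr {Q : ℕ → Fin n} {s s' : State} (h : HasOrder T Q s)
    (hr : s'.reg 0 = s.reg 0) (h4 : s'.arr 4 = s.arr 4) (h5 : s'.arr 5 = s.arr 5) :
    HasOrder T Q s' :=
  ⟨h.isTopOrder, hr ▸ h.reg_n, h5 ▸ h.queue, h4 ▸ h.par⟩

/-- In reverse breadth first order a vertex comes after its children and before its parent. The
invariant refers only to the set `S` of treated vertices and to the arrays, so that individual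
sweeps need not mention the queue. -/
theorem Runs.sweepDown {Q : ℕ → Fin n} {p : Prog} {s : State}
    (hW : (M + 2) ^ (sweepDown p).size ≤ W) (hs : s.Bdd M) (hQ : HasOrder T Q s)
    (hreg : ∀ x ∈ p.regs, 7 ≤ x) (harr : ∀ a ∈ p.arrays, 6 ≤ a)
    (Inv : Set (Fin n) → (ℕ → ℕ → ℕ) → Prop)
    (step : ∀ (S : Set (Fin n)) (w : Fin n) (s' : State), s'.Bdd M → s'.reg 5 = (w : ℕ) → s'.reg 6 = (T.par w : ℕ) →
      (∀ b, b ∉ p.arrays → s'.arr b = s.arr b) → w ≠ T.root → w ∉ S → T.par w ∉ S →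
      (∀ c, T.IsChild w c → c ∈ S) → Inv S s'.arr →
      p.Safe M s' ∧ Inv (insert w S) (p.run s').arr)
    (hI : Inv ∅ s.arr) :
    Runs M W (sweepDown p) s ((n + 1) * (p.cost + 20)) fun s' => Inv {v | v ≠ T.root} s'.arr := by
  have hn : 0 < n := T.root.pos
  have hreg' : ∀ x, x < 7 → x ∉ p.regs := fun x hx h => by have := hreg x h; omega
  have harr' : ∀ a, a < 6 → a ∉ p.arrays := fun a ha h => by have := harr a h; omega
  have hnM : n ≤ M := hQ.reg_n ▸ hs.1 0
  -- Step `k` treats `Q (n - k)`; the root `Q 0` is left out because `k < n`.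
  let S : ℕ → Set (Fin n) := fun k => {v | ∃ j, n - k < j ∧ j < n ∧ Q j = v}
  have hTop := hQ.isTopOrder
  have hmem : ∀ k i, i < n → (Q i ∈ S k ↔ n - k < i) := fun k i hi => by
    constructor
    · rintro ⟨j, h1, h2, h3⟩
      rwa [← hTop.inj j i h2 hi h3]
    · exact fun h => ⟨i, h, hi, rfl⟩
  refine (Runs.forLoop (N := n) hW hs hQ.reg_n hn ?_ ?_ (by decide) (fun k s => Inv (S k) s.arr)
    (fun _ _ _ h => h) ?_ ?_).mono ?_ ?_
  · simp [Prog.regs, hreg']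
  · simp [Prog.regs, hreg']
  · intro k s' hs' hk1 hkn hr4 ha hr hIk
    have e5 : s'.arr 5 = s.arr 5 := ha 5 (by simp [Prog.arrays, harr'])
    have e4 : s'.arr 4 = s.arr 4 := ha 4 (by simp [Prog.arrays, harr'])
    have e0 : s'.reg 0 = n := by
      rw [hr 0 (by simp [Prog.regs, hreg']) (by decide), hQ.reg_n]
    obtain ⟨w, hw⟩ : ∃ w, Q (n - k) = w := ⟨_, rfl⟩
    have hval : s'.arr 5 (n - k) = (w : ℕ) := by rw [e5, hQ.queue _ (by omega), hw]
    have hpar : s'.arr 4 w = (T.par w : ℕ) := by rw [e4, hQ.par]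
    obtain ⟨s'', hs''⟩ : ∃ s'', s'' = (s'.setReg 5 w).setReg 6 (T.par w : ℕ) := ⟨_, rfl⟩
    have hwroot : w ≠ T.root := by
      rw [← hw, ← hTop.zero]
      intro h
      have := hTop.inj _ _ (by omega) hn h
      omega
    obtain ⟨k', hk', hkw⟩ := hTop.par_lt (n - k) (by omega) (by omega)
    rw [hw] at hkw
    obtain ⟨h1, h2⟩ := step (S k) w s'' (by
        rw [hs'']; exact (hs'.setReg (by omega)).setReg (by omega))
      (by simp [hs'']) (by simp [hs'']) (fun b hb => by
        rw [hs'', ← ha b (by simpa [Prog.arrays] using hb)]; rfl) hwroot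
      (by rw [← hw, hmem k _ (by omega)]; omega)
      (by rw [← hkw, hmem k _ (by omega)]; omega)
      (fun c hc => by
        obtain ⟨i, hi, rfl⟩ := hTop.surj c
        rw [hmem k _ hi]
        have hi0 : 0 < i := by
          rcases Nat.eq_zero_or_pos i with rfl | h
          · exact absurd hTop.zero hc.ne_root
          · exact h
        obtain ⟨i', h1, h2⟩ := hTop.par_lt i hi0 hi
        rw [hc.par_eq, ← hw] at h2
        have := hTop.inj _ _ (by omega) (by omega) h2
        omega) (by rw [hs'']; exact hIk)
    have hrun : (Prog.seq (.assign 5 (.get 5 (.op .sub (.reg 0) (.reg 4)))) <|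
        .seq (.assign 6 (.get 4 (.reg 5))) p).run s' = p.run s'' := by
      simp [Prog.run, Expr.eval, Op.eval, hr4, e0, hval, hpar, hs'']
    refine ⟨?_, ?_⟩
    · simp only [Prog.Safe, Prog.run, Expr.eval, Op.eval, hr4, e0, hval, State.setReg_reg,
        State.setReg_arr, if_true, hpar]
      exact ⟨by omega, by omega, by rwa [← hs'']⟩
    · rw [hrun]
      convert h2 using 1
      ext v
      obtain ⟨i, hi, rfl⟩ := hTop.surj v
      rw [hmem _ _ hi, Set.mem_insert_iff, hmem _ _ hi]
      constructor
      · intro h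
        by_cases hik : i = n - k
        · exact Or.inl (hik ▸ hw)
        · right; omega
      · rintro (h | h)
        · rw [← hw] at h
          have := hTop.inj _ _ hi (by omega) h
          omega
        · omega
  · convert hI using 1
    ext v
    simp only [S, Set.mem_ofPred_eq, Set.mem_empty_iff_false, iff_false]
    rintro ⟨j, h1, h2, -⟩
    omega
  · refine Nat.mul_le_mul_left _ ?_
    simp only [Prog.cost, Expr.cost]
    omega
  · intro s' h
    convert h using 1
    ext v
    obtain ⟨i, hi, rfl⟩ := hTop.surj v
    rw [hmem _ _ hi, Set.mem_ofPred_eq, ← hTop.zero, Nat.sub_self]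
    constructor
    · intro h
      rcases Nat.eq_zero_or_pos i with rfl | h'
      · exact absurd rfl h
      · exact h'
    · intro h h'
      have := hTop.inj _ _ hi hn h'
      omega

/-- In breadth first order a parent comes before its children, and the siblings already treated are
exactly those further left, which is what the ranks of the leaves require. -/
theorem Runs.sweepUp {Q : ℕ → Fin n} {p : Prog} {s : State}
    (hW : (M + 2) ^ (sweepUp p).size ≤ W) (hs : s.Bdd M) (hQ : HasOrder T Q s)
    (hreg : ∀ x ∈ p.regs, 7 ≤ x) (harr : ∀ a ∈ p.arrays, a ≠ 4 ∧ a ≠ 5)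
    (Inv : Set (Fin n) → (ℕ → ℕ → ℕ) → Prop)
    (step : ∀ (S : Set (Fin n)) (w : Fin n) (s' : State), s'.Bdd M → s'.reg 5 = (w : ℕ) → s'.reg 6 = (T.par w : ℕ) →
      (∀ b, b ∉ p.arrays → s'.arr b = s.arr b) →
      (∀ x, x ∉ p.regs → 7 ≤ x → s'.reg x = s.reg x) → w ≠ T.root → w ∉ S → T.par w ∈ S →
      (∀ c, T.IsChild w c → c ∉ S) →
      (∀ c, T.IsChild (T.par w) c → (c ∈ S ↔ [c, w].Sublist (T.adj (T.par w)))) → Inv S s'.arr →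
      p.Safe M s' ∧ Inv (insert w S) (p.run s').arr)
    (hI : Inv {T.root} s.arr) :
    Runs M W (sweepUp p) s ((n + 1) * (p.cost + 20)) fun s' => Inv Set.univ s'.arr := by
  have hn : 0 < n := T.root.pos
  have hreg' : ∀ x, x < 7 → x ∉ p.regs := fun x hx h => by have := hreg x h; omega
  have harr4 : 4 ∉ p.arrays := fun h => (harr 4 h).1 rfl
  have harr5 : 5 ∉ p.arrays := fun h => (harr 5 h).2 rfl
  have hnM : n ≤ M := hQ.reg_n ▸ hs.1 0
  let S : ℕ → Set (Fin n) := fun k => {v | ∃ j, j < k ∧ j < n ∧ Q j = v}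
  have hTop := hQ.isTopOrder
  have hmem : ∀ k i, i < n → (Q i ∈ S k ↔ i < k) := fun k i hi => by
    constructor
    · rintro ⟨j, h1, h2, h3⟩
      rwa [← hTop.inj j i h2 hi h3]
    · exact fun h => ⟨i, h, hi, rfl⟩
  refine (Runs.forLoop (N := n) hW hs hQ.reg_n hn ?_ ?_ (by decide) (fun k s => Inv (S k) s.arr)
    (fun _ _ _ h => h) ?_ ?_).mono ?_ ?_
  · simp [Prog.regs, hreg']
  · simp [Prog.regs, hreg']
  · intro k s' hs' hk1 hkn hr4 ha hr hIk
    have e5 : s'.arr 5 = s.arr 5 := ha 5 (by simp [Prog.arrays, harr5])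
    have e4 : s'.arr 4 = s.arr 4 := ha 4 (by simp [Prog.arrays, harr4])
    obtain ⟨w, hw⟩ : ∃ w, Q k = w := ⟨_, rfl⟩
    have hval : s'.arr 5 k = (w : ℕ) := by rw [e5, hQ.queue _ (by omega), hw]
    have hpar : s'.arr 4 w = (T.par w : ℕ) := by rw [e4, hQ.par]
    obtain ⟨s'', hs''⟩ : ∃ s'', s'' = (s'.setReg 5 w).setReg 6 (T.par w : ℕ) := ⟨_, rfl⟩
    have hwroot : w ≠ T.root := by
      rw [← hw, ← hTop.zero]
      intro h
      have := hTop.inj _ _ (by omega) hn h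
      omega
    obtain ⟨k', hk', hkw⟩ := hTop.par_lt k (by omega) (by omega)
    rw [hw] at hkw
    obtain ⟨h1, h2⟩ := step (S k) w s'' (by
        rw [hs'']; exact (hs'.setReg (by omega)).setReg (by omega))
      (by simp [hs'']) (by simp [hs'']) (fun b hb => by
        rw [hs'', ← ha b (by simpa [Prog.arrays] using hb)]; rfl)
      (fun x hx hx7 => by
        rw [← hr x (by simp [Prog.regs, hx]; omega) (by omega), hs'']
        simp [show x ≠ 5 by omega, show x ≠ 6 by omega]) hwroot
      (by rw [← hw, hmem k _ (by omega)]; omega)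
      (by rw [← hkw, hmem k _ (by omega)]; omega)
      (fun c hc => by
        obtain ⟨i, hi, rfl⟩ := hTop.surj c
        rw [hmem k _ hi]
        have hi0 : 0 < i := by
          rcases Nat.eq_zero_or_pos i with rfl | h
          · exact absurd hTop.zero hc.ne_root
          · exact h
        obtain ⟨i', h1, h2⟩ := hTop.par_lt i hi0 hi
        rw [hc.par_eq, ← hw] at h2
        have := hTop.inj _ _ (by omega) (by omega) h2
        omega)
      (fun c hc => by
        obtain ⟨i, hi, rfl⟩ := hTop.surj c
        rw [hmem k _ hi]
        have hcw := isChild_par hwroot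
        constructor
        · intro hik
          rcases pair_sublist_total ((T.mem_adj _ _).2 hc.1) ((T.mem_adj _ _).2 hcw.1) (by
            rw [← hw]; intro h; have := hTop.inj _ _ hi hkn h; omega) with h | h
          · exact h
          · rw [← hw] at h hc hcw
            have := hTop.sibling _ _ _ hkn hi (by rw [hw] at hcw ⊢; exact hcw) hc h
            omega
        · intro h
          rw [← hw] at h hc hcw
          exact hTop.sibling _ _ _ hi hkn hc hcw h)
      (by rw [hs'']; exact hIk)
    have hrun : (Prog.seq (.assign 5 (.get 5 (.reg 4))) <|
        .seq (.assign 6 (.get 4 (.reg 5))) p).run s' = p.run s'' := by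
      simp [Prog.run, Expr.eval, hr4, hval, hpar, hs'']
    refine ⟨?_, ?_⟩
    · simp only [Prog.Safe, Prog.run, Expr.eval, hr4, hval, State.setReg_reg,
        State.setReg_arr, if_true, hpar]
      exact ⟨by omega, by omega, by rwa [← hs'']⟩
    · rw [hrun]
      convert h2 using 1
      ext v
      obtain ⟨i, hi, rfl⟩ := hTop.surj v
      rw [hmem _ _ hi, Set.mem_insert_iff, hmem _ _ hi]
      constructor
      · intro h
        by_cases hik : i = k
        · exact Or.inl (hik ▸ hw)
        · right; omega
      · rintro (h | h)
        · rw [← hw] at h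
          have := hTop.inj _ _ hi (by omega) h
          omega
        · omega
  · convert hI using 1
    ext v
    obtain ⟨i, hi, rfl⟩ := hTop.surj v
    rw [hmem _ _ hi, Set.mem_singleton_iff, ← hTop.zero]
    constructor
    · intro h
      rw [show i = 0 by omega]
    · intro h
      have := hTop.inj _ _ hi hn h
      omega
  · refine Nat.mul_le_mul_left _ ?_
    simp only [Prog.cost, Expr.cost]
    omega
  · intro s' h
    convert h using 1
    ext v
    obtain ⟨i, hi, rfl⟩ := hTop.surj v
    rw [hmem _ _ hi]
    simpa using hi

end RAM

/-! ### Counting the leaves below and to the left of a vertex. -/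

namespace OrderedTree

variable {n : ℕ} {T : OrderedTree n}

theorem depth_lt (v : Fin n) : T.depth v < n := by
  obtain ⟨p, hp, hlen⟩ := T.isTree.connected.exists_path_of_dist T.root v
  rw [depth, ← hlen]
  simpa using hp.length_lt

/-- The leaves below `v`. -/
def leavesBelow (T : OrderedTree n) (v : Fin n) : Set (Fin n) := {l | T.IsLeaf l ∧ T.Anc v l}

/-- The leaves below the children of `v` in `S`. -/
def leavesUnder (T : OrderedTree n) (S : Set (Fin n)) (v : Fin n) : Set (Fin n) :=
  {l | T.IsLeaf l ∧ ∃ c ∈ S, T.IsChild v c ∧ T.Anc c l}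

/-- The leaves to the left of `v`. -/
def leavesLeft (T : OrderedTree n) (v : Fin n) : Set (Fin n) := {l | T.IsLeaf l ∧ T.LeftOf l v}

theorem IsLeaf.leavesBelow_eq {l : Fin n} (h : T.IsLeaf l) : T.leavesBelow l = {l} := by
  ext x
  constructor
  · exact fun hx => (h.eq_of_anc hx.2).symm
  · rintro rfl
    exact ⟨h, anc_refl _⟩

theorem leavesUnder_eq_leavesBelow {S : Set (Fin n)} {w : Fin n} (hw : ¬ T.IsLeaf w)
    (hS : ∀ c, T.IsChild w c → c ∈ S) : T.leavesUnder S w = T.leavesBelow w := by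
  ext l
  constructor
  · rintro ⟨h1, c, h2, h3, h4⟩
    exact ⟨h1, h3.anc.trans h4⟩
  · rintro ⟨h1, h2⟩
    obtain ⟨c, h3, h4⟩ := h2.exists_child fun h => hw (h ▸ h1)
    exact ⟨h1, c, hS c h3, h3, h4⟩

theorem leavesUnder_insert_of_not_isChild {S : Set (Fin n)} {v w : Fin n} (h : ¬ T.IsChild v w) :
    T.leavesUnder (insert w S) v = T.leavesUnder S v := by
  ext l
  constructor
  · rintro ⟨h1, c, rfl | h2, h3, h4⟩
    · exact absurd h3 h
    · exact ⟨h1, c, h2, h3, h4⟩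
  · rintro ⟨h1, c, h2, h3, h4⟩
    exact ⟨h1, c, Or.inr h2, h3, h4⟩

theorem ncard_leavesUnder_insert {S : Set (Fin n)} {u w : Fin n} (h : T.IsChild u w) (hw : w ∉ S) :
    (T.leavesUnder (insert w S) u).ncard =
      (T.leavesUnder S u).ncard + (T.leavesBelow w).ncard := by
  rw [← Set.ncard_union_eq _ (Set.toFinite _) (Set.toFinite _)]
  · congr 1
    ext l
    constructor
    · rintro ⟨h1, c, rfl | h2, h3, h4⟩
      · exact Or.inr ⟨h1, h4⟩
      · exact Or.inl ⟨h1, c, h2, h3, h4⟩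
    · rintro (⟨h1, c, h2, h3, h4⟩ | ⟨h1, h2⟩)
      · exact ⟨h1, c, Or.inr h2, h3, h4⟩
      · exact ⟨h1, w, Or.inl rfl, h, h2⟩
  · rw [Set.disjoint_left]
    rintro l ⟨h1, c, h2, h3, h4⟩ ⟨-, h5⟩
    exact hw (h3.eq_of_anc h h4 h5 ▸ h2)

theorem leavesUnder_of_forall_not_mem {S : Set (Fin n)} {w : Fin n}
    (h : ∀ c, T.IsChild w c → c ∉ S) : T.leavesUnder S w = ∅ := by
  ext l
  simp only [leavesUnder, Set.mem_ofPred_eq, Set.mem_empty_iff_false, iff_false]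
  rintro ⟨-, c, h1, h2, -⟩
  exact h c h2 h1

theorem disjoint_leavesLeft_leavesUnder (S : Set (Fin n)) (u : Fin n) :
    Disjoint (T.leavesLeft u) (T.leavesUnder S u) := by
  rw [Set.disjoint_left]
  rintro l ⟨-, h1⟩ ⟨-, c, -, h2, h3⟩
  exact h1.not_anc' (h2.anc.trans h3)

theorem ncard_leavesLeft_add_le (S : Set (Fin n)) (u : Fin n) :
    (T.leavesLeft u).ncard + (T.leavesUnder S u).ncard ≤ n := by
  rw [← Set.ncard_union_eq (disjoint_leavesLeft_leavesUnder S u) (Set.toFinite _) (Set.toFinite _)]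
  simpa using Set.ncard_le_card (T.leavesLeft u ∪ T.leavesUnder S u)

/-- The leaves left of `w` are those left of its parent and those below the earlier siblings, which
are the members of `S`; so ranks can be accumulated from the root downwards. -/
theorem ncard_leavesLeft_child {S : Set (Fin n)} {u w : Fin n} (h : T.IsChild u w)
    (hS : ∀ c, T.IsChild u c → (c ∈ S ↔ [c, w].Sublist (T.adj u))) :
    (T.leavesLeft w).ncard = (T.leavesLeft u).ncard + (T.leavesUnder S u).ncard := by
  rw [← Set.ncard_union_eq (disjoint_leavesLeft_leavesUnder S u) (Set.toFinite _) (Set.toFinite _)]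
  congr 1
  ext l
  constructor
  · rintro ⟨h1, h2⟩
    rcases h.leftOf_iff.1 h2 with h3 | ⟨c, h3, h4, h5⟩
    · exact Or.inl ⟨h1, h3⟩
    · exact Or.inr ⟨h1, c, (hS c h3).2 h4, h3, h5⟩
  · rintro (⟨h1, h2⟩ | ⟨h1, c, h2, h3, h4⟩)
    · exact ⟨h1, h.leftOf_iff.2 (Or.inl h2)⟩
    · exact ⟨h1, h.leftOf_iff.2 (Or.inr ⟨c, h3, (hS c h3).1 h2, h4⟩)⟩

theorem LeftOf.ncard_leavesLeft_lt {a b : Fin n} (ha : T.IsLeaf a) (h : T.LeftOf a b) :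
    (T.leavesLeft a).ncard < (T.leavesLeft b).ncard :=
  Set.ncard_lt_ncard ⟨fun _ hl => ⟨hl.1, hl.2.trans h⟩,
    fun hsub => LeftOf.irrefl a (hsub ⟨ha, h⟩).2⟩ (Set.toFinite _)

/-- The number of leaves to the left is the rank of a leaf; it grows strictly from left to right. -/
theorem IsLeaf.leftOf_iff_ncard {a b : Fin n} (ha : T.IsLeaf a) (hb : T.IsLeaf b) :
    T.LeftOf a b ↔ (T.leavesLeft a).ncard < (T.leavesLeft b).ncard := by
  refine ⟨fun h => h.ncard_leavesLeft_lt ha, fun h => ?_⟩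
  by_cases hab : a = b
  · rw [hab] at h; omega
  · refine (ha.leftOf_or_leftOf hb hab).resolve_right fun h' => ?_
    have := h'.ncard_leavesLeft_lt hb
    omega

theorem IsLeaf.eq_of_ncard_eq {a b : Fin n} (ha : T.IsLeaf a) (hb : T.IsLeaf b)
    (h : (T.leavesLeft a).ncard = (T.leavesLeft b).ncard) : a = b := by
  by_contra hab
  rcases ha.leftOf_or_leftOf hb hab with h' | h'
  · have := h'.ncard_leavesLeft_lt ha; omega
  · have := h'.ncard_leavesLeft_lt hb; omega

/-- The leaves in the order from left to right. -/
theorem exists_isLeafOrder (T : OrderedTree n) : ∃ LV : ℕ → Fin n,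
    T.IsLeafOrder {l | T.IsLeaf l}.ncard LV ∧
      ∀ i, i < {l | T.IsLeaf l}.ncard → (T.leavesLeft (LV i)).ncard = i := by
  classical
  set L : Set (Fin n) := {l | T.IsLeaf l} with hL
  have hlt : ∀ l, T.IsLeaf l → (T.leavesLeft l).ncard < L.ncard := fun l hl =>
    Set.ncard_lt_ncard ⟨fun _ h => h.1, fun hsub => LeftOf.irrefl l (hsub hl).2⟩ (Set.toFinite _)
  have himg : (fun l => (T.leavesLeft l).ncard) '' L = Set.Iio L.ncard := by
    refine Set.eq_of_subset_of_ncard_le ?_ ?_ (Set.toFinite _)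
    · rintro _ ⟨l, hl, rfl⟩
      exact hlt l hl
    · have hinj : Set.InjOn (fun l => (T.leavesLeft l).ncard) L := fun a ha b hb h =>
        IsLeaf.eq_of_ncard_eq ha hb h
      rw [hinj.ncard_image]
      simp [Set.ncard_eq_toFinset_card']
  have hsurj : ∀ i, i < L.ncard → ∃ l, T.IsLeaf l ∧ (T.leavesLeft l).ncard = i := fun i hi => by
    have : i ∈ (fun l => (T.leavesLeft l).ncard) '' L := himg ▸ hi
    obtain ⟨l, h1, h2⟩ := this
    exact ⟨l, h1, h2⟩
  let LV : ℕ → Fin n := fun i =>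
    if h : ∃ l, T.IsLeaf l ∧ (T.leavesLeft l).ncard = i then h.choose else T.root
  have hLV : ∀ i, i < L.ncard → T.IsLeaf (LV i) ∧ (T.leavesLeft (LV i)).ncard = i := fun i hi => by
    have h := hsurj i hi
    simp only [LV, dif_pos h]
    exact h.choose_spec
  have hLV' : ∀ l, T.IsLeaf l → LV (T.leavesLeft l).ncard = l := fun l hl =>
    IsLeaf.eq_of_ncard_eq (hLV _ (hlt l hl)).1 hl (hLV _ (hlt l hl)).2
  refine ⟨LV, ⟨fun i hi => (hLV i hi).1, fun l hl => ⟨_, hlt l hl, hLV' l hl⟩, ?_⟩,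
    fun i hi => (hLV i hi).2⟩
  intro i j hi hj
  rw [(hLV i hi).1.leftOf_iff_ncard (hLV j hj).1, (hLV i hi).2, (hLV j hj).2]

theorem leavesUnder_root (T : OrderedTree n) :
    T.leavesUnder {v | v ≠ T.root} T.root = {l | T.IsLeaf l} := by
  rw [leavesUnder_eq_leavesBelow (S := {v | v ≠ T.root}) (fun h => h.1 rfl) fun c hc => hc.ne_root]
  ext l
  exact ⟨fun h => h.1, fun h => ⟨h, anc_root l⟩⟩

end OrderedTree

namespace RAM

open OrderedTree

variable {n : ℕ} {T : OrderedTree n} {M W : ℕ}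

/-! ### Heights and long paths -/

/-- Update the height (array `6`) and the highest child (array `7`) of the parent. -/
def heightStep : Prog :=
  .ite (.op .lt (.get 6 (.reg 6)) (.op .add (.get 6 (.reg 5)) (.lit 1)))
    (.seq (.store 6 (.reg 6) (.op .add (.get 6 (.reg 5)) (.lit 1))) (.store 7 (.reg 6) (.reg 5)))
    .skip

/-- Heights and highest children with respect to the children in `S`. -/
structure HeightInv (T : OrderedTree n) (S : Set (Fin n)) (A : ℕ → ℕ → ℕ) : Prop where
  lt : ∀ v, ∀ c ∈ S, T.IsChild v c → A 6 c + 1 ≤ A 6 v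
  eq : ∀ v : Fin n, A 6 v = 0 ∨ ∃ c ∈ S, T.IsChild v c ∧ A 7 v = c ∧ A 6 c + 1 = A 6 v
  le : ∀ v : Fin n, A 6 v + T.depth v < n

/-- All children of a vertex report before it is treated itself. That height plus depth stays below
`n` keeps the stored heights within the word bound. -/
theorem height_spec {Q : ℕ → Fin n} {s : State} (hW : (M + 2) ^ (sweepDown heightStep).size ≤ W)
    (hs : s.Bdd M) (hQ : HasOrder T Q s) (h6 : ∀ i, s.arr 6 i = 0) :
    Runs M W (sweepDown heightStep) s ((n + 1) * (heightStep.cost + 20))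
      fun s' => HeightInv T {v | v ≠ T.root} s'.arr := by
  have hnM : n ≤ M := hQ.reg_n ▸ hs.1 0
  refine Runs.sweepDown hW hs hQ (by decide) (by decide) (HeightInv T) ?_ ?_
  · intro S w s' hs' r5 r6 _ hw hwS huS hc hI
    obtain ⟨u, hu⟩ : ∃ u, T.par w = u := ⟨_, rfl⟩
    rw [hu] at r6 huS
    have huw : T.IsChild u w := hu ▸ isChild_par hw
    have hdw := huw.depth
    have hle := hI.le w
    by_cases hlt : s'.arr 6 u < s'.arr 6 w + 1
    · have hrun : heightStep.run s' = (s'.setArr 6 u (s'.arr 6 w + 1)).setArr 7 u w := by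
        simp [heightStep, Prog.run, Expr.eval, Op.eval, r5, r6, hlt]
      refine ⟨?_, ?_⟩
      · simp [heightStep, Prog.Safe, Prog.run, Expr.eval, Op.eval, r5, r6, hlt]
        omega
      have a6 : ∀ x : Fin n, (heightStep.run s').arr 6 x =
          if x = u then s'.arr 6 w + 1 else s'.arr 6 x := fun x => by
        simp [hrun, Function.update_apply, Fin.ext_iff]
      have a7 : ∀ x : Fin n, (heightStep.run s').arr 7 x =
          if x = u then (w : ℕ) else s'.arr 7 x := fun x => by
        simp [hrun, Function.update_apply, Fin.ext_iff]
      refine ⟨?_, ?_, ?_⟩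
      · intro v c hcS hvc
        have hcu : c ≠ u := by
          rintro rfl
          rcases hcS with h | h
          · exact huw.ne h
          · exact huS h
        rw [a6, a6, if_neg hcu]
        by_cases hv : v = u
        · rw [if_pos hv]
          rcases hcS with rfl | h
          · exact le_rfl
          · have := hI.lt v c h hvc
            rw [hv] at this
            omega
        · rw [if_neg hv]
          rcases hcS with rfl | h
          · exact absurd (hvc.unique huw) hv
          · exact hI.lt v c h hvc
      · intro v
        rw [a6, a7]
        by_cases hv : v = u
        · right
          refine ⟨w, Or.inl rfl, hv ▸ huw, by simp [hv], ?_⟩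
          rw [a6, if_neg huw.ne.symm, if_pos hv]
        · simp only [if_neg hv]
          rcases hI.eq v with h | ⟨c, h1, h2, h3, h4⟩
          · exact Or.inl h
          · refine Or.inr ⟨c, Or.inr h1, h2, h3, ?_⟩
            rw [a6, if_neg (fun h : c = u => huS (h ▸ h1)), h4]
      · intro v
        rw [a6]
        split_ifs with hv
        · rw [hv]; omega
        · exact hI.le v
    · have hrun : heightStep.run s' = s' := by
        simp [heightStep, Prog.run, Expr.eval, Op.eval, r5, r6, hlt]
      refine ⟨?_, ?_⟩
      · simp [heightStep, Prog.Safe, Expr.eval, Op.eval, r5, r6, hlt]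
      rw [hrun]
      refine ⟨?_, ?_, hI.le⟩
      · rintro v c (rfl | h) hvc
        · rw [hvc.unique huw]; omega
        · exact hI.lt v c h hvc
      · intro v
        rcases hI.eq v with h | ⟨c, h1, h2⟩
        · exact Or.inl h
        · exact Or.inr ⟨c, Or.inr h1, h2⟩
  · exact ⟨fun _ _ h => h.elim, fun v => Or.inl (h6 _), fun v => by
      rw [h6]; simpa using depth_lt v⟩

theorem HeightInv.isLeaf_iff {A : ℕ → ℕ → ℕ} (h : HeightInv T {v | v ≠ T.root} A) {w : Fin n}
    (hw : w ≠ T.root) : A 6 w = 0 ↔ T.IsLeaf w := by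
  constructor
  · refine fun h0 => ⟨hw, fun c hc => ?_⟩
    have := h.lt w c hc.ne_root hc
    omega
  · intro hl
    rcases h.eq w with h0 | ⟨c, -, h1, -⟩
    · exact h0
    · exact absurd h1 (hl.2 c)

/-- Compute the end (array `10`) of the long path through the vertex. -/
def pathEndStep : Prog :=
  .ite (.get 6 (.reg 5)) (.store 10 (.reg 5) (.get 10 (.get 7 (.reg 5))))
    (.store 10 (.reg 5) (.reg 5))

/-- Compute the end of the long path through the vertex, and update the length (array `11`) of this
path. -/
def pathStep : Prog :=
  .seq pathEndStep <|
  .seq (.assign 7 (.get 10 (.reg 5))) <|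
  .ite (.op .lt (.get 11 (.reg 7)) (.op .add (.get 6 (.reg 5)) (.lit 1)))
    (.store 11 (.reg 7) (.op .add (.get 6 (.reg 5)) (.lit 1))) .skip

/-- The ends and lengths of the long paths, for the vertices in `S`, the heights being `h` and the
highest children `best`. -/
structure PathInv (h best : ℕ → ℕ) (S : Set (Fin n)) (A : ℕ → ℕ → ℕ) : Prop where
  leaf : ∀ w ∈ S, h w = 0 → A 10 w = w
  eq : ∀ w ∈ S, h w ≠ 0 → A 10 w = A 10 (best w)
  lt : ∀ w ∈ S, A 10 w < n
  le_len : ∀ w ∈ S, h w + 1 ≤ A 11 (A 10 w)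
  len_eq : ∀ x, A 11 x = 0 ∨ ∃ w ∈ S, A 10 w = x ∧ A 11 x = h w + 1

/-- The highest child is treated before `w`, so the end of its path can be copied. Array `11` keeps
the maximum of `h + 1` over the vertices with a given end, that is, the length including the edge to
the attachment. -/
theorem path_spec {Q : ℕ → Fin n} {s : State} (hW : (M + 2) ^ (sweepDown pathStep).size ≤ W)
    (hs : s.Bdd M) (hQ : HasOrder T Q s) (hH : HeightInv T {v | v ≠ T.root} s.arr)
    (h11 : ∀ i, s.arr 11 i = 0) :
    Runs M W (sweepDown pathStep) s ((n + 1) * (pathStep.cost + 20))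
      fun s' => PathInv (s.arr 6) (s.arr 7) {v | v ≠ T.root} s'.arr := by
  have hnM : n ≤ M := hQ.reg_n ▸ hs.1 0
  refine Runs.sweepDown hW hs hQ (by decide) (by decide) (PathInv (s.arr 6) (s.arr 7)) ?_ ?_
  · intro S w s' hs' r5 r6 ha hw hwS huS hc hI
    have e6 : s'.arr 6 = s.arr 6 := ha 6 (by decide)
    have e7 : s'.arr 7 = s.arr 7 := ha 7 (by decide)
    have hle := hH.le w
    obtain ⟨x, hx, hxn⟩ : ∃ x : ℕ, x = (if s.arr 6 w = 0 then (w : ℕ) else s'.arr 10 (s.arr 7 w)) ∧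
        x < n := by
      refine ⟨_, rfl, ?_⟩
      split_ifs with h0
      · exact w.2
      · obtain ⟨c, h1, h2, h3, h4⟩ := (hH.eq w).resolve_left h0
        rw [h3]
        exact hI.lt c (hc c h2)
    have hend : pathEndStep.run s' = s'.setArr 10 w x := by
      rw [hx]
      split_ifs with h0 <;> simp [pathEndStep, Prog.run, Expr.eval, r5, e6, e7, h0]
    have hend' : pathEndStep.Safe M s' := by
      have h1 := hs'.2 10 (s.arr 7 w)
      by_cases h0 : s.arr 6 w = 0 <;>
        simp [pathEndStep, Prog.Safe, Expr.eval, r5, e6, e7, h0] <;> omega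
    have hrun : pathStep.run s' = (if s'.arr 11 x < s.arr 6 w + 1 then
        ((s'.setArr 10 w x).setReg 7 x).setArr 11 x (s.arr 6 w + 1) else
        (s'.setArr 10 w x).setReg 7 x) := by
      rw [pathStep, Prog.run, hend]
      by_cases h1 : s'.arr 11 x < s.arr 6 w + 1 <;>
        simp [Prog.run, Expr.eval, Op.eval, r5, e6, h1]
    refine ⟨?_, ?_⟩
    · refine ⟨hend', ?_⟩
      rw [hend]
      by_cases h1 : s'.arr 11 x < s.arr 6 w + 1 <;>
        simp [Prog.Safe, Prog.run, Expr.eval, Op.eval, r5, e6, h1] <;> omega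
    have a10 : ∀ y : ℕ, (pathStep.run s').arr 10 y = if y = w then x else s'.arr 10 y := fun y => by
      rw [hrun]; split_ifs <;> simp_all
    have a11 : ∀ y : ℕ, (pathStep.run s').arr 11 y =
        if y = x then max (s'.arr 11 x) (s.arr 6 w + 1) else s'.arr 11 y := fun y => by
      rw [hrun]
      split_ifs with h1 h2 h2
      · simp [h2]; omega
      · simp [h2]
      · simp [h2]; omega
      · simp
    generalize pathStep.run s' = s'' at a10 a11
    have hne : ∀ v ∈ S, (v : ℕ) ≠ w := fun v hv h => hwS (Fin.ext h ▸ hv)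
    refine ⟨?_, ?_, ?_, ?_, ?_⟩
    · rintro v (rfl | hv) hl
      · rw [a10, if_pos rfl, hx, if_pos hl]
      · rw [a10, if_neg (hne v hv), hI.leaf v hv hl]
    · rintro v hv hl
      obtain ⟨c, -, h2, h3, -⟩ := (hH.eq v).resolve_left hl
      have hcw : (c : ℕ) ≠ w := by
        intro h
        rw [Fin.ext h] at h2
        rcases hv with rfl | hv
        · exact h2.ne rfl
        · exact huS (h2.par_eq ▸ hv)
      rw [h3, a10, a10, if_neg hcw]
      rcases hv with rfl | hv
      · rw [if_pos rfl, hx, if_neg hl, h3]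
      · rw [if_neg (hne v hv), hI.eq v hv hl, h3]
    · rintro v (rfl | hv)
      · rw [a10, if_pos rfl]; exact hxn
      · rw [a10, if_neg (hne v hv)]; exact hI.lt v hv
    · rintro v (rfl | hv)
      · rw [a10, if_pos rfl, a11, if_pos rfl]; exact le_max_right _ _
      · rw [a10, if_neg (hne v hv), a11]
        have := hI.le_len v hv
        split_ifs with h
        · rw [h] at this; omega
        · exact this
    · intro y
      rw [a11]
      by_cases hy : y = x
      · right
        rw [if_pos hy]
        rcases le_total (s'.arr 11 x) (s.arr 6 w + 1) with h | h
        · exact ⟨w, Or.inl rfl, by rw [a10, if_pos rfl, hy], max_eq_right h⟩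
        · rcases hI.len_eq x with h0 | ⟨v, h1, h2, h3⟩
          · omega
          · exact ⟨v, Or.inr h1, by rw [a10, if_neg (hne v h1), h2, hy], by
              rw [max_eq_left h, h3]⟩
      · rw [if_neg hy]
        rcases hI.len_eq y with h0 | ⟨v, h1, h2, h3⟩
        · exact Or.inl h0
        · exact Or.inr ⟨v, Or.inr h1, by rw [a10, if_neg (hne v h1), h2], h3⟩
  · exact ⟨fun _ h => h.elim, fun _ h => h.elim, fun _ h => h.elim, fun _ h => h.elim,
      fun x => Or.inl (h11 x)⟩

theorem PathInv.isLongPathData {A B : ℕ → ℕ → ℕ} (hH : HeightInv T {v | v ≠ T.root} A)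
    (hP : PathInv (A 6) (A 7) {v | v ≠ T.root} B) : ∃ lf : Fin n → Fin n,
    (∀ v, v ≠ T.root → B 10 v = lf v) ∧
      T.IsLongPathData (fun v => A 6 v) lf fun v => B 11 v := by
  classical
  -- The paths are indexed by vertices other than the root; at the root `lf` has a default value.
  let lf : Fin n → Fin n := fun v => if h : v = T.root then T.root else ⟨B 10 v, hP.lt v h⟩
  have hlf : ∀ v, v ≠ T.root → B 10 v = lf v := fun v hv => by simp [lf, hv]
  refine ⟨lf, hlf, ?_, ?_, ?_, ?_⟩
  · exact fun u w _ h => hH.lt u w h.ne_root h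
  · intro w hw hl
    have h0 : A 6 w ≠ 0 := fun h => hl ((hH.isLeaf_iff hw).1 h)
    obtain ⟨c, h1, h2, h3, h4⟩ := (hH.eq w).resolve_left h0
    refine ⟨c, h2, h4, Fin.ext ?_⟩
    rw [← hlf w hw, ← hlf c h1, hP.eq w hw h0, h3]
  · intro l hl
    have h0 := (hH.isLeaf_iff hl.1).2 hl
    exact ⟨h0, Fin.ext (by rw [← hlf l hl.1, hP.leaf l hl.1 h0])⟩
  · intro l hl
    have h0 := (hH.isLeaf_iff hl.1).2 hl
    have hle := hP.le_len l hl.1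
    rw [hP.leaf l hl.1 h0] at hle
    obtain ⟨w, h1, h2, h3⟩ := (hP.len_eq l).resolve_left (by omega)
    refine ⟨w, h1, Fin.ext (by rw [← hlf w h1, h2]), h3, fun x hx hxl => ?_⟩
    have := hP.le_len x hx
    rw [hlf x hx, hxl, h3] at this
    omega

end RAM

namespace RAM

open OrderedTree

variable {n : ℕ} {T : OrderedTree n} {M W : ℕ}

/-! ### The order of the leaves -/

/-- Add the number of leaves below the vertex (array `8`) to that of its parent. -/
def countStep : Prog :=
  .seq (.ite (.get 6 (.reg 5)) .skip (.store 8 (.reg 5) (.lit 1))) <|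
  .store 8 (.reg 6) (.op .add (.get 8 (.reg 6)) (.get 8 (.reg 5)))

/-- The numbers of leaves below the vertices in `S`, and under children in `S`. -/
structure CountInv (T : OrderedTree n) (S : Set (Fin n)) (A : ℕ → ℕ → ℕ) : Prop where
  below : ∀ v ∈ S, A 8 v = (T.leavesBelow v).ncard
  under : ∀ v, v ∉ S → A 8 v = (T.leavesUnder S v).ncard

theorem ncard_le (S : Set (Fin n)) : S.ncard ≤ n := by simpa using Set.ncard_le_card S

theorem count_spec {Q : ℕ → Fin n} {s : State} (hW : (M + 2) ^ (sweepDown countStep).size ≤ W)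
    (hs : s.Bdd M) (hQ : HasOrder T Q s) (hleaf : ∀ w, w ≠ T.root → (s.arr 6 w = 0 ↔ T.IsLeaf w))
    (h8 : ∀ i, s.arr 8 i = 0) :
    Runs M W (sweepDown countStep) s ((n + 1) * (countStep.cost + 20))
      fun s' => CountInv T {v | v ≠ T.root} s'.arr := by
  have hnM : n ≤ M := hQ.reg_n ▸ hs.1 0
  refine Runs.sweepDown hW hs hQ (by decide) (by decide) (CountInv T) ?_ ?_
  · intro S w s' hs' r5 r6 ha hw hwS huS hc hI
    obtain ⟨u, hu⟩ : ∃ u, T.par w = u := ⟨_, rfl⟩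
    rw [hu] at r6 huS
    have huw : T.IsChild u w := hu ▸ isChild_par hw
    have hne : (u : ℕ) ≠ w := fun h => huw.ne (Fin.ext h)
    have e6 : s'.arr 6 = s.arr 6 := ha 6 (by decide)
    have hn : 0 < n := T.root.pos
    have hin := ncard_leavesUnder_insert huw hwS
    have hb := ncard_le (T.leavesUnder (insert w S) u)
    have eu := hI.under u huS
    -- A leaf has received nothing from children and is set to `1` first.
    have hww : (if s.arr 6 w = 0 then 1 else s'.arr 8 w) = (T.leavesBelow w).ncard := by
      split_ifs with h0
      · rw [((hleaf w hw).1 h0).leavesBelow_eq, Set.ncard_singleton]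
      · rw [hI.under w hwS,
          leavesUnder_eq_leavesBelow (fun h => h0 ((hleaf w hw).2 h)) hc]
    have a8 : ∀ x : Fin n, (countStep.run s').arr 8 x =
        if x = u then (T.leavesUnder (insert w S) u).ncard else
        if x = w then (T.leavesBelow w).ncard else s'.arr 8 x := fun x => by
      rw [hin, ← eu, ← hww]
      by_cases h0 : s.arr 6 w = 0 <;>
        simp [countStep, Prog.run, Expr.eval, Op.eval, r5, r6, e6, h0, Function.update_apply,
          Fin.ext_iff, hne]
      split_ifs <;> simp_all
    refine ⟨?_, ?_, ?_⟩
    · by_cases h0 : s.arr 6 w = 0 <;> simp only [h0, if_true, if_false] at hww <;>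
        simp [countStep, Prog.Safe, Prog.run, Expr.eval, Op.eval, r5, r6, e6, h0, hne] <;> omega
    · rintro v hv
      have hvu : v ≠ u := by
        rintro rfl
        rcases hv with h | h
        · exact huw.ne h
        · exact huS h
      rw [a8, if_neg hvu]
      rcases hv with rfl | hv
      · rw [if_pos rfl]
      · rw [if_neg (fun h : v = w => hwS (h ▸ hv)), hI.below v hv]
    · intro v hv
      rw [Set.mem_insert_iff, not_or] at hv
      rw [a8, if_neg hv.1]
      by_cases hvu : v = u
      · rw [if_pos hvu, hvu]
      · rw [if_neg hvu, leavesUnder_insert_of_not_isChild fun h => hvu (h.unique huw),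
          hI.under v hv.2]
  · refine ⟨fun _ h => h.elim, fun v _ => ?_⟩
    rw [leavesUnder_of_forall_not_mem fun _ _ h => h.elim, Set.ncard_empty, h8]

/-- Compute the number of leaves to the left of the vertex in array `9`, to which the numbers of
leaves below its children will be added, and put a leaf in its place in array `12`. -/
def rankStep : Prog :=
  .seq (.store 9 (.reg 5) (.get 9 (.reg 6))) <|
  .seq (.store 9 (.reg 6) (.op .add (.get 9 (.reg 6)) (.get 8 (.reg 5)))) <|
  .ite (.get 6 (.reg 5)) .skip (.store 12 (.get 9 (.reg 5)) (.reg 5))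

/-- The numbers of leaves to the left of the vertices in `S`, and the order of the leaves. -/
structure RankInv (T : OrderedTree n) (S : Set (Fin n)) (A : ℕ → ℕ → ℕ) : Prop where
  off : ∀ v ∈ S, A 9 v = (T.leavesLeft v).ncard + (T.leavesUnder S v).ncard
  leaf : ∀ l ∈ S, T.IsLeaf l → A 12 (T.leavesLeft l).ncard = l

/-- At a treated vertex array `9` holds the rank at which its next child starts: the child reads it
and then adds its own number of leaves. -/
theorem rank_spec {Q : ℕ → Fin n} {s : State} (hW : (M + 2) ^ (sweepUp rankStep).size ≤ W)
    (hs : s.Bdd M) (hQ : HasOrder T Q s) (hleaf : ∀ w, w ≠ T.root → (s.arr 6 w = 0 ↔ T.IsLeaf w))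
    (h8 : ∀ v, v ≠ T.root → s.arr 8 v = (T.leavesBelow v).ncard)
    (h9 : ∀ i, s.arr 9 i = 0) :
    Runs M W (sweepUp rankStep) s ((n + 1) * (rankStep.cost + 20))
      fun s' => RankInv T Set.univ s'.arr := by
  have hnM : n ≤ M := hQ.reg_n ▸ hs.1 0
  refine Runs.sweepUp hW hs hQ (by decide) (by decide) (RankInv T) ?_ ?_
  · intro S w s' hs' r5 r6 ha _ hw hwS huS hc hsib hI
    obtain ⟨u, hu⟩ : ∃ u, T.par w = u := ⟨_, rfl⟩
    rw [hu] at r6 huS hsib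
    have huw : T.IsChild u w := hu ▸ isChild_par hw
    have hne : (u : ℕ) ≠ w := fun h => huw.ne (Fin.ext h)
    have e6 : s'.arr 6 = s.arr 6 := ha 6 (by decide)
    have e8 : s'.arr 8 = s.arr 8 := ha 8 (by decide)
    have hin := ncard_leavesUnder_insert huw hwS
    have hb := ncard_leavesLeft_add_le (T := T) (insert w S) u
    have hrank := ncard_leavesLeft_child huw hsib
    have eu := hI.off u huS
    have e8w := h8 w hw
    have hrun : rankStep.run s' = (if s.arr 6 w = 0 then
        (((s'.setArr 9 w (T.leavesLeft w).ncard).setArr 9 u ((T.leavesLeft u).ncard +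
          (T.leavesUnder (insert w S) u).ncard)).setArr 12 (T.leavesLeft w).ncard w) else
        ((s'.setArr 9 w (T.leavesLeft w).ncard).setArr 9 u ((T.leavesLeft u).ncard +
          (T.leavesUnder (insert w S) u).ncard))) := by
      by_cases h0 : s.arr 6 w = 0 <;>
        simp [rankStep, Prog.run, Expr.eval, Op.eval, r5, r6, e6, e8, h0, hne, hne.symm, hin, hrank,
          eu, e8w, add_assoc]
    refine ⟨?_, ?_⟩
    · by_cases h0 : s.arr 6 w = 0 <;>
        simp [rankStep, Prog.Safe, Prog.run, Expr.eval, Op.eval, r5, r6, e6, e8, h0, hne,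
          eu, e8w] <;> omega
    have a9 : ∀ x : Fin n, (rankStep.run s').arr 9 x = if x = u then
        ((T.leavesLeft u).ncard + (T.leavesUnder (insert w S) u).ncard) else
        if x = w then (T.leavesLeft w).ncard else s'.arr 9 x := fun x => by
      rw [hrun]
      by_cases h0 : s.arr 6 w = 0 <;> simp [h0, Function.update_apply, Fin.ext_iff]
    have a12 : ∀ y : ℕ, (rankStep.run s').arr 12 y =
        if y = (T.leavesLeft w).ncard ∧ s.arr 6 w = 0 then (w : ℕ) else s'.arr 12 y := fun y => by
      rw [hrun]
      by_cases h0 : s.arr 6 w = 0 <;> simp [h0, Function.update_apply]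
    generalize rankStep.run s' = s'' at a9 a12
    refine ⟨?_, ?_⟩
    · intro v hv
      rw [a9]
      by_cases hvu : v = u
      · rw [if_pos hvu, hvu]
      rw [if_neg hvu, leavesUnder_insert_of_not_isChild fun h => hvu (h.unique huw)]
      rcases hv with rfl | hv
      · rw [if_pos rfl, leavesUnder_of_forall_not_mem hc, Set.ncard_empty, add_zero]
      · rw [if_neg (fun h : v = w => hwS (h ▸ hv)), hI.off v hv]
    · intro l hl hleafl
      rw [a12]
      split_ifs with h
      · rw [hleafl.eq_of_ncard_eq ((hleaf w hw).1 h.2) h.1]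
      · refine hI.leaf l (hl.resolve_left ?_) hleafl
        rintro rfl
        exact h ⟨rfl, (hleaf l hw).2 hleafl⟩
  · refine ⟨fun v hv => ?_, fun l hl hleafl => absurd hl hleafl.1⟩
    obtain rfl : v = T.root := hv
    rw [leavesUnder_of_forall_not_mem (S := {T.root}) fun c hc h => hc.ne_root h, h9]
    have : T.leavesLeft T.root = ∅ := by
      ext l
      exact ⟨fun h => (h.2.not_anc' (anc_root l)).elim, fun h => h.elim⟩
    rw [this, Set.ncard_empty]

end RAM

/-- The number of nodes of depth less than `j` in the complete `c`-ary tree. -/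
def heapOff (c : ℕ) : ℕ → ℕ
  | 0 => 0
  | j + 1 => heapOff c j * c + 1

/-- The defining recursion matches the parent map `k ↦ (k - 1) / c`; this form shows that level `j`
has `c ^ j` nodes. -/
theorem heapOff_succ' (c j : ℕ) : heapOff c (j + 1) = heapOff c j + c ^ j := by
  induction j with
  | zero => simp [heapOff]
  | succ j ih =>
    have h : heapOff c (j + 2) = heapOff c (j + 1) * c + 1 := rfl
    rw [h, ih, add_mul, pow_succ, add_right_comm, ← heapOff, ih]

theorem heapOff_le (c : ℕ) (hc : 2 ≤ c) (j : ℕ) : heapOff c j < c ^ j := by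
  induction j with
  | zero => simp [heapOff]
  | succ j ih => rw [heapOff, pow_succ]; nlinarith

theorem heapOff_mono (c : ℕ) : Monotone (heapOff c) :=
  monotone_nat_of_le_succ fun j => by rw [heapOff_succ']; exact Nat.le_add_right _ _

/-- The nodes of the complete `c`-ary tree are numbered level by level. -/
theorem exists_heapOff_add (c : ℕ) (hc : 0 < c) (k : ℕ) : ∃ j i, i < c ^ j ∧ heapOff c j + i = k := by
  induction k using Nat.strong_induction_on with
  | _ k ih =>
    rcases Nat.eq_zero_or_pos k with rfl | hk
    · exact ⟨0, 0, by simp, rfl⟩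
    · obtain ⟨j, i, h1, h2⟩ := ih ((k - 1) / c) ((Nat.div_le_self _ _).trans_lt (by omega))
      have hm := Nat.mod_lt (k - 1) hc
      have hdm := Nat.div_add_mod (k - 1) c
      refine ⟨j + 1, i * c + (k - 1) % c, ?_, ?_⟩
      · rw [pow_succ]; nlinarith
      · rw [← h2] at hdm
        rw [heapOff]
        have : c * (heapOff c j + i) = heapOff c j * c + i * c := by ring
        omega

/-! ### Powers and the table of strides. -/

namespace RAM

open OrderedTree

variable {n f : ℕ} {M W : ℕ}

/-- Put `(f + 1) ^ K` into register `9`, where `K` is the rounded logarithm of `n`, the previous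
power into register `11`, and the sum of the smaller powers into register `10`. -/
def powerStep : Prog :=
  .seq (.assign 11 (.reg 9)) <|
  .seq (.assign 9 (.op .mul (.reg 9) (.op .add (.reg 2) (.lit 1)))) <|
  .assign 10 (.op .add (.op .mul (.reg 10) (.op .add (.reg 2) (.lit 1))) (.lit 1))

def power : Prog :=
  .seq (.seq (.assign 9 (.lit 1)) <| .seq (.assign 10 (.lit 0)) (.assign 11 (.lit 1))) <|
  .loop (.op .lt (.reg 9) (.reg 0)) powerStep

/-- The loop stops at the least power of `f + 1` that is at least `n`, and its exponent is `Nat.clog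
(f + 1) n`. -/
theorem power_spec {s : State} (hf : 0 < f) (hn : 0 < n) (hM : (f + 1) * n ≤ M)
    (hW : (M + 2) ^ power.size ≤ W) (hs : s.Bdd M) (h0 : s.reg 0 = n) (h2 : s.reg 2 = f) :
    Runs M W power s (100 * (n + 1)) fun s' =>
      s'.reg 9 = (f + 1) ^ Nat.clog (f + 1) n ∧ s'.reg 10 = heapOff (f + 1) (Nat.clog (f + 1) n) ∧
      s'.reg 11 = (f + 1) ^ (Nat.clog (f + 1) n - 1) := by
  have hnM : n ≤ M := h0 ▸ hs.1 0
  let Inv : ℕ → State → Prop := fun k s => ∃ j, s.reg 0 = n ∧ s.reg 2 = f ∧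
    s.reg 9 = (f + 1) ^ j ∧ s.reg 10 = heapOff (f + 1) j ∧ s.reg 11 = (f + 1) ^ (j - 1) ∧
    (j = 0 ∨ (f + 1) ^ (j - 1) < n) ∧ k = n - (f + 1) ^ j
  refine Runs.mono (t := (Prog.seq (.assign 9 (.lit 1)) <| .seq (.assign 10 (.lit 0))
    (.assign 11 (.lit 1))).cost + (n - 1 + 1) * (powerStep.cost +
    (Expr.op .lt (.reg 9) (.reg 0)).cost + 1)) (Runs.seq (P := Inv (n - 1)) ?_
    fun s' hs' hI _ _ => ?_) ?_ fun _ h => h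
  · refine Runs.of_run hs ((Nat.pow_le_pow_right (by omega) (by simp [power, Prog.size])).trans hW)
      ?_ ?_
    · simp [Prog.Safe, Expr.eval]; omega
    · exact ⟨0, h0, h2, by simp [Prog.run, Expr.eval], by simp [Prog.run, Expr.eval, heapOff],
        by simp [Prog.run, Expr.eval], Or.inl rfl, by simp⟩
  · refine (Runs.loop ((Nat.pow_le_pow_right (by omega) (by simp [power, Prog.size])).trans hW)
      Inv ?_ hs' hI).mono le_rfl ?_
    · rintro k s hs ⟨j, r0, r2, r9, r10, r11, hj, hk⟩ he
      have hlt : (f + 1) ^ j < n := by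
        by_contra hcon
        simp [Expr.eval, Op.eval, r9, r0, hcon] at he
      have hle : (f + 1) ^ (j + 1) ≤ M := by
        rw [pow_succ]; nlinarith
      have hgt : (f + 1) ^ j < (f + 1) ^ (j + 1) := Nat.pow_lt_pow_right (by omega) (by omega)
      have hoff := heapOff_le (f + 1) (by omega) (j + 1)
      have hrun : powerStep.run s = ((s.setReg 11 ((f + 1) ^ j)).setReg 9 ((f + 1) ^ (j + 1))).setReg
          10 (heapOff (f + 1) (j + 1)) := by
        simp [powerStep, Prog.run, Expr.eval, Op.eval, r9, r10, r2, heapOff, pow_succ]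
      refine ⟨?_, n - (f + 1) ^ (j + 1), by omega, j + 1, ?_⟩
      · rw [heapOff] at hoff
        rw [pow_succ] at hle hoff hgt
        simp [powerStep, Prog.Safe, Prog.run, Expr.eval, Op.eval, r9, r10, r2]
        omega
      · rw [hrun]
        exact ⟨r0, r2, by simp, by simp, by simp, Or.inr (by simpa using hlt), rfl⟩
    · rintro s'' ⟨⟨k, j, r0, r2, r9, r10, r11, hj, hk⟩, he⟩
      have hle : n ≤ (f + 1) ^ j := by
        by_contra hcon
        simp [Expr.eval, Op.eval, r9, r0, show (f + 1) ^ j < n by omega] at he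
      have hK : Nat.clog (f + 1) n = j := by
        refine le_antisymm (Nat.clog_le_of_le_pow hle) ?_
        rcases hj with rfl | hj
        · exact Nat.zero_le _
        · have := (Nat.lt_clog_iff_pow_lt (by omega)).2 hj
          omega
      rw [hK]
      exact ⟨r9, r10, r11⟩
  · simp [powerStep, Prog.cost, Expr.cost]
    omega

/-- Array `13` becomes the table of the strides of the paths of all lengths. -/
def strideStep : Prog :=
  .ite (.op .mul (.op .lt (.reg 7) (.reg 11))
      (.op .lt (.op .mul (.op .sub (.reg 0) (.lit 1)) (.reg 7))
        (.op .add (.op .mul (.reg 4) (.reg 11)) (.lit 1))))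
    (.assign 7 (.op .mul (.reg 7) (.op .add (.reg 2) (.lit 1))))
    (.seq (.store 13 (.reg 4) (.reg 7)) (.assign 4 (.op .add (.reg 4) (.lit 1))))

def stride : Prog :=
  .seq (.seq (.assign 4 (.lit 1)) (.assign 7 (.lit 1))) <|
  .loop (.op .lt (.reg 4) (.reg 0)) strideStep

/-- The level `j` never rises as the length `L` grows, so two pointers suffice: each step lowers `j`
or raises `L`, and `n - L + j` decreases. -/
theorem stride_spec {s : State} (hf : 0 < f) (hn : 0 < n)
    (hM : (f + 1) ^ Nat.clog (f + 1) n ≤ M)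
    (hW : (M + 2) ^ stride.size ≤ W) (hs : s.Bdd M) (h0 : s.reg 0 = n) (h2 : s.reg 2 = f)
    (h11 : s.reg 11 = (f + 1) ^ (Nat.clog (f + 1) n - 1)) :
    Runs M W stride s (200 * (n + 1)) fun s' =>
      ∀ m, 1 ≤ m → m < n → IsStride n (f + 1) m (s'.arr 13 m) := by
  have hnM : n ≤ M := h0 ▸ hs.1 0
  obtain ⟨c, hc⟩ : ∃ c, f + 1 = c := ⟨_, rfl⟩
  rw [hc] at hM h11 ⊢
  obtain ⟨K, hK⟩ : ∃ K, Nat.clog c n = K := ⟨_, rfl⟩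
  have hKn : K ≤ n := hK ▸ Nat.clog_le_of_le_pow (Nat.lt_pow_self (by omega)).le
  have hnK : n ≤ c ^ K := hK ▸ Nat.le_pow_clog (by omega) n
  have hK1 : 1 < n → 1 ≤ K := fun h => by rw [← hK]; exact Nat.clog_pos (by omega) h
  rw [hK] at hM h11
  have hc0 : 0 < c := by omega
  let Inv : ℕ → State → Prop := fun k s => ∃ L j, s.reg 0 = n ∧ s.reg 2 = f ∧
    s.reg 11 = c ^ (K - 1) ∧ s.reg 4 = L ∧ s.reg 7 = c ^ (K - j) ∧ 1 ≤ L ∧ L ≤ n ∧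
    (1 < n → 1 ≤ j) ∧ j ≤ K ∧ n - 1 ≤ L * c ^ j ∧
    (∀ m, 1 ≤ m → m < L → IsStride n c m (s.arr 13 m)) ∧ k = n - L + j
  refine Runs.mono (t := (Prog.seq (.assign 4 (.lit 1)) (.assign 7 (.lit 1))).cost +
    (n - 1 + K + 1) * (strideStep.cost +
    (Expr.op .lt (.reg 4) (.reg 0)).cost + 1)) (Runs.seq (P := Inv (n - 1 + K)) ?_
    fun s' hs' hI _ _ => ?_) ?_ fun _ h => h
  · refine Runs.of_run hs ((Nat.pow_le_pow_right (by omega) (by simp [stride, Prog.size])).trans hW)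
      ?_ ?_
    · simp [Prog.Safe, Expr.eval]; omega
    · exact ⟨1, K, h0, h2, h11, by simp [Prog.run, Expr.eval], by simp [Prog.run, Expr.eval], le_rfl,
        hn, hK1, le_rfl, by omega, fun m h1 h2 => by omega, rfl⟩
  · refine (Runs.loop ((Nat.pow_le_pow_right (by omega) (by simp [stride, Prog.size])).trans hW)
      Inv ?_ hs' hI).mono le_rfl ?_
    · rintro k s hs ⟨L, j, r0, r2, r11, r4, r7, hL1, hLn, hj1, hjK, hLj, hT, hk⟩ he
      have hlt : L < n := by
        by_contra hcon
        simp [Expr.eval, Op.eval, r4, r0, hcon] at he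
      have hj1 := hj1 (by omega)
      have hpK : c ^ (K - j) * c ^ (j - 1) = c ^ (K - 1) := by
        rw [← pow_add]; congr 1; omega
      -- The program knows only `c ^ (K - j)` and `c ^ (K - 1)`. It tests `1 < j` by comparing these
      -- powers, and the second condition after multiplication by `c ^ (K - j)`.
      by_cases hcond : 1 < j ∧ n - 1 ≤ L * c ^ (j - 1)
      · have c1 : c ^ (K - j) < c ^ (K - 1) := Nat.pow_lt_pow_right (by omega) (by omega)
        have c2 : (n - 1) * c ^ (K - j) < L * c ^ (K - 1) + 1 := by
          rw [← hpK]
          have := Nat.mul_le_mul_left (c ^ (K - j)) hcond.2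
          nlinarith
        have e : c ^ (K - j) * c = c ^ (K - (j - 1)) := by
          rw [← pow_succ]; congr 1; omega
        have hle : c ^ (K - (j - 1)) ≤ c ^ K := Nat.pow_le_pow_right hc0 (by omega)
        have hrun : strideStep.run s = s.setReg 7 (c ^ (K - (j - 1))) := by
          simp [strideStep, Prog.run, Expr.eval, Op.eval, r0, r4, r7, r11, r2, c1, c2, hc, e]
        refine ⟨?_, k - 1, by omega, L, j - 1, ?_⟩
        · simp [strideStep, Prog.Safe, Expr.eval, Op.eval, r0, r4, r7, r11, r2, c1, c2, hc, e]
          omega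
        · rw [hrun]
          exact ⟨r0, r2, r11, r4, by simp, hL1, hLn, fun _ => by omega, by omega, hcond.2, hT,
            by omega⟩
      · have c1 : ¬ (c ^ (K - j) < c ^ (K - 1) ∧ (n - 1) * c ^ (K - j) < L * c ^ (K - 1) + 1) := by
          rintro ⟨h1, h2⟩
          have h3 := (Nat.pow_lt_pow_iff_right (by omega)).1 h1
          refine hcond ⟨by omega, ?_⟩
          rw [← hpK] at h2
          refine Nat.le_of_mul_le_mul_left (c := c ^ (K - j)) ?_ (Nat.pow_pos hc0)
          nlinarith
        have hz : Op.mul.eval (Op.lt.eval (c ^ (K - j)) (c ^ (K - 1)))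
            (Op.lt.eval ((n - 1) * c ^ (K - j)) (L * c ^ (K - 1) + 1)) = 0 := by
          rw [not_and_or] at c1
          rcases c1 with h | h <;> simp [Op.eval, h]
        have hz' : (Expr.op .mul (.op .lt (.reg 7) (.reg 11))
            (.op .lt (.op .mul (.op .sub (.reg 0) (.lit 1)) (.reg 7))
            (.op .add (.op .mul (.reg 4) (.reg 11)) (.lit 1)))).eval s = 0 := by
          simp only [Expr.eval, r0, r4, r7, r11]
          exact hz
        have hle : c ^ (K - j) ≤ c ^ K := Nat.pow_le_pow_right hc0 (by omega)
        have hrun : strideStep.run s = (s.setArr 13 L (c ^ (K - j))).setReg 4 (L + 1) := by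
          simp only [strideStep, Prog.run, hz', if_true]
          simp [Expr.eval, Op.eval, r4, r7]
        refine ⟨?_, k - 1, by omega, L + 1, j, ?_⟩
        · simp only [strideStep, Prog.Safe, hz', if_true]
          simp [Prog.run, Expr.eval, Op.eval, r4, r7]
          omega
        · rw [hrun]
          refine ⟨r0, r2, r11, by simp, r7, by omega, hlt, fun _ => hj1, hjK,
            hLj.trans (Nat.mul_le_mul_right _ (by omega)), ?_, by omega⟩
          intro m h1 h2
          by_cases hm : m = L
          · refine ⟨j, hj1, by rw [hK]; exact hjK, hm ▸ hLj, fun h => ?_, by simp [hm, hK]⟩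
            rw [hm]
            by_contra hcon
            exact hcond ⟨h, by omega⟩
          · have := hT m h1 (by omega)
            simpa [hm] using this
    · rintro s'' ⟨⟨k, L, j, r0, r2, r11, r4, r7, hL1, hLn, hj1, hjK, hLj, hT, hk⟩, he⟩
      have : L = n := by
        by_contra hcon
        simp [Expr.eval, Op.eval, r4, r0, show L < n by omega] at he
      exact this ▸ hT
  · simp [strideStep, Prog.cost, Expr.cost]
    omega

end RAM

namespace RAM

open OrderedTree

variable {n f d K : ℕ} {M W : ℕ}

/-! ### The table of the vectors -/

/-- Compute the pair of vectors of a node from that of its parent, for a first child, or from that of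
its previous sibling. -/
def vectorNode : Prog :=
  .seq (.assign 5 (.op .div (.op .sub (.reg 4) (.lit 1)) (.op .add (.reg 2) (.lit 1)))) <|
  .seq (.assign 6 (.op .mul (.reg 3) (.get 18 (.reg 5)))) <|
  .ite (.op .eq (.op .mul (.reg 5) (.op .add (.reg 2) (.lit 1))) (.op .sub (.reg 4) (.lit 1)))
    (.seq (.assign 7 (.op .div (.op .sub (.reg 6) (.get 16 (.reg 5))) (.get 14 (.reg 5)))) <|
     .seq (.store 14 (.reg 4) (.get 14 (.reg 5))) <|
     .seq (.store 15 (.reg 4) (.get 15 (.reg 5))) <|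
     .seq (.store 16 (.reg 4) (.op .add (.get 16 (.reg 5)) (.op .mul (.reg 7) (.get 14 (.reg 5)))))
      (.store 17 (.reg 4) (.op .add (.get 17 (.reg 5)) (.op .mul (.reg 7) (.get 15 (.reg 5))))))
    (.seq (.assign 5 (.op .sub (.reg 4) (.lit 1))) <|
     .seq (.assign 7 (.op .div (.op .add (.reg 6) (.get 14 (.reg 5))) (.get 16 (.reg 5)))) <|
     .seq (.store 14 (.reg 4) (.get 16 (.reg 5))) <|
     .seq (.store 15 (.reg 4) (.get 17 (.reg 5))) <|
     .seq (.store 16 (.reg 4) (.op .sub (.op .mul (.reg 7) (.get 16 (.reg 5))) (.get 14 (.reg 5))))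
      (.store 17 (.reg 4) (.op .sub (.op .mul (.reg 7) (.get 17 (.reg 5))) (.get 15 (.reg 5)))))

/-- Compute the pair of vectors of a node and its order. -/
def vectorStep : Prog := .seq vectorNode (.store 18 (.reg 4) (.reg 6))

/-- Compute the pairs of neighbouring vectors in arrays `14`, …, `17`, and their orders in array
`18`, for the nodes of the complete tree of depth `K`. -/
def vectors : Prog :=
  .seq (.seq (.store 14 (.lit 0) (.lit 1)) <| .seq (.store 16 (.lit 0) (.lit 1)) <|
    .seq (.store 17 (.lit 0) (.lit 1)) <| .seq (.store 18 (.lit 0) (.lit 1)) <|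
    .assign 12 (.op .add (.reg 10) (.reg 9))) <|
  .seq (forLoop 1 12 vectorStep) <|
  .seq (.store 14 (.reg 12) (.lit 1)) (.store 15 (.reg 12) (.lit 1))

/-- The pair of vectors stored at index `r`. -/
def vecPair (A : ℕ → ℕ → ℕ) (r : ℕ) : (ℕ × ℕ) × (ℕ × ℕ) := ((A 14 r, A 15 r), (A 16 r, A 17 r))

/-- A first child refines the pair of its parent to the new order. The other children, treated in
`vectorStep_next`, continue from node `r - 1`, which is their left sibling. -/
theorem vectorStep_first {s : State} {r q c N : ℕ} {p : (ℕ × ℕ) × (ℕ × ℕ)} (h4 : s.reg 4 = r)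
    (h2 : s.reg 2 + 1 = c) (hq : (r - 1) / c = q) (hqc : q * c = r - 1) (hqr : q < r)
    (hN : s.reg 3 * s.arr 18 q = N) (hp : fareyRefine N (vecPair s.arr q) = p) (hrM : r ≤ M)
    (hNM : N ≤ M) (h11 : p.1.1 ≤ M) (h12 : p.1.2 ≤ M) (h21 : p.2.1 ≤ M) (h22 : p.2.2 ≤ M) :
    vectorStep.Safe M s ∧ ∀ k,
      vecPair (vectorStep.run s).arr k = (if k = r then p else vecPair s.arr k) ∧
      (vectorStep.run s).arr 18 k = if k = r then N else s.arr 18 k := by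
  have hne : q ≠ r := hqr.ne
  have hdiv := Nat.div_le_self (N - s.arr 16 q) (s.arr 14 q)
  subst hp
  simp only [fareyRefine, vecPair] at h11 h12 h21 h22
  constructor
  · simp [vectorStep, vectorNode, Prog.Safe, Prog.run, Expr.eval, Op.eval, h4, h2, hq, hqc, hN, hne]
    omega
  · intro k
    by_cases hk : k = r <;>
      simp [vectorStep, vectorNode, Prog.run, Expr.eval, Op.eval, h4, h2, hq, hqc, hN, hne, hk,
        fareyRefine, vecPair]

theorem vectorStep_next {s : State} {r q c N : ℕ} {p : (ℕ × ℕ) × (ℕ × ℕ)} (h4 : s.reg 4 = r)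
    (h2 : s.reg 2 + 1 = c) (hq : (r - 1) / c = q) (hqc : q * c ≠ r - 1) (hr : 0 < r)
    (hN : s.reg 3 * s.arr 18 q = N) (hp : fareyNext N (vecPair s.arr (r - 1)) = p) (hrM : r ≤ M)
    (hNM : N ≤ M) (hNM' : N + s.arr 14 (r - 1) ≤ M)
    (h11 : p.1.1 ≤ M) (h12 : p.1.2 ≤ M) (h21 : p.2.1 ≤ M) (h22 : p.2.2 ≤ M) :
    vectorStep.Safe M s ∧ ∀ k,
      vecPair (vectorStep.run s).arr k = (if k = r then p else vecPair s.arr k) ∧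
      (vectorStep.run s).arr 18 k = if k = r then N else s.arr 18 k := by
  have hne : r - 1 ≠ r := by omega
  have hdiv := Nat.div_le_self (N + s.arr 14 (r - 1)) (s.arr 16 (r - 1))
  have hdiv2 := Nat.div_le_self (r - 1) c
  subst hp
  simp only [fareyNext, vecPair] at h11 h12 h21 h22
  constructor
  · simp [vectorStep, vectorNode, Prog.Safe, Prog.run, Expr.eval, Op.eval, h4, h2, hq, hqc, hN, hne]
    omega
  · intro k
    by_cases hk : k = r <;>
      simp [vectorStep, vectorNode, Prog.run, Expr.eval, Op.eval, h4, h2, hq, hqc, hN, hne, hk,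
        fareyNext, vecPair]

/-- The pairs of vectors of the nodes below `r` have been computed. -/
def VecInv (c d r : ℕ) (A : ℕ → ℕ → ℕ) : Prop :=
  ∀ j i, i < c ^ j → heapOff c j + i < r →
    vecPair A (heapOff c j + i) = gapPair c d j i ∧ A 18 (heapOff c j + i) = d ^ j

/-- In the numbering by levels the parent of `r` is `(r - 1) / c`, and `r` is a first child exactly
if the division leaves no remainder. -/
theorem vectorStep_spec (hv : ValidPair f d) {s : State} {r : ℕ} (hr : 1 ≤ r)
    (hrK : r < heapOff (f + 1) (K + 1)) (hrM : heapOff (f + 1) (K + 1) ≤ M) (hdM : 2 * d ^ K ≤ M)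
    (h4 : s.reg 4 = r) (h2 : s.reg 2 = f) (h3 : s.reg 3 = d) (hI : VecInv (f + 1) d r s.arr) :
    vectorStep.Safe M s ∧ VecInv (f + 1) d (r + 1) (vectorStep.run s).arr := by
  obtain ⟨c, hc⟩ : ∃ c, f + 1 = c := ⟨_, rfl⟩
  have hspec : ∀ j {i}, i < c ^ j → IsFareyPair (d ^ j) (gapPair c d j i) ∧
      (gapPair c d j i).2.2 ≤ (gapPair c d j i).2.1 := fun j {i} hi => by
    subst hc; exact gapPair_spec hv j hi
  rw [hc] at hrK hrM hI ⊢
  have hc0 : 0 < c := by omega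
  have hd0 : 0 < d := hv.2.1
  have key : ∀ j i, i < c ^ j → heapOff c j + i = r → vectorStep.Safe M s ∧ ∀ k,
      vecPair (vectorStep.run s).arr k = (if k = r then gapPair c d j i else vecPair s.arr k) ∧
      (vectorStep.run s).arr 18 k = if k = r then d ^ j else s.arr 18 k := by
    intro j i hi hji
    obtain ⟨j, rfl⟩ : ∃ j', j = j' + 1 := by
      cases j with
      | zero => simp [heapOff] at hi hji; omega
      | succ j => exact ⟨j, rfl⟩
    have hjK : j + 1 ≤ K := by
      by_contra hcon
      have := heapOff_mono c (show K + 1 ≤ j + 1 by omega)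
      omega
    have hdj : d ^ (j + 1) ≤ d ^ K := Nat.pow_le_pow_right hd0 hjK
    obtain ⟨H, H'⟩ := hspec (j + 1) hi
    have e1 := H.fst_le
    have e2 := H.fst_le'
    have e3 := H.snd_lt_fst H'
    have hoff : heapOff c (j + 1) = heapOff c j * c + 1 := rfl
    have hq : (r - 1) / c = heapOff c j + i / c := by
      rw [← hji, hoff, show heapOff c j * c + 1 + i - 1 = i + heapOff c j * c by omega,
        Nat.add_mul_div_right _ _ hc0, add_comm]
    have hqi : i / c < c ^ j := by
      rw [Nat.div_lt_iff_lt_mul hc0, ← pow_succ]; exact hi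
    have hqr : heapOff c j + i / c < r := by
      rw [← hq]; exact (Nat.div_le_self _ _).trans_lt (by omega)
    obtain ⟨g1, g2⟩ := hI j (i / c) hqi hqr
    have hN : s.reg 3 * s.arr 18 (heapOff c j + i / c) = d ^ (j + 1) := by
      rw [h3, g2, pow_succ, mul_comm]
    have hmul : (heapOff c j + i / c) * c + i % c = r - 1 := by
      rw [add_mul, mul_comm (i / c), add_assoc, Nat.div_add_mod, ← hji, hoff]; omega
    rcases Nat.eq_zero_or_pos (i % c) with hm | hm
    · refine vectorStep_first (c := c) h4 (by rw [h2, hc]) hq (by omega) hqr hN ?_ (by omega)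
        (by omega) (by omega) (by omega) (by omega) (by omega)
      rw [g1, gapPair, hm]
      rfl
    · have hi1 : i - 1 = c * (i / c) + (i % c - 1) := by
        have := Nat.div_add_mod i c; omega
      have hprev : gapPair c d (j + 1) (i - 1) =
          fareyIter (d ^ (j + 1)) (gapPair c d j (i / c)) (i % c - 1) := by
        rw [hi1]
        exact gapPair_mul_add c d j _ _ (by have := Nat.mod_lt i hc0; omega)
      obtain ⟨k1, -⟩ := hI (j + 1) (i - 1) (by omega) (by
        have := Nat.mod_le i c; omega)
      rw [show heapOff c (j + 1) + (i - 1) = r - 1 by have := Nat.mod_le i c; omega] at k1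
      have k2 : s.arr 14 (r - 1) ≤ d ^ (j + 1) := by
        have := (hspec (j + 1) (i := i - 1) (by omega)).1.fst_le
        rwa [← k1] at this
      refine vectorStep_next (c := c) h4 (by rw [h2, hc]) hq (by omega) hr hN ?_ (by omega)
        (by omega) (by omega) (by omega) (by omega) (by omega) (by omega)
      rw [k1, hprev, ← fareyIter_succ, gapPair, Nat.sub_add_cancel hm]
  refine ⟨?_, ?_⟩
  · obtain ⟨j, i, h5, h6⟩ := exists_heapOff_add c hc0 r
    exact (key j i h5 h6).1
  · intro j i hi hlt
    by_cases h : heapOff c j + i = r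
    · have := (key j i hi h).2 r
      rw [h]
      simpa using this
    · obtain ⟨j', i', h5, h6⟩ := exists_heapOff_add c hc0 r
      have := (key j' i' h5 h6).2 (heapOff c j + i)
      rw [if_neg h, if_neg h] at this
      rw [this.1, this.2]
      exact hI j i hi (by omega)

/-- The tree has fewer than `2 * (f + 1) ^ K` nodes, which for `K = Nat.clog (f + 1) n` is linear in
`n` by `pow_clog_le`. -/
theorem vectors_spec (hv : ValidPair f d) {s : State} (hM : heapOff (f + 1) (K + 1) ≤ M)
    (hdM : 2 * d ^ K ≤ M) (hW : (M + 2) ^ vectors.size ≤ W) (hs : s.Bdd M) (h2 : s.reg 2 = f)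
    (h3 : s.reg 3 = d) (h9 : s.reg 9 = (f + 1) ^ K) (h10 : s.reg 10 = heapOff (f + 1) K)
    (h15 : ∀ i, s.arr 15 i = 0) :
    Runs M W vectors s (200 * (heapOff (f + 1) (K + 1) + 1)) fun s' =>
      ∀ i, i ≤ (f + 1) ^ K → (s'.arr 14 (heapOff (f + 1) K + i),
        s'.arr 15 (heapOff (f + 1) K + i)) = gapVec (f + 1) d K i := by
  have hX : 0 < M + 2 := by omega
  have hoff := heapOff_succ' (f + 1) K
  have hpos : 0 < (f + 1) ^ K := Nat.pow_pos (by omega)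
  let P : State → Prop := fun s' => s'.reg 12 = heapOff (f + 1) (K + 1) ∧ VecInv (f + 1) d 1 s'.arr
  let P' : State → Prop := fun s' => s'.reg 12 = heapOff (f + 1) (K + 1) ∧
    VecInv (f + 1) d (heapOff (f + 1) (K + 1)) s'.arr
  refine Runs.mono (t := 16 + ((heapOff (f + 1) (K + 1) + 1) * (vectorStep.cost + 10) + 6))
    (Runs.seq (P := P) ?_ fun s₁ hs₁ hP _ hr₁ => Runs.seq (P := P') ?_ fun s₂ hs₂ hP' _ _ => ?_)
    ?_ fun _ h => h
  · refine Runs.of_run hs ((Nat.pow_le_pow_right hX (by simp [vectors, Prog.size])).trans hW) ?_ ?_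
    · simp [Prog.Safe, Prog.run, Expr.eval, Op.eval, h9, h10]; omega
    · refine ⟨by simp [Prog.run, Expr.eval, Op.eval, h9, h10, hoff], ?_⟩
      intro j i hi hlt
      obtain ⟨h5, rfl⟩ : heapOff (f + 1) j = 0 ∧ i = 0 := by omega
      cases j with
      | zero => simp [vecPair, gapPair, Prog.run, Expr.eval, heapOff, h15]
      | succ j => simp [heapOff] at h5
  · have r2 : s₁.reg 2 = f := by rw [hr₁ 2 (by decide), h2]
    have r3 : s₁.reg 3 = d := by rw [hr₁ 3 (by decide), h3]
    refine Runs.forLoop ((Nat.pow_le_pow_right hX (by simp [vectors, Prog.size]; omega)).trans hW)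
      hs₁ hP.1 (by omega) (by decide) (by decide) (by decide)
      (fun k s => s.reg 12 = heapOff (f + 1) (K + 1) ∧ VecInv (f + 1) d k s.arr)
      (fun _ _ _ h => h) ?_ hP
    intro k s' hs' hk hkN hr4 harr hreg hI
    obtain ⟨h5, h6⟩ := vectorStep_spec hv hk hkN hM hdM hr4
      (by rw [hreg 2 (by decide) (by decide), r2]) (by rw [hreg 3 (by decide) (by decide), r3]) hI.2
    exact ⟨h5, by rw [h5.run_reg (by decide), hI.1], h6⟩
  · refine Runs.of_run hs₂ ((Nat.pow_le_pow_right hX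
      (by simp [vectors, Prog.size]; omega)).trans hW) ?_ ?_
    · simp [Prog.Safe, Expr.eval]; omega
    · intro i hi
      unfold gapVec
      -- This index is one past the last node; `(1, 1)` is stored there separately.
      by_cases h : i = (f + 1) ^ K
      · rw [if_pos h, h, ← hoff, ← hP'.1]
        simp [Prog.run, Expr.eval]
      · rw [if_neg h, ← (hP'.2 K i (by omega) (by omega)).1]
        have hne : heapOff (f + 1) K + i ≠ heapOff (f + 1) (K + 1) := by omega
        simp [Prog.run, Expr.eval, hP'.1, hne, vecPair]
  · have : vectorStep.cost + 10 ≤ 150 := by decide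
    nlinarith

end RAM

namespace RAM

open OrderedTree

variable {n f d K : ℕ} {T : OrderedTree n} {M W : ℕ}

/-! ### The indices of the vectors and the positions of the vertices -/

/-- Move to the next multiple of the stride of the path, and store it in array `19`. -/
def indexStep : Prog :=
  .seq (.assign 5 (.get 12 (.reg 4))) <|
  .seq (.assign 6 (.get 13 (.get 11 (.reg 5)))) <|
  .seq (.assign 7 (.op .mul (.op .add (.op .div (.reg 7) (.reg 6)) (.lit 1)) (.reg 6))) <|
  .store 19 (.reg 5) (.reg 7)

def index : Prog :=
  .seq (.seq (.assign 12 (.get 8 (.reg 1))) (.assign 7 (.lit 0))) (forLoop 0 12 indexStep)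

/-- The assignment is mere arithmetic on indices: register `7` holds the last index used, and no
slopes are compared. -/
theorem index_spec {s : State} {t : ℕ} {LV : ℕ → Fin n} {str : ℕ → ℕ}
    (hW : (M + 2) ^ index.size ≤ W) (hs : s.Bdd M) (hnM : n ≤ M) (ht : s.arr 8 (s.reg 1) = t)
    (htn : t ≤ n) (hinj : ∀ i j, i < t → j < t → LV i = LV j → i = j)
    (h12 : ∀ i, i < t → s.arr 12 i = LV i)
    (hstr : ∀ i, i < t → s.arr 13 (s.arr 11 (LV i)) = str i)
    (hM : ∀ i, i < t → multipleSeq str (i + 1) ≤ M) :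
    Runs M W index s (100 * (n + 1)) fun s' =>
      ∀ i, i < t → s'.arr 19 (LV i) = multipleSeq str (i + 1) := by
  have hX : 0 < M + 2 := by omega
  refine Runs.mono (t := 5 + (t + 1) * (indexStep.cost + 10))
    (Runs.seq (P := fun s' => s'.reg 12 = t ∧ s'.reg 7 = 0) ?_
      fun s₁ hs₁ hP ha₁ _ => ?_) ?_ fun _ h => h
  · refine Runs.of_run hs ((Nat.pow_le_pow_right hX (by simp [index, Prog.size])).trans hW) ?_ ?_
    · simp [Prog.Safe, Expr.eval, ht]; omega
    · simp [Prog.run, Expr.eval, ht]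
  · refine (Runs.forLoop ((Nat.pow_le_pow_right hX (by simp [index, Prog.size])).trans hW) hs₁ hP.1
      (Nat.zero_le _) (by decide) (by decide) (by decide)
      (fun k s => s.reg 7 = multipleSeq str k ∧
        ∀ i, i < k → s.arr 19 (LV i) = multipleSeq str (i + 1))
      (fun _ _ _ h => h) ?_ ⟨hP.2, fun i hi => absurd hi (Nat.not_lt_zero i)⟩).mono le_rfl
      fun _ h => h.2
    intro k s' hs' _ hk r4 harr hreg hI
    have e12 : s'.arr 12 k = LV k := by rw [harr 12 (by decide), ha₁ 12 (by decide), h12 k hk]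
    have estr : s'.arr 13 (s'.arr 11 (LV k)) = str k := by
      rw [harr 13 (by decide), harr 11 (by decide), ha₁ 13 (by decide), ha₁ 11 (by decide), hstr k hk]
    have hle := hM k hk
    have hstM : str k ≤ M := estr ▸ hs'.2 13 _
    have hrun : indexStep.run s' = (((s'.setReg 5 (LV k)).setReg 6 (str k)).setReg 7
        (multipleSeq str (k + 1))).setArr 19 (LV k) (multipleSeq str (k + 1)) := by
      simp [indexStep, Prog.run, Expr.eval, Op.eval, r4, e12, estr, hI.1, multipleSeq]
    refine ⟨?_, ?_⟩
    · rw [multipleSeq] at hle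
      simp [indexStep, Prog.Safe, Prog.run, Expr.eval, Op.eval, r4, e12, estr, hI.1]
      omega
    · rw [hrun]
      refine ⟨by simp, fun i hi => ?_⟩
      by_cases hik : i = k
      · simp [hik]
      · have hne : (LV i : ℕ) ≠ LV k := fun h => hik (hinj i k (by omega) hk (Fin.ext h))
        rw [← hI.2 i (by omega)]
        simp [hne]
  · have h1 : indexStep.cost + 10 ≤ 50 := by decide
    nlinarith

/-- Compute the coordinates of a vertex. -/
def drawStep : Prog :=
  .seq (.assign 7 (.op .add (.reg 10) (.get 19 (.get 10 (.reg 5))))) <|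
  .seq (.store 2 (.reg 5) (.op .add (.get 2 (.reg 6)) (.get 14 (.reg 7)))) <|
  .store 3 (.reg 5) (.op .add (.get 3 (.reg 6)) (.get 15 (.reg 7)))

/-- The intended coordinates `x`, `y` are taken from a drawing known to exist, so that its grid
bound keeps the words small during the sweep. -/
theorem draw_spec {Q : ℕ → Fin n} {s : State} {x y : Fin n → ℕ} {r : Fin n → ℕ}
    (hW : (M + 2) ^ (sweepUp drawStep).size ≤ W) (hs : s.Bdd M) (hQ : HasOrder T Q s)
    (h2 : ∀ i, s.arr 2 i = 0) (h3 : ∀ i, s.arr 3 i = 0) (hx0 : x T.root = 0) (hy0 : y T.root = 0)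
    (hr : ∀ v, v ≠ T.root → s.reg 10 + s.arr 19 (s.arr 10 v) = r v ∧ r v ≤ M)
    (hx : ∀ v, v ≠ T.root → x v = x (T.par v) + s.arr 14 (r v))
    (hy : ∀ v, v ≠ T.root → y v = y (T.par v) + s.arr 15 (r v))
    (hxM : ∀ v, x v ≤ M) (hyM : ∀ v, y v ≤ M) :
    Runs M W (sweepUp drawStep) s ((n + 1) * (drawStep.cost + 20))
      fun s' => ∀ v : Fin n, s'.arr 2 v = x v ∧ s'.arr 3 v = y v := by
  refine (Runs.sweepUp hW hs hQ (by decide) (by decide)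
    (fun S A => ∀ v ∈ S, A 2 (v : Fin n) = x v ∧ A 3 v = y v) ?_ ?_).mono le_rfl
    fun s' h v => h v (Set.mem_univ v)
  · intro S w s' hs' r5 r6 ha hreg hw hwS huS _ _ hI
    obtain ⟨u, hu⟩ : ∃ u, T.par w = u := ⟨_, rfl⟩
    have hxw := hx w hw
    have hyw := hy w hw
    rw [hu] at r6 huS hxw hyw
    obtain ⟨e1, e2⟩ := hr w hw
    have e1' : s'.reg 10 + s'.arr 19 (s'.arr 10 w) = r w := by
      rw [hreg 10 (by decide) (by decide), ha 19 (by decide), ha 10 (by decide), e1]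
    have e14 : s'.arr 14 = s.arr 14 := ha 14 (by decide)
    have e15 : s'.arr 15 = s.arr 15 := ha 15 (by decide)
    obtain ⟨e3, e4⟩ := hI u huS
    have hrun : drawStep.run s' = ((s'.setReg 7 (r w)).setArr 2 w (x w)).setArr 3 w (y w) := by
      simp [drawStep, Prog.run, Expr.eval, Op.eval, r5, r6, e1', e14, e15, e3, e4, hxw, hyw]
    refine ⟨?_, ?_⟩
    · have h5 := hxM w
      have h6 := hyM w
      simp [drawStep, Prog.Safe, Prog.run, Expr.eval, Op.eval, r5, r6, e1', e14, e15, e3, e4]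
      omega
    · rw [hrun]
      rintro v (rfl | hv)
      · simp
      · have hne : (v : ℕ) ≠ w := fun h => hwS (Fin.ext h ▸ hv)
        simpa [hne] using hI v hv
  · intro v hv
    obtain rfl : v = T.root := hv
    rw [h2, h3, hx0, hy0]
    exact ⟨rfl, rfl⟩

/-! ### The whole program -/

/-- The part of the program that treats the tree. -/
def treeProg : Prog :=
  .seq bfs <| .seq (sweepDown heightStep) <| .seq (sweepDown pathStep) <|
  .seq (sweepDown countStep) (sweepUp rankStep)

theorem treeProg_spec (hM : 2 * n + 2 ≤ M) (hW : (M + 2) ^ treeProg.size ≤ W) {s : State}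
    (hs : s.Bdd M) (hT : HasTree T s) (hz : ∀ a i, 2 ≤ a → s.arr a i = 0) :
    Runs M W treeProg s (1000 * (n + 1)) fun s' => ∃ (Q : ℕ → Fin n) (h : Fin n → ℕ)
      (lf : Fin n → Fin n) (LV : ℕ → Fin n), HasOrder T Q s' ∧
      T.IsLongPathData h lf (fun v => s'.arr 11 v) ∧
      T.IsLeafOrder (s'.arr 8 T.root) LV ∧ s'.arr 8 T.root ≤ n ∧
      (∀ i, i < s'.arr 8 T.root → s'.arr 12 i = LV i) ∧
      ∀ v, v ≠ T.root → s'.arr 10 v = lf v := by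
  have hX : 0 < M + 2 := by omega
  have hW' : ∀ p : Prog, p.size ≤ treeProg.size → (M + 2) ^ p.size ≤ W := fun p hp =>
    (Nat.pow_le_pow_right hX hp).trans hW
  refine Runs.mono (Runs.seq (bfs_spec hM (hW' _ (by simp [treeProg, Prog.size])) hs hT)
    fun s₁ hs₁ h₁ ha₁ hr₁ => Runs.seq (P := fun s' => HeightInv T {v | v ≠ T.root} s'.arr)
      (t₁ := (n + 1) * (heightStep.cost + 20)) (t₂ := (n + 1) * (pathStep.cost + 20) +
      ((n + 1) * (countStep.cost + 20) + (n + 1) * (rankStep.cost + 20))) ?_ ?_) ?_ fun _ h => h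
  · obtain ⟨Q, hQ, hq, hp⟩ := h₁
    exact height_spec (hW' _ (by simp [treeProg, Prog.size]; omega)) hs₁
      ⟨hQ, by rw [hr₁ 0 (by decide), hT.reg_n], hq, hp⟩
      fun i => by rw [ha₁ 6 (by decide), hz _ _ (by decide)]
  · obtain ⟨Q, hQ, hq, hp⟩ := h₁
    have hO₁ : HasOrder T Q s₁ := ⟨hQ, by rw [hr₁ 0 (by decide), hT.reg_n], hq, hp⟩
    intro s₂ hs₂ h₂ ha₂ hr₂
    have hO₂ : HasOrder T Q s₂ := hO₁.congr (hr₂ 0 (by decide)) (ha₂ 4 (by decide))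
      (ha₂ 5 (by decide))
    refine Runs.seq (path_spec (hW' _ (by simp [treeProg, Prog.size]; omega)) hs₂ hO₂ h₂
      fun i => by rw [ha₂ 11 (by decide), ha₁ 11 (by decide), hz _ _ (by decide)]) ?_
    intro s₃ hs₃ h₃ ha₃ hr₃
    have hO₃ : HasOrder T Q s₃ := hO₂.congr (hr₃ 0 (by decide)) (ha₃ 4 (by decide))
      (ha₃ 5 (by decide))
    have hleaf₃ : ∀ w, w ≠ T.root → (s₃.arr 6 w = 0 ↔ T.IsLeaf w) := fun w hw => by
      rw [ha₃ 6 (by decide)]; exact h₂.isLeaf_iff hw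
    refine Runs.seq (count_spec (hW' _ (by simp [treeProg, Prog.size]; omega)) hs₃ hO₃ hleaf₃
      fun i => by rw [ha₃ 8 (by decide), ha₂ 8 (by decide), ha₁ 8 (by decide), hz _ _ (by decide)]) ?_
    intro s₄ hs₄ h₄ ha₄ hr₄
    have hO₄ : HasOrder T Q s₄ := hO₃.congr (hr₄ 0 (by decide)) (ha₄ 4 (by decide))
      (ha₄ 5 (by decide))
    obtain ⟨lf, hlf, hdata⟩ := h₃.isLongPathData h₂
    obtain ⟨LV, hLV, hLV'⟩ := T.exists_isLeafOrder
    have h8 : s₄.arr 8 T.root = {l | T.IsLeaf l}.ncard := by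
      rw [h₄.under T.root fun h => h rfl, leavesUnder_root]
    obtain ⟨τ, s₅, hex, h6, h7, h9⟩ := rank_spec (hW' _ (by simp [treeProg, Prog.size]; omega)) hs₄ hO₄
      (fun w hw => by rw [ha₄ 6 (by decide)]; exact hleaf₃ w hw) h₄.below
      fun i => by
        rw [ha₄ 9 (by decide), ha₃ 9 (by decide), ha₂ 9 (by decide), ha₁ 9 (by decide),
          hz _ _ (by decide)]
    have ha₅ : ∀ a, a ∉ (sweepUp rankStep).arrays → s₅.arr a = s₄.arr a := fun a h => hex.arr_eq h
    have hr₅ : ∀ a, a ∉ (sweepUp rankStep).regs → s₅.reg a = s₄.reg a := fun a h => hex.reg_eq h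
    refine ⟨τ, s₅, hex, h6, h7, Q, fun v => s₂.arr 6 v, lf, LV, hO₄.congr (hr₅ 0 (by decide)) (ha₅ 4 (by decide))
      (ha₅ 5 (by decide)), ?_, ?_, ?_, ?_, ?_⟩
    · rw [ha₅ 11 (by decide), ha₄ 11 (by decide)]
      exact hdata
    · rw [ha₅ 8 (by decide), h8]
      exact hLV
    · rw [ha₅ 8 (by decide), h8]
      exact ncard_le _
    · intro i hi
      rw [ha₅ 8 (by decide), h8] at hi
      have h10 := hLV.isLeaf i hi
      have h11 := h9.leaf _ (Set.mem_univ _) h10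
      rwa [hLV' i hi] at h11
    · intro v hv
      rw [ha₅ 10 (by decide), ha₄ 10 (by decide), hlf v hv]
  · have h1 : heightStep.cost + 20 + (pathStep.cost + 20) + (countStep.cost + 20) +
      (rankStep.cost + 20) ≤ 800 := by decide
    nlinarith

end RAM

/-- The previous power is still smaller than `n`. -/
theorem pow_clog_le {c n : ℕ} (hc : 2 ≤ c) (hn : 0 < n) : c ^ Nat.clog c n ≤ c * n := by
  rcases Nat.lt_or_ge 1 n with h | h
  · have h1 := Nat.pow_pred_clog_lt_self (by omega : 1 < c) h
    have h2 := Nat.clog_pos (by omega : 1 < c) h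
    obtain ⟨k, hk⟩ : ∃ k, Nat.clog c n = k + 1 := ⟨Nat.clog c n - 1, by omega⟩
    rw [hk] at h1 ⊢
    rw [pow_succ, mul_comm]
    exact Nat.mul_le_mul_left _ h1.le
  · obtain rfl : n = 1 := by omega
    simp
    omega

namespace RAM

open OrderedTree

variable {n f d : ℕ} {T : OrderedTree n} {M W : ℕ}

/-- The part of the program that computes the vectors and the drawing. -/
def drawProg : Prog :=
  .seq power <| .seq stride <| .seq vectors <| .seq index (sweepUp drawStep)

/-- Here the grid bound becomes a bound on words; the denominator `f + 1 - d` is at least `1` and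
can be dropped. -/
theorem exists_nat_drawing {B : PathDecomposition T} {a : Fin B.t → ℕ × ℕ} (hd : 0 < d)
    (hdf : d ≤ f) (hB : B.IsLengthDecreasing) {R : ℕ → Finset (ℕ × ℕ)}
    (hR : IsVectorFamily f d (Nat.clog (f + 1) n) R) (ha : IsAssignment B (f + 1) R a) :
    ∃ x y : Fin n → ℕ, IsDrawnBy B a (fun v => ((x v : ℤ), (y v : ℤ))) ∧
      ∀ v, x v ≤ (f + 1) * d * n ∧ y v ≤ (f + 1) * d * n := by
  obtain ⟨pos, hpos⟩ := B.exists_isDrawnBy a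
  obtain ⟨I, hI, hgrid⟩ := B.exists_isOnGrid hd hdf hB hR ha hpos
  have hI' : I ≤ (f + 1) * d * n := by
    have h1 : (1 : ℝ) ≤ (f : ℝ) + 1 - d := by
      have : (d : ℝ) ≤ f := by exact_mod_cast hdf
      linarith
    have h2 : ((f : ℝ) + 1) * (d : ℝ) / (((f : ℝ) + 1) - (d : ℝ)) ≤ ((f : ℝ) + 1) * d :=
      div_le_self (by positivity) h1
    have h3 : (I : ℝ) ≤ ((f : ℝ) + 1) * d * n :=
      hI.trans (mul_le_mul_of_nonneg_right h2 (by positivity))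
    exact_mod_cast h3
  refine ⟨fun v => (pos v).1.toNat, fun v => (pos v).2.toNat, ?_, fun v => ?_⟩
  · convert hpos using 1
    funext v
    obtain ⟨h1, -, h2, -⟩ := hgrid v
    exact Prod.ext (Int.toNat_of_nonneg h1) (Int.toNat_of_nonneg h2)
  · obtain ⟨h1, h2, h3, h4⟩ := hgrid v
    constructor <;> dsimp only <;> omega

/-- Strides looked up by path length satisfy `IsStride`, so `IsLongPathData.optimalDraw` yields a
decomposition, a family and an assignment with exactly the vectors used by the program; the
coordinates agree by the recursion over parents. -/
theorem drawProg_spec (hv : ValidPair f d) (hM : 4 * (f + 1) * (d + 1) * n ≤ M)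
    (hW : (M + 2) ^ drawProg.size ≤ W) {s : State} (hs : s.Bdd M) {Q : ℕ → Fin n}
    {h : Fin n → ℕ} {lf : Fin n → Fin n} {LV : ℕ → Fin n} (hQ : HasOrder T Q s)
    (hH : T.IsLongPathData h lf fun v => s.arr 11 v) (hLV : T.IsLeafOrder (s.arr 8 T.root) LV)
    (htn : s.arr 8 T.root ≤ n) (h12 : ∀ i, i < s.arr 8 T.root → s.arr 12 i = LV i)
    (h10 : ∀ v, v ≠ T.root → s.arr 10 v = lf v) (h1 : s.reg 1 = T.root) (h2 : s.reg 2 = f)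
    (h3 : s.reg 3 = d) (a2 : ∀ i, s.arr 2 i = 0) (a3 : ∀ i, s.arr 3 i = 0)
    (a15 : ∀ i, s.arr 15 i = 0) :
    Runs M W drawProg s (2000 * (f + 1) * (n + 1)) fun s' => OptimalDraw T f d (output n s') := by
  have hX : 0 < M + 2 := by omega
  have hn : 0 < n := T.root.pos
  have hf : 0 < f := hv.1
  have hd : 0 < d := hv.2.1
  have hdf : d ≤ f := hv.2.2.1
  have hW' : ∀ p : Prog, p.size ≤ drawProg.size → (M + 2) ^ p.size ≤ W := fun p hp =>
    (Nat.pow_le_pow_right hX hp).trans hW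
  obtain ⟨K, hK⟩ : ∃ K, Nat.clog (f + 1) n = K := ⟨_, rfl⟩
  have hpow : (f + 1) ^ K ≤ (f + 1) * n := hK ▸ pow_clog_le (by omega) hn
  have hoff := heapOff_le (f + 1) (by omega) K
  have hoff' := heapOff_succ' (f + 1) K
  have hdK : d ^ K ≤ (f + 1) ^ K := Nat.pow_le_pow_left (by omega) K
  -- Of the bound on `M`, the part `4 (f + 1) n` covers the tables and twice the entries of the
  -- vectors, and `(f + 1) d n` covers the coordinates.
  have hM1 : 4 * ((f + 1) * n) ≤ M := by
    refine le_trans ?_ hM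
    rw [show 4 * (f + 1) * (d + 1) * n = 4 * ((f + 1) * n) * (d + 1) by ring]
    exact Nat.le_mul_of_pos_right _ (by omega)
  have hM2 : (f + 1) * d * n ≤ M := by
    refine le_trans ?_ hM
    rw [show 4 * (f + 1) * (d + 1) * n = (f + 1) * d * n + ((f + 1) * n * (3 * d + 4)) by ring]
    exact Nat.le_add_right _ _
  have hnM : n ≤ M := hQ.reg_n ▸ hs.1 0
  set t := s.arr 8 T.root with ht
  refine Runs.mono (Runs.seq (power_spec hf hn (by omega) (hW' _ (by simp [drawProg, Prog.size]))
    hs hQ.reg_n h2) fun s₁ hs₁ h₁ ha₁ hr₁ => Runs.seq (P := fun s' =>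
      ∀ m, 1 ≤ m → m < n → IsStride n (f + 1) m (s'.arr 13 m)) (t₁ := 200 * (n + 1))
      (t₂ := 200 * (heapOff (f + 1) (K + 1) + 1) + (100 * (n + 1) + (n + 1) * (drawStep.cost + 20)))
      ?_ fun s₂ hs₂ h₂ ha₂ hr₂ => ?_) ?_ fun _ h => h
  · exact stride_spec hf hn (by rw [hK]; omega) (hW' _ (by simp [drawProg, Prog.size]; omega)) hs₁
      (by rw [hr₁ 0 (by decide), hQ.reg_n]) (by rw [hr₁ 2 (by decide), h2]) h₁.2.2
  · rw [hK] at h₁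
    have r9 : s₂.reg 9 = (f + 1) ^ K := by rw [hr₂ 9 (by decide), h₁.1]
    have r10 : s₂.reg 10 = heapOff (f + 1) K := by rw [hr₂ 10 (by decide), h₁.2.1]
    refine Runs.seq (vectors_spec hv (K := K) (by omega) (by omega)
      (hW' _ (by simp [drawProg, Prog.size]; omega)) hs₂
      (by rw [hr₂ 2 (by decide), hr₁ 2 (by decide), h2])
      (by rw [hr₂ 3 (by decide), hr₁ 3 (by decide), h3]) r9 r10
      fun i => by rw [ha₂ 15 (by decide), ha₁ 15 (by decide), a15]) ?_
    intro s₃ hs₃ h₃ ha₃ hr₃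
    have e8 : s₃.arr 8 = s.arr 8 := by rw [ha₃ 8 (by decide), ha₂ 8 (by decide), ha₁ 8 (by decide)]
    have e11 : s₃.arr 11 = s.arr 11 := by
      rw [ha₃ 11 (by decide), ha₂ 11 (by decide), ha₁ 11 (by decide)]
    have e12 : s₃.arr 12 = s.arr 12 := by
      rw [ha₃ 12 (by decide), ha₂ 12 (by decide), ha₁ 12 (by decide)]
    have e10 : s₃.arr 10 = s.arr 10 := by
      rw [ha₃ 10 (by decide), ha₂ 10 (by decide), ha₁ 10 (by decide)]
    have e1 : s₃.reg 1 = T.root := by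
      rw [hr₃ 1 (by decide), hr₂ 1 (by decide), hr₁ 1 (by decide), h1]
    let str : ℕ → ℕ := fun i => s₃.arr 13 (s.arr 11 (LV i))
    have hstr : ∀ i, i < t → IsStride n (f + 1) (s.arr 11 (LV i)) (str i) := by
      intro i hi
      have hl := hLV.isLeaf i hi
      simp only [str]
      rw [ha₃ 13 (by decide)]
      obtain ⟨w, hw, hwl, hlen, -⟩ := hH.exists_top _ hl
      have hdep := (hH.spec hw).2.2
      have hlt := depth_lt (T := T) (lf w)
      have hpar := depth_par hw
      exact h₂ _ (by omega) (by omega)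
    have hmle := hH.multipleSeq_le hv hLV hstr
    have hmle' : ∀ i, i < t → multipleSeq str (i + 1) ≤ (f + 1) ^ K := by
      intro i hi
      rw [hK] at hmle
      rcases Nat.lt_or_ge (i + 1) t with hlt | hge
      · refine (multipleSeq_lt (fun m hm => ?_) hlt le_rfl).le.trans hmle
        obtain ⟨j, -, -, -, -, hj⟩ := hstr m hm
        rw [hj]
        exact Nat.pow_pos (by omega)
      · rwa [show i + 1 = t by omega]
    refine Runs.seq (index_spec (t := t) (LV := LV) (str := str)
      (hW' _ (by simp [drawProg, Prog.size]; omega)) hs₃ hnM (by rw [e1, e8]) htn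
      (fun i j hi hj => hLV.injOn hi hj) (fun i hi => by rw [e12, h12 i hi])
      (fun i hi => by rw [e11]) fun i hi => (hmle' i hi).trans (by omega)) ?_
    intro s₄ hs₄ h₄ ha₄ hr₄
    have hO : HasOrder T Q s₄ := hQ.congr
      (by rw [hr₄ 0 (by decide), hr₃ 0 (by decide), hr₂ 0 (by decide), hr₁ 0 (by decide)])
      (by rw [ha₄ 4 (by decide), ha₃ 4 (by decide), ha₂ 4 (by decide), ha₁ 4 (by decide)])
      (by rw [ha₄ 5 (by decide), ha₃ 5 (by decide), ha₂ 5 (by decide), ha₁ 5 (by decide)])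
    let ix : Fin n → ℕ := fun l => s₄.arr 19 l
    have hix : ∀ v, v ≠ T.root → ix (lf v) ≤ (f + 1) ^ K := by
      intro v hv'
      obtain ⟨i, hi, hiv⟩ := hLV.exists_eq _ (hH.spec hv').1
      rw [← hiv]
      simp only [ix]
      rw [h₄ i hi]
      exact hmle' i hi
    obtain ⟨B, R, a, hB, hR, ha, hvec⟩ := hH.optimalDraw hv hLV hstr (ix := ix) h₄
      (vec := fun v => gapVec (f + 1) d (Nat.clog (f + 1) n) (ix (lf v))) fun _ _ => rfl
    rw [hK] at hvec
    obtain ⟨x, y, hdraw, hxy⟩ := exists_nat_drawing hd hdf hB hR ha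
    obtain ⟨hroot, hstep⟩ := B.isDrawnBy_iff.1 hdraw
    have hvec' : ∀ v, v ≠ T.root → (s₄.arr 14 (heapOff (f + 1) K + ix (lf v)),
        s₄.arr 15 (heapOff (f + 1) K + ix (lf v))) = B.edgeVec a v := by
      intro v hv'
      rw [hvec v hv', ← h₃ _ (hix v hv'), ha₄ 14 (by decide), ha₄ 15 (by decide)]
    have e10' : s₄.arr 10 = s.arr 10 := by rw [ha₄ 10 (by decide), e10]
    have r10' : s₄.reg 10 = heapOff (f + 1) K := by
      rw [hr₄ 10 (by decide), hr₃ 10 (by decide), r10]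
    refine (draw_spec (x := x) (y := y) (r := fun v => heapOff (f + 1) K + ix (lf v))
      (hW' _ (by simp [drawProg, Prog.size]; omega)) hs₄ hO
      (fun i => by rw [ha₄ 2 (by decide), ha₃ 2 (by decide), ha₂ 2 (by decide), ha₁ 2 (by decide), a2])
      (fun i => by rw [ha₄ 3 (by decide), ha₃ 3 (by decide), ha₂ 3 (by decide), ha₁ 3 (by decide), a3])
      (by simpa using congrArg Prod.fst hroot) (by simpa using congrArg Prod.snd hroot)
      (fun v hv' => ⟨by rw [r10', e10', h10 v hv'], by have := hix v hv'; omega⟩)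
      (fun v hv' => ?_) (fun v hv' => ?_) (fun v => (hxy v).1.trans hM2)
      fun v => (hxy v).2.trans hM2).mono le_rfl ?_
    · have := congrArg Prod.fst (hstep v hv')
      rw [← hvec' v hv'] at this
      dsimp only at this ⊢
      exact_mod_cast this
    · have := congrArg Prod.snd (hstep v hv')
      rw [← hvec' v hv'] at this
      dsimp only at this ⊢
      exact_mod_cast this
    · intro s' hs'
      refine ⟨B, hB, R, hR, a, ha, ?_⟩
      convert hdraw using 1
      funext v
      simp only [output]
      rw [(hs' v).1, (hs' v).2]
  · have h5 : drawStep.cost + 20 ≤ 100 := by decide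
    have h6 : (n + 1) * (drawStep.cost + 20) ≤ (n + 1) * 100 := Nat.mul_le_mul_left _ h5
    have h7 : 2000 * (f + 1) * (n + 1) = 2000 * ((f + 1) * n) + 2000 * (f + 1) := by ring
    have h8 : (f + 1) * n = f * n + n := by ring
    omega

end RAM

namespace RAM

variable {n f d : ℕ} {T : OrderedTree n} {M W : ℕ}

theorem input_bdd (T : OrderedTree n) (hn : 2 * n ≤ M) (hf : f ≤ M) (hd : d ≤ M) :
    (input T f d).Bdd M := by
  refine ⟨fun x => ?_, fun a i => ?_⟩
  · have := T.root.2
    simp only [input]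
    rcases x with _ | _ | _ | _ | x <;> simp <;> omega
  · have := T.start_le i
    simp only [input]
    split_ifs
    · exact this.trans hn
    · omega
    · rw [List.getD_eq_getElem?_getD, List.getElem?_map]
      cases ((List.ofFn T.adj).flatten)[i]? with
      | none => simp
      | some w =>
        have := w.2
        simp only [Option.map_some, Option.getD_some]
        omega
    · omega

/-- A linear time implementation of Optimal Draw. -/
def optimalDrawProg : Prog := .seq treeProg drawProg

theorem optimalDrawProg_spec (hv : ValidPair f d) (T : OrderedTree n)
    (hM : 4 * (f + 1) * (d + 1) * n ≤ M) (hW : (M + 2) ^ optimalDrawProg.size ≤ W) :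
    Runs M W optimalDrawProg (input T f d) (3000 * (f + 1) * (n + 1))
      fun s' => OptimalDraw T f d (output n s') := by
  have hX : 0 < M + 2 := by omega
  have hn : 0 < n := T.root.pos
  have h1 : 4 * (f + 1) * (d + 1) * n =
      4 * (f * d * n) + 4 * (f * n) + 4 * (d * n) + 4 * n := by ring
  have h2 : f ≤ f * n := Nat.le_mul_of_pos_right _ hn
  have h3 : d ≤ d * n := Nat.le_mul_of_pos_right _ hn
  have hs : (input T f d).Bdd M := input_bdd T (by omega) (by omega) (by omega)
  refine Runs.mono (Runs.seq (t₂ := 2000 * (f + 1) * (n + 1)) (treeProg_spec (by omega)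
    ((Nat.pow_le_pow_right hX (by simp [optimalDrawProg, Prog.size])).trans hW) hs
    (hasTree_input T f d) fun a i ha => ?_) fun s₁ hs₁ h₁ ha₁ hr₁ => ?_) ?_ fun _ h => h
  · simp [input, show a ≠ 0 by omega, show a ≠ 1 by omega]
  · obtain ⟨Q, h, lf, LV, hQ, hH, hLV, htn, h12, h10⟩ := h₁
    exact drawProg_spec hv hM
      ((Nat.pow_le_pow_right hX (by simp [optimalDrawProg, Prog.size])).trans hW) hs₁ hQ hH hLV htn
      h12 h10 (by rw [hr₁ 1 (by decide)]; rfl) (by rw [hr₁ 2 (by decide)]; rfl)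
      (by rw [hr₁ 3 (by decide)]; rfl) (fun i => by rw [ha₁ 2 (by decide)]; simp [input])
      (fun i => by rw [ha₁ 3 (by decide)]; simp [input])
      fun i => by rw [ha₁ 15 (by decide)]; simp [input]
  · have : 3000 * (f + 1) * (n + 1) = 3000 * (f * n) + 3000 * f + 3000 * n + 3000 := by ring
    have : 2000 * (f + 1) * (n + 1) = 2000 * (f * n) + 2000 * f + 2000 * n + 2000 := by ring
    omega

/-- Optimal Draw runs in linear time with words of polynomial size. -/
theorem exists_exec_optimalDraw (hv : ValidPair f d) : ∃ C : ℕ,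
    ∀ (n : ℕ) (T : OrderedTree n), ∃ (τ : ℕ) (s : State),
      Exec (C * n ^ C) optimalDrawProg (input T f d) τ s ∧ τ ≤ C * n ∧
      OptimalDraw T f d (output n s) := by
  obtain ⟨m, hm⟩ : ∃ m, 4 * (f + 1) * (d + 1) = m := ⟨_, rfl⟩
  obtain ⟨σ, hσ⟩ : ∃ σ, optimalDrawProg.size = σ := ⟨_, rfl⟩
  -- The three summands take care of the factor and the exponent of the word bound `(m n + 2) ^ σ`,
  -- and of the running time, where `n + 1 ≤ 2 n`.
  obtain ⟨C, hC⟩ : ∃ C, (m + 2) ^ σ + σ + 6000 * (f + 1) = C := ⟨_, rfl⟩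
  refine ⟨C, fun n T => ?_⟩
  have hn : 0 < n := T.root.pos
  have h2n : 2 ≤ 2 * n := by omega
  have hW : (m * n + 2) ^ σ ≤ C * n ^ C :=
    calc (m * n + 2) ^ σ ≤ ((m + 2) * n) ^ σ :=
          Nat.pow_le_pow_left (by rw [add_mul]; exact Nat.add_le_add_left h2n _) σ
      _ = (m + 2) ^ σ * n ^ σ := mul_pow _ _ _
      _ ≤ C * n ^ C := Nat.mul_le_mul (by omega) (Nat.pow_le_pow_right hn (by omega))
  obtain ⟨τ, s, h1, h2, -, h3⟩ := optimalDrawProg_spec (M := m * n) (W := C * n ^ C) hv T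
    (by rw [hm]) (by rw [hσ]; exact hW)
  refine ⟨τ, s, h1, h2.trans ?_, h3⟩
  have h4 : 3000 * (f + 1) * (n + 1) ≤ 6000 * (f + 1) * n := by nlinarith
  have h5 : 6000 * (f + 1) ≤ C := hC ▸ Nat.le_add_left _ _
  exact h4.trans (Nat.mul_le_mul_right n h5)

end RAM

theorem theorem3 :
    -- correctness and size, for every way of making the arbitrary choices
    (∀ f d : ℕ, ValidPair f d →
      -- the construction of the vector family never gets stuck
      (∀ (j : ℕ) (R : ℕ → Finset (ℕ × ℕ)), IsVectorFamily f d j R →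
        ∃ R' : ℕ → Finset (ℕ × ℕ), (∀ i, 1 ≤ i → i ≤ j → R' i = R i) ∧
          IsVectorFamily f d (j + 1) R') ∧
      ∀ (n : ℕ) (T : OrderedTree n),
        (∃ B : PathDecomposition T, B.IsLengthDecreasing) ∧
        -- the vector assignment and the drawing step succeed
        (∀ B : PathDecomposition T, B.IsLengthDecreasing →
          ∀ R : ℕ → Finset (ℕ × ℕ), IsVectorFamily f d (Nat.clog (f + 1) n) R →
            (∃ a : Fin B.t → ℕ × ℕ, IsAssignment B (f + 1) R a) ∧
            ∀ a : Fin B.t → ℕ × ℕ, IsAssignment B (f + 1) R a →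
              ∃ pos : Fin n → ℤ × ℤ, IsDrawnBy B a pos) ∧
        ∀ pos : Fin n → ℤ × ℤ, OptimalDraw T f d pos →
          IsMonotoneDrawing T.graph pos ∧
          ∃ I : ℕ, (I : ℝ) ≤ ((f : ℝ) + 1) * (d : ℝ) / (((f : ℝ) + 1) - (d : ℝ)) * (n : ℝ) ∧
            IsOnGrid pos I) ∧
    -- linear running time on a word RAM with words of `O(log n)` bits
    ∃ p : RAM.Prog, ∀ f d : ℕ, ValidPair f d → ∃ C : ℕ,
      ∀ (n : ℕ) (T : OrderedTree n), ∃ (τ : ℕ) (s : RAM.State),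
        RAM.Exec (C * n ^ C) p (RAM.input T f d) τ s ∧
        τ ≤ C * n ∧
        OptimalDraw T f d (RAM.output n s) := by
  refine ⟨fun f d hv => ⟨fun j R hR => hR.exists_extension hv, fun n T => ⟨?_, ?_, ?_⟩⟩,
    RAM.optimalDrawProg, fun f d hv => RAM.exists_exec_optimalDraw hv⟩
  -- The existence of a length decreasing decomposition is read off from the program, whose output
  -- is a drawing by Optimal Draw.
  · obtain ⟨C, hC⟩ := RAM.exists_exec_optimalDraw hv
    obtain ⟨-, -, -, -, B, hB, -⟩ := hC n T
    exact ⟨B, hB⟩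
  · exact fun B _ R hR => ⟨B.exists_isAssignment hv.1 hv.2.1 hR, fun a _ => B.exists_isDrawnBy a⟩
  · rintro pos ⟨B, hB, R, hR, a, ha, hpos⟩
    exact ⟨(B.isSlopeDisjoint hv.2.1 hR ha hpos).isMonotoneDrawing,
      B.exists_isOnGrid hv.2.1 hv.2.2.1 hB hR ha hpos⟩
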